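/- There is an algorithm (a single real-RAM program, the same for all inputs) that, given a finite list of points in the plane $\mathbb{R}^2$ and a finite list of lower halfplanes $\{(x,y) : y \le a x + b\}$ (each given by the pair $(a,b)$), with $n$ the total number of listed points and halfplanes, halts within $T(n)$ steps, where $T(n) = O(n\log n)$, and outputs a smallest subset of the given halfplanes whose union covers all the points, or reports that the union of all given halfplanes does not cover the points. Here the real RAM performs each of the following in one step: addition, subtraction, multiplication, division and comparison of real numbers (exactly), the same operations on integer words of at most $O(\log n)$ bits (subtraction truncated at $0$, division rounding down), conversion of a word to a real, and access to an array entry at an address given by a word. It has no floor function on the reals, and its only constants are natural numbers. -/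

import Mathlib

/-! ## The real RAM

A word/real random access machine.  Its store consists of arrays of words (natural numbers) and
arrays of reals, and a program names finitely many of them; a scalar variable is an entry with a
literal index.  A program is a fixed finite text in a structured language with arithmetic on words,
exact arithmetic `+ - * /` and comparisons on reals, and array access at computed word indices.
A word can be converted to a real; the only way from reals back to words is to branch on a
comparison (in particular there is no floor function).  The only constants are natural numbers.
Every operation, array access and test costs one step. -/

namespace RealRAM

/-- The store: `word a i` and `real a i` are the `i`-th entries of the `a`-th arrays. -/
structure Store where
  word : ℕ → ℕ → ℕ
  real : ℕ → ℕ → ℝ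

/-- Overwrite the `i`-th entry of the `a`-th word array. -/
def Store.putWord (s : Store) (a i v : ℕ) : Store :=
  { s with word := Function.update s.word a (Function.update (s.word a) i v) }

/-- Overwrite the `i`-th entry of the `a`-th real array. -/
noncomputable def Store.putReal (s : Store) (a i : ℕ) (v : ℝ) : Store :=
  { s with real := Function.update s.real a (Function.update (s.real a) i v) }

/-- Word expressions; the array named in `get` is a literal, the index is computed. -/
inductive WordExpr where
  | lit (k : ℕ)
  | get (a : ℕ) (i : WordExpr)
  | add (e f : WordExpr)
  | sub (e f : WordExpr)
  | mul (e f : WordExpr)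
  | div (e f : WordExpr)

/-- The value of a word expression (subtraction is truncated, division rounds down). -/
def WordExpr.eval (s : Store) : WordExpr → ℕ
  | lit k => k
  | get a i => s.word a (i.eval s)
  | add e f => e.eval s + f.eval s
  | sub e f => e.eval s - f.eval s
  | mul e f => e.eval s * f.eval s
  | div e f => e.eval s / f.eval s

/-- The number of steps for evaluating a word expression. -/
def WordExpr.cost : WordExpr → ℕ
  | lit _ => 1
  | get _ i => i.cost + 1
  | add e f => e.cost + f.cost + 1
  | sub e f => e.cost + f.cost + 1
  | mul e f => e.cost + f.cost + 1
  | div e f => e.cost + f.cost + 1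

/-- Real expressions. -/
inductive RealExpr where
  | ofWord (e : WordExpr)
  | get (a : ℕ) (i : WordExpr)
  | add (e f : RealExpr)
  | sub (e f : RealExpr)
  | mul (e f : RealExpr)
  | div (e f : RealExpr)

/-- The value of a real expression (exact; a quotient by zero is zero). -/
noncomputable def RealExpr.eval (s : Store) : RealExpr → ℝ
  | ofWord e => (e.eval s : ℝ)
  | get a i => s.real a (i.eval s)
  | add e f => e.eval s + f.eval s
  | sub e f => e.eval s - f.eval s
  | mul e f => e.eval s * f.eval s
  | div e f => e.eval s / f.eval s

/-- The number of steps for evaluating a real expression. -/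
def RealExpr.cost : RealExpr → ℕ
  | ofWord e => e.cost + 1
  | get _ i => i.cost + 1
  | add e f => e.cost + f.cost + 1
  | sub e f => e.cost + f.cost + 1
  | mul e f => e.cost + f.cost + 1
  | div e f => e.cost + f.cost + 1

/-- Tests. -/
inductive Test where
  | wordEq (e f : WordExpr)
  | wordLt (e f : WordExpr)
  | realEq (e f : RealExpr)
  | realLt (e f : RealExpr)
  | neg (b : Test)
  | conj (b c : Test)
  | disj (b c : Test)

/-- The truth of a test in a store. -/
def Test.Holds (s : Store) : Test → Prop
  | wordEq e f => e.eval s = f.eval s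
  | wordLt e f => e.eval s < f.eval s
  | realEq e f => e.eval s = f.eval s
  | realLt e f => e.eval s < f.eval s
  | neg b => ¬ b.Holds s
  | conj b c => b.Holds s ∧ c.Holds s
  | disj b c => b.Holds s ∨ c.Holds s

/-- The number of steps for evaluating a test. -/
def Test.cost : Test → ℕ
  | wordEq e f => e.cost + f.cost + 1
  | wordLt e f => e.cost + f.cost + 1
  | realEq e f => e.cost + f.cost + 1
  | realLt e f => e.cost + f.cost + 1
  | neg b => b.cost + 1
  | conj b c => b.cost + c.cost + 1
  | disj b c => b.cost + c.cost + 1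

/-- Programs. -/
inductive Program where
  | skip
  | setWord (a : ℕ) (i e : WordExpr)
  | setReal (a : ℕ) (i : WordExpr) (e : RealExpr)
  | seq (p q : Program)
  | branch (b : Test) (p q : Program)
  | loop (b : Test) (p : Program)

/-- `Exec B p s t u`: on a machine whose words are the numbers below `B`, the program `p` started
in the store `s` halts after `t` steps in the store `u`.  A run that would store a word `≥ B`, or
write at an address `≥ B`, is stuck. -/
inductive Exec (B : ℕ) : Program → Store → ℕ → Store → Prop where
  | skip (s : Store) : Exec B .skip s 1 s
  | setWord (s : Store) (a : ℕ) (i e : WordExpr)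
      (hi : i.eval s < B) (he : e.eval s < B) :
      Exec B (.setWord a i e) s (i.cost + e.cost + 1) (s.putWord a (i.eval s) (e.eval s))
  | setReal (s : Store) (a : ℕ) (i : WordExpr) (e : RealExpr) (hi : i.eval s < B) :
      Exec B (.setReal a i e) s (i.cost + e.cost + 1) (s.putReal a (i.eval s) (e.eval s))
  | seq {p q : Program} {s u v : Store} {t₁ t₂ : ℕ}
      (hp : Exec B p s t₁ u) (hq : Exec B q u t₂ v) :
      Exec B (.seq p q) s (t₁ + t₂) v
  | branchTrue {b : Test} {p q : Program} {s u : Store} {t : ℕ}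
      (hb : b.Holds s) (hp : Exec B p s t u) :
      Exec B (.branch b p q) s (b.cost + 1 + t) u
  | branchFalse {b : Test} {p q : Program} {s u : Store} {t : ℕ}
      (hb : ¬ b.Holds s) (hq : Exec B q s t u) :
      Exec B (.branch b p q) s (b.cost + 1 + t) u
  | loopFalse {b : Test} {p : Program} {s : Store} (hb : ¬ b.Holds s) :
      Exec B (.loop b p) s (b.cost + 1) s
  | loopTrue {b : Test} {p : Program} {s u v : Store} {t₁ t₂ : ℕ}
      (hb : b.Holds s) (hp : Exec B p s t₁ u) (hl : Exec B (.loop b p) u t₂ v) :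
      Exec B (.loop b p) s (b.cost + 1 + t₁ + t₂) v

end RealRAM

/-! ## Coverage of points by lower halfplanes -/

/-- A lower halfplane, given by the slope and the intercept of its bounding line. -/
@[ext]
structure LowerHalfplane where
  slope : ℝ
  intercept : ℝ

/-- The points of the plane in the halfplane `y ≤ a * x + b`. -/
def LowerHalfplane.carrier (h : LowerHalfplane) : Set (ℝ × ℝ) :=
  {q | q.2 ≤ h.slope * q.1 + h.intercept}

/-- The union of the halfplanes in `S` covers all points of `P`. -/
def Covers (P : Set (ℝ × ℝ)) (S : Set LowerHalfplane) : Prop :=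
  P ⊆ ⋃ h ∈ S, h.carrier

/-- `S` is a smallest subset of `H` whose union covers `P`. -/
def IsSmallestCover (P : Set (ℝ × ℝ)) (H S : Set LowerHalfplane) : Prop :=
  S ⊆ H ∧ Covers P S ∧ ∀ S' ⊆ H, Covers P S' → S.encard ≤ S'.encard

/-- The input store: word array `0` holds the numbers of points and of halfplanes, real arrays
`0` and `1` hold the coordinates of the points, real arrays `2` and `3` the slopes and intercepts
of the bounding lines.  Everything else is zero. -/
def inputStore (points : List (ℝ × ℝ)) (halfplanes : List LowerHalfplane) : RealRAM.Store where
  word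
    | 0, 0 => points.length
    | 0, 1 => halfplanes.length
    | _, _ => 0
  real
    | 0, i => (points.map Prod.fst).getD i 0
    | 1, i => (points.map Prod.snd).getD i 0
    | 2, i => (halfplanes.map LowerHalfplane.slope).getD i 0
    | 3, i => (halfplanes.map LowerHalfplane.intercept).getD i 0
    | _, _ => 0

/-- The store `s` reports that there is no feasible solution. -/
def ReportsInfeasible (s : RealRAM.Store) : Prop :=
  s.word 1 0 = 0

/-- The store `s` reports the subset `S` of the given halfplanes: after the feasibility flag and
the number `k` of chosen halfplanes in word array `1`, the first `k` entries of word array `2` are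
the input positions of the elements of `S`, without repetition. -/
def ReportsSubset (s : RealRAM.Store) (halfplanes : List LowerHalfplane)
    (S : Set LowerHalfplane) : Prop :=
  s.word 1 0 = 1 ∧ ∃ sol : List LowerHalfplane, sol.Nodup ∧ {h | h ∈ sol} = S ∧
    (List.range (s.word 1 1)).map (fun j => halfplanes[s.word 2 j]?) = sol.map some

/-! Combinatorics. Sort the points by abscissa. In a cover `S` every point lies below the highest
line of `S` there, and a line that is highest in `S` at two points is highest at all points between
them. So a cover cuts the points into at most |S| blocks of consecutive points, each below one line,
and a smallest cover corresponds to a shortest such partition. One line may cover many separate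
blocks, and there can be too many maximal blocks to list. The crucial fact is that one block per
line suffices. Let `c u` be a highest of all given lines at the point `u`, let `K j` be the first
point where this highest line is at least as steep as line `j`, and let `[l j, r j)` be the maximal
block of line `j` around `K j` (`IsRunSystem`). By `IsRunSystem.exists_run`, in a feasible instance
every block covered by a line is contained in one of these runs. For if line `j` covers a block and
misses a point `u` between the block and `K j`, then a highest line at `u` is above `j` at `u`, and
the choice of `K j` puts its slope on the right side, so it stays above `j` on the whole block. It
can replace `j`, with a longer block.

What remains is covering an interval by intervals, where the greedy choice is optimal: from the
first uncovered point take the run that starts no later and reaches farthest. For the lower bound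
(`IsGreedy.le_encard`), take in an arbitrary cover the highest line at each point where a greedy
step starts. These lines are distinct, since a line occurring twice would give a run that beats a
greedy step. If the greedy choice is stuck, the instance is infeasible (`IsRunSystem.not_feasible`).

Time. The basic tool is `maximize`: for points sorted by abscissa, a linear scan builds the upper
hull of each block, and linear functions in monotone order of their parameter are maximized over the
hulls by popping points that no later query needs. Applied to the dual points (slope, intercept) it
yields `c`. The ends of all runs are found simultaneously by a search over aligned dyadic blocks
(`reach`), with one call of `maximize` per block width: a line with slope a and intercept b is above
a block iff the maximum of y - a x over the block is at most b. Left ends are right ends in the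
reflected input. Sorting is bottom-up merge sort, and everything else is linear.

Cost accounting. `Runs` bounds a run by the weight of the program text times a factor. Sequencing
keeps a common factor, and a loop multiplies it by its number of rounds plus one. So only numbers of
rounds have to be bounded, and the weight of the fixed text ends up in the constant of the O. -/

namespace RealRAM

/-! ### Structured reasoning about runs -/

instance : Add WordExpr := ⟨.add⟩
instance : Sub WordExpr := ⟨.sub⟩
instance : Mul WordExpr := ⟨.mul⟩
instance : Div WordExpr := ⟨.div⟩
instance : Add RealExpr := ⟨.add⟩
instance : Sub RealExpr := ⟨.sub⟩
instance : Mul RealExpr := ⟨.mul⟩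

@[simp] theorem WordExpr.eval_add (s : Store) (e f : WordExpr) :
    (e + f).eval s = e.eval s + f.eval s := rfl
@[simp] theorem WordExpr.eval_sub (s : Store) (e f : WordExpr) :
    (e - f).eval s = e.eval s - f.eval s := rfl
@[simp] theorem WordExpr.eval_mul (s : Store) (e f : WordExpr) :
    (e * f).eval s = e.eval s * f.eval s := rfl
@[simp] theorem WordExpr.eval_div (s : Store) (e f : WordExpr) :
    (e / f).eval s = e.eval s / f.eval s := rfl
@[simp] theorem WordExpr.eval_lit (s : Store) (k : ℕ) : (WordExpr.lit k).eval s = k := rfl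
@[simp] theorem WordExpr.eval_get (s : Store) (a : ℕ) (i : WordExpr) :
    (WordExpr.get a i).eval s = s.word a (i.eval s) := rfl
@[simp] theorem RealExpr.eval_add (s : Store) (e f : RealExpr) :
    (e + f).eval s = e.eval s + f.eval s := rfl
@[simp] theorem RealExpr.eval_sub (s : Store) (e f : RealExpr) :
    (e - f).eval s = e.eval s - f.eval s := rfl
@[simp] theorem RealExpr.eval_mul (s : Store) (e f : RealExpr) :
    (e * f).eval s = e.eval s * f.eval s := rfl
@[simp] theorem RealExpr.eval_get (s : Store) (a : ℕ) (i : WordExpr) :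
    (RealExpr.get a i).eval s = s.real a (i.eval s) := rfl
@[simp] theorem RealExpr.eval_ofWord (s : Store) (e : WordExpr) :
    (RealExpr.ofWord e).eval s = (e.eval s : ℝ) := rfl

@[simp] theorem Store.putWord_word_self (s : Store) (a i v : ℕ) :
    (s.putWord a i v).word a = Function.update (s.word a) i v := by
  simp [Store.putWord]
@[simp] theorem Store.putWord_word_of_ne (s : Store) {a b : ℕ} (i v : ℕ) (h : b ≠ a) :
    (s.putWord a i v).word b = s.word b := by
  simp [Store.putWord, h]
@[simp] theorem Store.putWord_real (s : Store) (a i v : ℕ) :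
    (s.putWord a i v).real = s.real := rfl
@[simp] theorem Store.putReal_real_self (s : Store) (a i : ℕ) (v : ℝ) :
    (s.putReal a i v).real a = Function.update (s.real a) i v := by
  simp [Store.putReal]
@[simp] theorem Store.putReal_real_of_ne (s : Store) {a b : ℕ} (i : ℕ) (v : ℝ) (h : b ≠ a) :
    (s.putReal a i v).real b = s.real b := by
  simp [Store.putReal, h]
@[simp] theorem Store.putReal_word (s : Store) (a i : ℕ) (v : ℝ) :
    (s.putReal a i v).word = s.word := rfl

/-- The number of steps of a run that executes every instruction of the text once. -/
def Program.weight : Program → ℕ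
  | skip => 1
  | setWord _ i e => i.cost + e.cost + 1
  | setReal _ i e => i.cost + e.cost + 1
  | seq p q => p.weight + q.weight
  | branch b p q => b.cost + 1 + p.weight + q.weight
  | loop b p => b.cost + 1 + p.weight

/-- Does the text contain an assignment to the `a`-th word array? -/
def Program.writesWord (a : ℕ) : Program → Bool
  | skip => false
  | setWord b _ _ => b == a
  | setReal _ _ _ => false
  | seq p q => p.writesWord a || q.writesWord a
  | branch _ p q => p.writesWord a || q.writesWord a
  | loop _ p => p.writesWord a

/-- Does the text contain an assignment to the `a`-th real array? -/
def Program.writesReal (a : ℕ) : Program → Bool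
  | skip => false
  | setWord _ _ _ => false
  | setReal b _ _ => b == a
  | seq p q => p.writesReal a || q.writesReal a
  | branch _ p q => p.writesReal a || q.writesReal a
  | loop _ p => p.writesReal a

/-- The stores agree on all arrays to which `p` contains no assignment. -/
structure Frame (p : Program) (s u : Store) : Prop where
  word : ∀ a, p.writesWord a = false → u.word a = s.word a
  real : ∀ a, p.writesReal a = false → u.real a = s.real a

theorem Frame.refl (p : Program) (s : Store) : Frame p s s := ⟨fun _ _ => rfl, fun _ _ => rfl⟩

theorem Frame.trans {p : Program} {s u v : Store} (h : Frame p s u) (h' : Frame p u v) :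
    Frame p s v :=
  ⟨fun a ha => (h'.word a ha).trans (h.word a ha), fun a ha => (h'.real a ha).trans (h.real a ha)⟩

theorem Frame.mono {p q : Program} {s u : Store} (h : Frame p s u)
    (hw : ∀ a, q.writesWord a = false → p.writesWord a = false)
    (hr : ∀ a, q.writesReal a = false → p.writesReal a = false) : Frame q s u :=
  ⟨fun a ha => h.word a (hw a ha), fun a ha => h.real a (hr a ha)⟩

/-- The frame condition is decided by the program text alone. For a concrete program and array the
side condition `writesWord a = false` computes, so it is discharged by `rfl` throughout. -/
theorem Exec.frame {B : ℕ} {p : Program} {s u : Store} {t : ℕ} (h : Exec B p s t u) :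
    Frame p s u := by
  induction h with
  | skip s => exact Frame.refl _ _
  | setWord s a i e hi he =>
    refine ⟨fun b hb => ?_, fun b _ => rfl⟩
    have : a ≠ b := by simpa [Program.writesWord] using hb
    simp [this.symm]
  | setReal s a i e hi =>
    refine ⟨fun b _ => rfl, fun b hb => ?_⟩
    have : a ≠ b := by simpa [Program.writesReal] using hb
    simp [this.symm]
  | seq hp hq ihp ihq =>
    refine Frame.trans (ihp.mono ?_ ?_) (ihq.mono ?_ ?_) <;>
      simp +contextual [Program.writesWord, Program.writesReal]
  | branchTrue hb hp ih =>
    refine ih.mono ?_ ?_ <;> simp +contextual [Program.writesWord, Program.writesReal]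
  | branchFalse hb hp ih =>
    refine ih.mono ?_ ?_ <;> simp +contextual [Program.writesWord, Program.writesReal]
  | loopFalse hb => exact Frame.refl _ _
  | loopTrue hb hp hl ihp ihl =>
    exact Frame.trans (ihp.mono (fun _ h => h) (fun _ h => h)) ihl

/-- Started in `s`, the program halts within `F` times its weight in a store satisfying `Q`. -/
def Runs (B F : ℕ) (p : Program) (s : Store) (Q : Store → Prop) : Prop :=
  ∃ t u, Exec B p s t u ∧ t ≤ p.weight * F ∧ Q u

theorem Runs.mono {B F F' : ℕ} {p : Program} {s : Store} {Q Q' : Store → Prop}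
    (h : Runs B F p s Q) (hF : F ≤ F') (hQ : ∀ u, Frame p s u → Q u → Q' u) :
    Runs B F' p s Q' := by
  obtain ⟨t, u, hx, ht, hq⟩ := h
  exact ⟨t, u, hx, ht.trans (Nat.mul_le_mul_left _ hF), hQ u hx.frame hq⟩

/-- Weights add up, so the factor `F` is not changed by sequencing. -/
theorem Runs.seq {B F : ℕ} {p q : Program} {s : Store} {Q R : Store → Prop}
    (hp : Runs B F p s Q)
    (hq : ∀ u, Frame p s u → Q u → Runs B F q u R) :
    Runs B F (.seq p q) s R := by
  obtain ⟨t, u, hx, ht, hQ⟩ := hp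
  obtain ⟨t', v, hx', ht', hR⟩ := hq u hx.frame hQ
  exact ⟨t + t', v, .seq hx hx', by simp only [Program.weight, add_mul]; omega, hR⟩

/-- A loop whose body takes `F` times its weight and decreases the measure `μ`. -/
theorem Runs.loop {B F : ℕ} {b : Test} {p : Program} {s₀ : Store} (I : Store → Prop)
    (μ : Store → ℕ) (G : ℕ) (h0 : I s₀) (hG : μ s₀ ≤ G) (hF : 1 ≤ F)
    (hbody : ∀ s, Frame p s₀ s → I s → b.Holds s →
      Runs B F p s (fun u => I u ∧ μ u < μ s)) :
    Runs B (F * (G + 1)) (.loop b p) s₀ (fun u => I u ∧ ¬ b.Holds u) := by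
  -- One last failing test, and at most `k` rounds of a test and a body each.
  have key : ∀ k s, Frame p s₀ s → I s → μ s ≤ k →
      ∃ t u, Exec B (.loop b p) s t u ∧
        t ≤ b.cost + 1 + k * (b.cost + 1 + p.weight * F) ∧ I u ∧ ¬ b.Holds u := by
    intro k
    induction k with
    | zero =>
      intro s hs hI hμ
      by_cases hb : b.Holds s
      · obtain ⟨t, u, -, -, -, hlt⟩ := hbody s hs hI hb
        omega
      · exact ⟨_, _, .loopFalse hb, by omega, hI, hb⟩
    | succ k ih =>
      intro s hs hI hμ
      by_cases hb : b.Holds s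
      · obtain ⟨t, u, hx, ht, hI', hlt⟩ := hbody s hs hI hb
        obtain ⟨t', v, hx', ht', hI'', hn⟩ := ih u (hs.trans hx.frame) hI' (by omega)
        exact ⟨_, v, .loopTrue hb hx hx', by rw [add_mul]; omega, hI'', hn⟩
      · exact ⟨_, _, .loopFalse hb, by omega, hI, hb⟩
  obtain ⟨t, u, hx, ht, hI, hn⟩ := key G s₀ (Frame.refl _ _) h0 hG
  refine ⟨t, u, hx, ht.trans ?_, hI, hn⟩
  simp only [Program.weight]
  -- As `1 ≤ F`, the cost of a test is at most `F` times itself, so tests and bodies share the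
  -- factor.
  calc b.cost + 1 + G * (b.cost + 1 + p.weight * F)
      ≤ (b.cost + 1) * F + p.weight * F + G * ((b.cost + 1) * F + p.weight * F) := by
        have : b.cost + 1 ≤ (b.cost + 1) * F := Nat.le_mul_of_pos_right _ hF
        have := Nat.mul_le_mul_left G (Nat.add_le_add_right this (p.weight * F))
        omega
    _ = _ := by ring

/-- Weakest preconditions of loop-free programs. -/
def wp (B : ℕ) : Program → Store → (Store → Prop) → Prop
  | .skip, s, Q => Q s
  | .setWord a i e, s, Q => i.eval s < B ∧ e.eval s < B ∧ Q (s.putWord a (i.eval s) (e.eval s))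
  | .setReal a i e, s, Q => i.eval s < B ∧ Q (s.putReal a (i.eval s) (e.eval s))
  | .seq p q, s, Q => wp B p s (wp B q · Q)
  | .branch b p q, s, Q => (b.Holds s → wp B p s Q) ∧ (¬ b.Holds s → wp B q s Q)
  | .loop _ _, _, _ => False

attribute [simp] wp Test.Holds

theorem wp.mono {B : ℕ} {p : Program} {s : Store} {Q Q' : Store → Prop} (h : wp B p s Q)
    (hQ : ∀ u, Q u → Q' u) : wp B p s Q' := by
  induction p generalizing s Q Q' with
  | skip => exact hQ _ h
  | setWord a i e => exact ⟨h.1, h.2.1, hQ _ h.2.2⟩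
  | setReal a i e => exact ⟨h.1, hQ _ h.2⟩
  | seq p q ihp ihq => exact ihp h fun _ hu => ihq hu hQ
  | branch b p q ihp ihq => exact ⟨fun hb => ihp (h.1 hb) hQ, fun hb => ihq (h.2 hb) hQ⟩
  | loop b p => exact h.elim

/-- Without loops each instruction is executed at most once, so the factor is 1. -/
theorem Runs.of_wp {B : ℕ} {p : Program} {s : Store} {Q : Store → Prop} (h : wp B p s Q) :
    Runs B 1 p s Q := by
  induction p generalizing s Q with
  | skip => exact ⟨1, s, .skip s, by simp [Program.weight], h⟩
  | setWord a i e => exact ⟨_, _, .setWord s a i e h.1 h.2.1, by simp [Program.weight], h.2.2⟩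
  | setReal a i e => exact ⟨_, _, .setReal s a i e h.1, by simp [Program.weight], h.2⟩
  | seq p q ihp ihq => exact Runs.seq (ihp h) fun _ _ hu => ihq hu
  | branch b p q ihp ihq =>
    by_cases hb : b.Holds s
    · obtain ⟨t, u, hx, ht, hQ⟩ := ihp (h.1 hb)
      exact ⟨_, u, .branchTrue hb hx, by simp only [Program.weight]; omega, hQ⟩
    · obtain ⟨t, u, hx, ht, hQ⟩ := ihq (h.2 hb)
      exact ⟨_, u, .branchFalse hb hx, by simp only [Program.weight]; omega, hQ⟩
  | loop b p => exact h.elim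

/-- Loop-free initialization followed by a loop. -/
theorem Runs.initLoop {B F : ℕ} {b : Test} {p q : Program} {s₀ : Store} (I : Store → Prop)
    (μ : Store → ℕ) (G : ℕ) (hF : 1 ≤ F) (hinit : wp B q s₀ (fun u => I u ∧ μ u ≤ G))
    (hbody : ∀ s, Frame (.seq q (.loop b p)) s₀ s → I s → b.Holds s →
      Runs B F p s (fun u => I u ∧ μ u < μ s)) :
    Runs B (F * (G + 1)) (.seq q (.loop b p)) s₀ (fun u => I u ∧ ¬ b.Holds u) := by
  refine Runs.seq ((Runs.of_wp hinit).mono (Nat.mul_pos hF (Nat.succ_pos _)) fun _ _ h => h)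
    fun u hu h => ?_
  refine Runs.loop I μ G h.1 h.2 hF fun s hs hI hb => hbody s ?_ hI hb
  refine Frame.trans (hu.mono ?_ ?_) (hs.mono ?_ ?_) <;>
    simp +contextual [Program.writesWord, Program.writesReal]

/-- Loop-free initialization followed by a loop with a loop-free body. -/
theorem Runs.simpleInitLoop {B : ℕ} {b : Test} {p q : Program} {s₀ : Store} (I : Store → Prop)
    (μ : Store → ℕ) (G : ℕ) (hinit : wp B q s₀ (fun u => I u ∧ μ u ≤ G))
    (hbody : ∀ s, Frame (.seq q (.loop b p)) s₀ s → I s → b.Holds s →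
      wp B p s (fun u => I u ∧ μ u < μ s)) :
    Runs B (G + 1) (.seq q (.loop b p)) s₀ (fun u => I u ∧ ¬ b.Holds u) := by
  have := Runs.initLoop (F := 1) I μ G le_rfl hinit
    fun s hs hI hb => Runs.of_wp (hbody s hs hI hb)
  simpa using this

infixr:60 " ;; " => Program.seq

/-- The scalar variable stored at the start of the `a`-th word array. -/
abbrev var (a : ℕ) : WordExpr := .get a (.lit 0)

/-- Assignment to a scalar variable. -/
abbrev assign (a : ℕ) (e : WordExpr) : Program := .setWord a (.lit 0) e

/-- `for v < e do p`, where `p` does not change `v`. -/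
abbrev forLoop (v : ℕ) (e : WordExpr) (p : Program) : Program :=
  assign v (.lit 0) ;; .loop (.wordLt (var v) e) (p ;; assign v (var v + .lit 1))

/-- Counting loops with a loop-free body. -/
theorem Runs.forLoop {B N : ℕ} {v : ℕ} {e : WordExpr} {p : Program} {s₀ : Store}
    (I : ℕ → Store → Prop) (hB : N < B)
    (he : ∀ s, Frame (forLoop v e p) s₀ s → e.eval s = N)
    (h0 : I 0 (s₀.putWord v 0 0))
    (hbody : ∀ i s, i < N → Frame (RealRAM.forLoop v e p) s₀ s → s.word v 0 = i → I i s →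
      wp B p s (fun u => u.word v 0 = i ∧ I (i + 1) (u.putWord v 0 (i + 1)))) :
    Runs B (N + 1) (RealRAM.forLoop v e p) s₀ (fun u => I N u) := by
  refine (Runs.simpleInitLoop (fun s => s.word v 0 ≤ N ∧ I (s.word v 0) s)
    (fun s => N - s.word v 0) N ?_ ?_).mono le_rfl ?_
  · simpa using ⟨by omega, h0⟩
  · intro s hfs hI hb
    have hlt : s.word v 0 < N := by
      have : s.word v 0 < e.eval s := by simpa [Test.Holds] using hb
      rwa [he s hfs] at this
    have hw := hbody _ s hlt hfs rfl hI.2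
    simp only [wp]
    refine hw.mono ?_
    rintro u ⟨hu, hI'⟩
    simp [hu]
    refine ⟨by omega, by omega, ⟨by omega, hI'⟩, by omega⟩
  · intro u hfs ⟨⟨hle, hI⟩, hn⟩
    have : ¬ u.word v 0 < e.eval u := by simpa [Test.Holds] using hn
    rw [he u hfs] at this
    have : u.word v 0 = N := by omega
    rwa [this] at hI

end RealRAM

namespace RealRAM

/-! ### Merge sort -/

/-- The list of the values of `f` on `[a, b)`. -/
def seg (f : ℕ → ℕ) (a b : ℕ) : List ℕ := (List.range' a (b - a)).map f

theorem seg_eq_nil {f : ℕ → ℕ} {a b : ℕ} (h : b ≤ a) : seg f a b = [] := by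
  simp [seg, Nat.sub_eq_zero_of_le h]

theorem seg_cons {f : ℕ → ℕ} {a b : ℕ} (h : a < b) : seg f a b = f a :: seg f (a + 1) b := by
  obtain ⟨k, rfl⟩ : ∃ k, b = a + k + 1 := ⟨b - a - 1, by omega⟩
  have h1 : a + k + 1 - a = k + 1 := by omega
  have h2 : a + k + 1 - (a + 1) = k := by omega
  simp [seg, h1, h2, List.range'_succ]

theorem seg_append {f : ℕ → ℕ} {a b c : ℕ} (hab : a ≤ b) (hbc : b ≤ c) :
    seg f a c = seg f a b ++ seg f b c := by
  obtain ⟨k, rfl⟩ := Nat.exists_eq_add_of_le hab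
  obtain ⟨l, rfl⟩ := Nat.exists_eq_add_of_le hbc
  have h1 : a + k + l - a = k + l := by omega
  have h2 : a + k - a = k := by omega
  have h3 : a + k + l - (a + k) = l := by omega
  simp only [seg, h1, h2, h3, ← List.map_append]
  rw [← List.range'_append_1]

theorem seg_snoc {f : ℕ → ℕ} {a b : ℕ} (h : a ≤ b) : seg f a (b + 1) = seg f a b ++ [f b] := by
  rw [seg_append h (Nat.le_succ b), seg_cons (Nat.lt_succ_self b), seg_eq_nil le_rfl]

theorem seg_congr {f g : ℕ → ℕ} {a b : ℕ} (h : ∀ i, a ≤ i → i < b → f i = g i) :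
    seg f a b = seg g a b := by
  refine List.map_congr_left fun i hi => ?_
  rw [List.mem_range'_1] at hi
  exact h i hi.1 (by omega)

theorem seg_update {f : ℕ → ℕ} {a b o v : ℕ} (h : b ≤ o) :
    seg (Function.update f o v) a b = seg f a b :=
  seg_congr fun i _ hi => Function.update_of_ne (by omega) _ _

/-- The consecutive blocks of width `w` of the first `N` entries are sorted. -/
def SortedBlocks (le : ℕ → ℕ → Bool) (f : ℕ → ℕ) (N w : ℕ) : Prop :=
  ∀ b, w ∣ b → b < N → (seg f b (min (b + w) N)).Pairwise fun x y => le x y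

/-- The state of a pass that merges neighbouring blocks of width `w` of `src` into `tmp`. -/
def MergeInv (le : ℕ → ℕ → Bool) (src : ℕ → ℕ) (N w : ℕ) (tmp : ℕ → ℕ) (o i j m e : ℕ) : Prop :=
  ∃ base, 2 * w ∣ base ∧ base ≤ o ∧ o ≤ e ∧ m = min (base + w) N ∧ e = min (base + 2 * w) N ∧
    i ≤ m ∧ m ≤ j ∧ j ≤ e ∧ (m - i) + (e - j) = e - o ∧
    seg tmp base o ++ List.merge (seg src i m) (seg src j e) le =
      List.merge (seg src base m) (seg src m e) le ∧
    (seg tmp 0 base).Perm (seg src 0 base) ∧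
    ∀ b, 2 * w ∣ b → b < base → (seg tmp b (min (b + 2 * w) N)).Pairwise fun x y => le x y

variable {le : ℕ → ℕ → Bool} {src tmp : ℕ → ℕ} {N w o i j m e : ℕ}

theorem MergeInv.init : MergeInv le src N w tmp 0 0 (min w N) (min w N) (min (2 * w) N) := by
  refine ⟨0, dvd_zero _, le_rfl, by omega, by simp, by simp, by omega, by omega, by omega,
    by omega, ?_, ?_, by omega⟩
  · simp [seg_eq_nil]
  · simp [seg_eq_nil]

/-- Moving the head of the remaining merge to the end of the finished prefix does not change their
concatenation, which is what the invariant records. Ties go to the left block, as in `List.merge`.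
The write at `o` is beyond all completed pairs of blocks. -/
theorem MergeInv.left (h : MergeInv le src N w tmp o i j m e) (hi : i < m)
    (hle : j < e → le (src i) (src j)) :
    MergeInv le src N w (Function.update tmp o (src i)) (o + 1) (i + 1) j m e := by
  obtain ⟨base, hd, hbo, hoe, hm, he, him, hmj, hje, hc, heq, hperm, hs⟩ := h
  refine ⟨base, hd, by omega, by omega, hm, he, by omega, hmj, hje, by omega, ?_, ?_, ?_⟩
  · rw [← heq, seg_snoc hbo, seg_update le_rfl, Function.update_self, seg_cons hi,
      List.append_assoc]
    congr 1
    rcases Nat.lt_or_ge j e with hj | hj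
    · rw [seg_cons hj, List.cons_merge_cons]
      simp [hle hj]
    · rw [seg_eq_nil hj]
      simp
  · rwa [seg_update hbo]
  · intro b hb hlt
    have hb2 : b + 2 * w ≤ base := by
      obtain ⟨c, rfl⟩ := hb
      obtain ⟨d, rfl⟩ := hd
      rw [← Nat.mul_succ]
      exact Nat.mul_le_mul_left _ (Nat.lt_of_mul_lt_mul_left hlt)
    rw [seg_update (by omega)]
    exact hs b hb hlt

theorem MergeInv.right (h : MergeInv le src N w tmp o i j m e) (hj : j < e)
    (hle : i < m → ¬ le (src i) (src j)) :
    MergeInv le src N w (Function.update tmp o (src j)) (o + 1) i (j + 1) m e := by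
  obtain ⟨base, hd, hbo, hoe, hm, he, him, hmj, hje, hc, heq, hperm, hs⟩ := h
  refine ⟨base, hd, by omega, by omega, hm, he, by omega, by omega, by omega, by omega, ?_, ?_, ?_⟩
  · rw [← heq, seg_snoc hbo, seg_update le_rfl, Function.update_self, seg_cons hj,
      List.append_assoc]
    congr 1
    rcases Nat.lt_or_ge i m with hi | hi
    · rw [seg_cons hi, List.cons_merge_cons]
      simp [hle hi]
    · rw [seg_eq_nil hi]
      simp
  · rwa [seg_update hbo]
  · intro b hb hlt
    have hb2 : b + 2 * w ≤ base := by
      obtain ⟨c, rfl⟩ := hb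
      obtain ⟨d, rfl⟩ := hd
      rw [← Nat.mul_succ]
      exact Nat.mul_le_mul_left _ (Nat.lt_of_mul_lt_mul_left hlt)
    rw [seg_update (by omega)]
    exact hs b hb hlt

/-- With `o = e` both remainders are empty, so the prefix of the current pair is the complete merge
of its two sorted blocks. The right block may be cut short by `N`, or be empty. -/
theorem MergeInv.block (htr : ∀ a b c, le a b → le b c → le a c) (htot : ∀ a b, le a b || le b a)
    (hsrc : SortedBlocks le src N w) (h : MergeInv le src N w tmp e i j m e) :
    (seg tmp 0 e).Perm (seg src 0 e) ∧
    ∀ b, 2 * w ∣ b → b < e → (seg tmp b (min (b + 2 * w) N)).Pairwise fun x y => le x y := by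
  obtain ⟨base, hd, hbo, hoe, hm, he, him, hmj, hje, hc, heq, hperm, hs⟩ := h
  have hmi : m ≤ i := by omega
  have hej : e ≤ j := by omega
  rw [seg_eq_nil hmi, seg_eq_nil hej] at heq
  simp only [List.merge_right, List.append_nil] at heq
  have hme : m ≤ e := by omega
  constructor
  · rw [seg_append (Nat.zero_le base) hbo, seg_append (Nat.zero_le base) hbo (f := src)]
    refine hperm.append ?_
    rw [heq]
    by_cases hbm : base ≤ m
    · rw [seg_append hbm hme]
      exact List.merge_perm_append _
    · have : e = base := by omega
      rw [seg_eq_nil (by omega), seg_eq_nil (by omega), seg_eq_nil (by omega)]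
      simp
  · intro b hb hlt
    rcases Nat.lt_or_ge b base with hbb | hbb
    · exact hs b hb hbb
    · have hb2 : b = base := by
        by_contra hne
        have : base + 2 * w ≤ b := by
          obtain ⟨c, rfl⟩ := hb
          obtain ⟨d, rfl⟩ := hd
          rw [← Nat.mul_succ]
          exact Nat.mul_le_mul_left _ (Nat.lt_of_mul_lt_mul_left (by omega : 2 * w * d < 2 * w * c))
        omega
      subst hb2
      rw [← he, heq]
      refine List.pairwise_merge htr htot _ _ ?_ ?_
      · have := hsrc b ((Dvd.intro_left 2 rfl).trans hb) (by omega)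
        rwa [← hm] at this
      · rcases Nat.lt_or_ge (b + w) N with hN | hN
        · have := hsrc (b + w) ((Nat.dvd_add_right ((Dvd.intro_left 2 rfl).trans hb)).2 dvd_rfl) hN
          have h1 : m = b + w := by omega
          have h2 : e = min (b + w + w) N := by omega
          rwa [h1, h2]
        · rw [seg_eq_nil (by omega)]
          exact List.Pairwise.nil

/-- Since `e < N`, the finished pair was not cut off, so `e` is again a multiple of `2 * w` and can
serve as the new base. -/
theorem MergeInv.next (htr : ∀ a b c, le a b → le b c → le a c)
    (htot : ∀ a b, le a b || le b a) (hsrc : SortedBlocks le src N w)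
    (h : MergeInv le src N w tmp e i j m e) (hN : e < N) :
    MergeInv le src N w tmp e e (min (e + w) N) (min (e + w) N) (min (e + 2 * w) N) := by
  obtain ⟨hp, hs⟩ := h.block htr htot hsrc
  obtain ⟨base, hd, hbo, hoe, hm, he, -⟩ := h
  refine ⟨e, ?_, le_rfl, by omega, rfl, rfl, by omega, by omega, by omega, by omega, ?_, hp, hs⟩
  · have : e = base + 2 * w := by omega
    rw [this]
    exact (Nat.dvd_add_right hd).2 dvd_rfl
  · simp [seg_eq_nil]

notation "sN" => (3 : ℕ)
notation "sIdx" => (4 : ℕ)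
notation "sTmp" => (5 : ℕ)
notation "sW" => (6 : ℕ)
notation "sO" => (7 : ℕ)
notation "sI" => (8 : ℕ)
notation "sJ" => (9 : ℕ)
notation "sM" => (10 : ℕ)
notation "sE" => (11 : ℕ)
notation "rKey" => (4 : ℕ)

/-- The minimum of two words. -/
abbrev wmin (e f : WordExpr) : WordExpr := e - (e - f)

/-- One pass of merge sort: merge blocks of width `sW` of `sIdx` into `sTmp`. -/
def mergePass : Program :=
  (assign sO (.lit 0) ;; assign sI (.lit 0) ;; assign sJ (wmin (var sW) (var sN)) ;;
    assign sM (var sJ) ;; assign sE (wmin (.lit 2 * var sW) (var sN))) ;;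
  .loop (.wordLt (var sO) (var sN))
    (.branch (.wordEq (var sO) (var sE))
      (assign sI (var sO) ;; assign sJ (wmin (var sO + var sW) (var sN)) ;;
        assign sM (var sJ) ;; assign sE (wmin (var sO + .lit 2 * var sW) (var sN)))
      .skip ;;
    .branch (.conj (.wordLt (var sI) (var sM)) (.disj (.neg (.wordLt (var sJ) (var sE)))
        (.neg (.realLt (.get rKey (.get sIdx (var sJ))) (.get rKey (.get sIdx (var sI)))))))
      (.setWord sTmp (var sO) (.get sIdx (var sI)) ;; assign sI (var sI + .lit 1))
      (.setWord sTmp (var sO) (.get sIdx (var sJ)) ;; assign sJ (var sJ + .lit 1)) ;;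
    assign sO (var sO + .lit 1))

/-- The order of indices by their keys. -/
noncomputable def keyLe (key : ℕ → ℝ) (a b : ℕ) : Bool := decide (key a ≤ key b)

theorem keyLe_trans (key : ℕ → ℝ) (a b c : ℕ) (h : keyLe key a b) (h' : keyLe key b c) :
    keyLe key a c := by
  simp only [keyLe, decide_eq_true_eq] at *
  exact h.trans h'

theorem keyLe_total (key : ℕ → ℝ) (a b : ℕ) : keyLe key a b || keyLe key b a := by
  simpa [keyLe] using le_total (key a) (key b)

theorem min_eq_sub (a b : ℕ) : a - (a - b) = min a b := by omega

theorem mergePass_runs {B N w : ℕ} {s : Store} (hN : s.word sN 0 = N) (hw : s.word sW 0 = w)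
    (hw0 : 0 < w) (hwN : w < N) (hB : 4 * N < B) (hidx : ∀ i < N, s.word sIdx i < N)
    (hsorted : SortedBlocks (keyLe (s.real rKey)) (s.word sIdx) N w) :
    Runs B (N + 1) mergePass s (fun u => SortedBlocks (keyLe (s.real rKey)) (u.word sTmp) N (2 * w) ∧
      (seg (u.word sTmp) 0 N).Perm (seg (s.word sIdx) 0 N)) := by
  have htr := keyLe_trans (s.real rKey)
  have htot := keyLe_total (s.real rKey)
  refine (Runs.simpleInitLoop (fun u => u.word sO 0 ≤ N ∧ MergeInv (keyLe (s.real rKey))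
      (s.word sIdx) N w (u.word sTmp) (u.word sO 0) (u.word sI 0) (u.word sJ 0) (u.word sM 0)
      (u.word sE 0)) (fun u => N - u.word sO 0) N ?_ ?_).mono le_rfl ?_
  · simp [hN, hw, min_eq_sub]
    and_intros <;> first | omega | exact MergeInv.init
  · rintro u hf ⟨hle, hI⟩ hb
    have h1 := hf.word sN rfl
    have h2 := hf.word sIdx rfl
    have h3 := hf.word sW rfl
    have h4 := hf.real rKey rfl
    simp [h1, hN] at hb
    simp only [wp, Test.Holds, WordExpr.eval_lit, WordExpr.eval_get, WordExpr.eval_sub,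
      WordExpr.eval_mul, WordExpr.eval_add, RealExpr.eval_get, Store.putWord_word_self,
      Store.putWord_word_of_ne, Store.putWord_real, Function.update_self, ne_eq,
      Nat.reduceEqDiff, not_false_eq_true, min_eq_sub, h1, h2, h3, h4, hN, hw]
    generalize u.word sI 0 = i at *
    generalize u.word sJ 0 = j at *
    generalize u.word sM 0 = m at *
    generalize u.word sE 0 = e at *
    generalize u.word sO 0 = o at *
    -- This is stated for arbitrary `i j m e`, because it is needed both for the current pair of
    -- blocks and for the pair that has just been opened when `o = e`.
    have step : ∀ i j m e, MergeInv (keyLe (s.real rKey)) (s.word sIdx) N w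
        (u.word sTmp) o i j m e → o < e →
        (i < m ∧ (¬ j < e ∨ ¬ s.real rKey (s.word sIdx j) < s.real rKey (s.word sIdx i)) →
          s.word sIdx i < N ∧ i < N ∧ MergeInv (keyLe (s.real rKey)) (s.word sIdx) N w
          (Function.update (u.word sTmp) o (s.word sIdx i)) (o + 1) (i + 1) j m e) ∧
        (¬ (i < m ∧ (¬ j < e ∨ ¬ s.real rKey (s.word sIdx j) < s.real rKey (s.word sIdx i))) →
          s.word sIdx j < N ∧ j < N ∧ MergeInv (keyLe (s.real rKey)) (s.word sIdx) N w
          (Function.update (u.word sTmp) o (s.word sIdx j)) (o + 1) i (j + 1) m e) := by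
      intro i j m e h hoe
      obtain ⟨base, _, _, _, hm, he, him, hmj, hje, hc, _⟩ := id h
      constructor
      · rintro ⟨hi, hor⟩
        refine ⟨hidx _ (by omega), by omega, h.left hi fun hj => ?_⟩
        have := hor.resolve_left (by omega)
        simpa [keyLe] using this
      · intro hn
        have hj : j < e := by
          by_contra hj
          exact hn ⟨by omega, Or.inl hj⟩
        refine ⟨hidx _ (by omega), by omega, h.right hj fun hi hle => hn ⟨hi, Or.inr ?_⟩⟩
        simpa [keyLe] using hle
    refine ⟨fun hoe => ?_, fun hoe => ?_⟩
    · subst hoe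
      obtain ⟨hl, hr⟩ := step _ _ _ _ (MergeInv.next htr htot hsorted hI hb) (by omega)
      and_intros <;> first | omega | skip
      · intro hc
        obtain ⟨h5, h6, h7⟩ := hl hc
        and_intros <;> omega
      · intro hc
        obtain ⟨h5, h6, h7⟩ := hr hc
        and_intros <;> omega
    · obtain ⟨hl, hr⟩ := step _ _ _ _ hI (by obtain ⟨_, _, _, h, _⟩ := hI; omega)
      and_intros
      · intro hc
        obtain ⟨h5, h6, h7⟩ := hl hc
        and_intros <;> omega
      · intro hc
        obtain ⟨h5, h6, h7⟩ := hr hc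
        and_intros <;> omega
  · rintro u hf ⟨⟨hle, hI⟩, hb⟩
    simp [hf.word sN rfl, hN] at hb
    obtain rfl : u.word sO 0 = N := by omega
    have he : u.word sE 0 = u.word sO 0 := by
      obtain ⟨base, _, _, _, _, he, _⟩ := hI
      omega
    rw [he] at hI
    obtain ⟨hp, hs⟩ := hI.block htr htot hsorted
    exact ⟨hs, hp⟩

/-- `idx` lists the indices below `N` in the order of their keys. -/
structure IsSorting (key : ℕ → ℝ) (N : ℕ) (idx : ℕ → ℕ) : Prop where
  lt : ∀ i < N, idx i < N
  surj : ∀ v < N, ∃ i < N, idx i = v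
  mono : ∀ i j, i ≤ j → j < N → key (idx i) ≤ key (idx j)

theorem mem_seg {f : ℕ → ℕ} {a b x : ℕ} : x ∈ seg f a b ↔ ∃ i, a ≤ i ∧ i < b ∧ f i = x := by
  simp only [seg, List.mem_map, List.mem_range'_1]
  constructor
  · rintro ⟨i, ⟨h1, h2⟩, rfl⟩
    exact ⟨i, h1, by omega, rfl⟩
  · rintro ⟨i, h1, h2, rfl⟩
    exact ⟨i, ⟨h1, by omega⟩, rfl⟩

theorem IsSorting.of_perm {key : ℕ → ℝ} {N w : ℕ} {idx : ℕ → ℕ} (hw : N ≤ w)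
    (hs : SortedBlocks (keyLe key) idx N w) (hp : (seg idx 0 N).Perm (seg id 0 N)) :
    IsSorting key N idx := by
  refine ⟨fun i hi => ?_, fun v hv => ?_, fun i j hij hj => ?_⟩
  · have := hp.mem_iff.1 (mem_seg.2 ⟨i, by omega, hi, rfl⟩)
    obtain ⟨k, -, hk, h⟩ := mem_seg.1 this
    simp only [id] at h
    omega
  · have := hp.mem_iff.2 (mem_seg.2 ⟨v, by omega, hv, rfl⟩)
    obtain ⟨k, -, hk, h⟩ := mem_seg.1 this
    exact ⟨k, hk, h⟩
  · rcases hij.eq_or_lt with rfl | hij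
    · exact le_rfl
    have := hs 0 (dvd_zero _) (by omega)
    rw [show min (0 + w) N = N by omega, seg_append (Nat.zero_le j) hj.le,
      List.pairwise_append] at this
    have := this.2.2 (idx i) (mem_seg.2 ⟨i, by omega, hij, rfl⟩) (idx j)
      (mem_seg.2 ⟨j, le_rfl, hj, rfl⟩)
    simpa [keyLe] using this

/-- Copy `sTmp` to `sIdx`. -/
def copyBack : Program := forLoop sO (var sN) (.setWord sIdx (var sO) (.get sTmp (var sO)))

/-- Merge sort: sorts the indices below `sN` by the keys `rKey` into `sIdx`. -/
def mergeSort : Program :=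
  forLoop sO (var sN) (.setWord sIdx (var sO) (var sO)) ;;
  assign sW (.lit 1) ;;
  .loop (.wordLt (var sW) (var sN)) (mergePass ;; copyBack ;; assign sW (var sW + var sW))

theorem copyBack_runs {B N : ℕ} {s : Store} (hN : s.word sN 0 = N) (hB : N < B)
    (hidx : ∀ i < N, s.word sTmp i < B) :
    Runs B (N + 1) copyBack s (fun u => ∀ i < N, u.word sIdx i = s.word sTmp i) := by
  refine Runs.forLoop (fun k u => ∀ i < k, u.word sIdx i = s.word sTmp i) hB ?_ (by simp) ?_
  · intro u hf
    simp [hf.word sN rfl, hN]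
  · intro k u hk hf hv hI
    simp [hf.word sTmp rfl, hv, Function.update_apply]
    refine ⟨by omega, hidx k hk, fun i hi => ?_⟩
    split_ifs with h
    · rw [h]
    · exact hI i (by omega)

theorem mergeSort_runs {B N : ℕ} {s : Store} (hN : s.word sN 0 = N) (hB : 4 * N + 1 < B) :
    Runs B ((N + 1) * (Nat.log 2 N + 2)) mergeSort s
      (fun u => IsSorting (s.real rKey) N (u.word sIdx)) := by
  have hF : N + 1 ≤ (N + 1) * (Nat.log 2 N + 2) := Nat.le_mul_of_pos_right _ (by omega)
  have hinit : Runs B (N + 1) (forLoop sO (var sN) (.setWord sIdx (var sO) (var sO))) s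
      (fun u => ∀ i < N, u.word sIdx i = i) := by
    refine Runs.forLoop (fun k u => ∀ i < k, u.word sIdx i = i) (by omega) ?_ (by simp) ?_
    · intro u hf
      simp [hf.word sN rfl, hN]
    · intro k u hk hf hv hI
      simp [hv, Function.update_apply]
      refine ⟨by omega, fun i hi => ?_⟩
      split_ifs with h
      · rw [h]
      · exact hI i (by omega)
  refine Runs.seq (hinit.mono hF fun _ _ h => h) fun s₁ hf₁ h₁ => ?_
  have hN₁ : s₁.word sN 0 = N := by rw [hf₁.word sN rfl, hN]
  refine (Runs.initLoop (F := N + 1) (fun u => (∃ k, u.word sW 0 = 2 ^ k) ∧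
      SortedBlocks (keyLe (s.real rKey)) (u.word sIdx) N (u.word sW 0) ∧
      (seg (u.word sIdx) 0 N).Perm (seg id 0 N))
    -- The width doubles in every round, so its logarithm counts the passes.
    (fun u => Nat.log 2 N + 1 - Nat.log 2 (u.word sW 0)) (Nat.log 2 N + 1)
    (by omega) ?_ ?_).mono le_rfl ?_
  · simp
    refine ⟨by omega, by omega, ⟨0, by simp⟩, ?_, ?_⟩
    · intro b hb hbN
      rw [seg_cons (by omega), seg_eq_nil (by omega)]
      simp
    · rw [seg_congr (g := id) fun i _ hi => by simpa using h₁ i hi]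
  · rintro u hf ⟨⟨k, hk⟩, hs, hp⟩ hb
    have hNu : u.word sN 0 = N := by rw [hf.word sN rfl, hN₁]
    have hkey : u.real rKey = s.real rKey := by rw [hf.real rKey rfl, hf₁.real rKey rfl]
    have hwN : u.word sW 0 < N := by simpa [hNu] using hb
    have hlt : ∀ i < N, u.word sIdx i < N := by
      intro i hi
      obtain ⟨j, -, hj, h⟩ := mem_seg.1 (hp.mem_iff.1 (mem_seg.2 ⟨i, by omega, hi, rfl⟩))
      simp only [id] at h
      omega
    refine Runs.seq (mergePass_runs hNu rfl (by rw [hk]; positivity) hwN (by omega) hlt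
      (hkey ▸ hs)) fun v hfv hv => ?_
    have hp' := hv.2.trans hp
    have hlt' : ∀ i < N, v.word sTmp i < N := by
      intro i hi
      obtain ⟨j, -, hj, h⟩ := mem_seg.1 (hp'.mem_iff.1 (mem_seg.2 ⟨i, by omega, hi, rfl⟩))
      simp only [id] at h
      omega
    refine Runs.seq (copyBack_runs (N := N) (by rw [hfv.word sN rfl, hNu]) (by omega)
      fun i hi => (hlt' i hi).trans (by omega)) fun v' hfv' hv' => ?_
    refine (Runs.of_wp ?_).mono (by omega : 1 ≤ N + 1) fun _ _ h => h
    have hw' : v'.word sW 0 = u.word sW 0 := by rw [hfv'.word sW rfl, hfv.word sW rfl]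
    have hseg : ∀ a b, b ≤ N → seg (v'.word sIdx) a b = seg (v.word sTmp) a b :=
      fun a b hb => seg_congr fun i _ hi => hv' i (by omega)
    simp [hw']
    refine ⟨by omega, by omega, ⟨⟨k + 1, by rw [hk]; ring⟩, ?_, ?_⟩, ?_⟩
    · intro b hb hbN
      have := hv.1 b (by rwa [two_mul]) hbN
      rw [hseg _ _ (by omega), ← two_mul, ← hkey]
      exact this
    · rwa [hseg _ _ le_rfl]
    · rw [← two_mul, mul_comm, hk, ← pow_succ, Nat.log_pow one_lt_two, Nat.log_pow one_lt_two]
      have : k ≤ Nat.log 2 N := Nat.le_log_of_pow_le one_lt_two (by omega)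
      omega
  · rintro u hf ⟨⟨-, hs, hp⟩, hb⟩
    have hNu : u.word sN 0 = N := by rw [hf.word sN rfl, hN₁]
    exact IsSorting.of_perm (by simpa [hNu] using hb) hs hp

end RealRAM

namespace RealRAM

/-! ### Upper hulls of consecutive blocks, and linear maximization over them -/

/-- The value of the linear function `v + ω u` at the `k`-th point. -/
def linVal (U V : ℕ → ℝ) (ω : ℝ) (k : ℕ) : ℝ := V k + ω * U k

/-- The `c` entries of `st` from `a` on are increasing positions in `[a, i)`, and along them every
linear function is strictly unimodal. -/
structure IsChain (U V : ℕ → ℝ) (st : ℕ → ℕ) (a c i : ℕ) : Prop where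
  pos : 1 ≤ c
  le : a + c ≤ i
  mem : ∀ t < c, a ≤ st (a + t) ∧ st (a + t) < i
  incr : ∀ t, t + 1 < c → st (a + t) < st (a + (t + 1))
  unimodal : ∀ t, t + 2 < c → ∀ ω, linVal U V ω (st (a + (t + 1))) <
    linVal U V ω (st (a + (t + 2))) → linVal U V ω (st (a + t)) < linVal U V ω (st (a + (t + 1)))

/-- Every linear function is maximized over `[a, i)` on the chain. -/
structure IsHull (U V : ℕ → ℝ) (st : ℕ → ℕ) (a c i : ℕ) : Prop extends IsChain U V st a c i where
  dom : ∀ k, a ≤ k → k < i → ∀ ω, ∃ t < c, linVal U V ω k ≤ linVal U V ω (st (a + t))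

/-- Every linear function is maximized over `[a, i]` on the chain or at `i`. -/
structure IsPartialHull (U V : ℕ → ℝ) (st : ℕ → ℕ) (a c i : ℕ) : Prop
    extends IsChain U V st a c i where
  dom : ∀ k, a ≤ k → k < i → ∀ ω,
    (∃ t < c, linVal U V ω k ≤ linVal U V ω (st (a + t))) ∨ linVal U V ω k ≤ linVal U V ω i

/-- The middle one of three points in horizontal order is redundant. -/
def Redundant (U V : ℕ → ℝ) (x y z : ℕ) : Prop :=
  ¬ (V z - V y) * (U y - U x) < (V y - V x) * (U z - U y) ∧
    (¬ (0 : ℝ) < V y - V x ∨ ¬ V z - V y < 0)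

variable {U V : ℕ → ℝ} {st : ℕ → ℕ} {a c i : ℕ}

theorem IsChain.congr {st' : ℕ → ℕ} (h : IsChain U V st a c i)
    (hst : ∀ t < c, st' (a + t) = st (a + t)) : IsChain U V st' a c i := by
  refine ⟨h.pos, h.le, fun t ht => ?_, fun t ht => ?_, fun t ht => ?_⟩
  · rw [hst t ht]; exact h.mem t ht
  · rw [hst t (by omega), hst _ ht]; exact h.incr t ht
  · rw [hst t (by omega), hst _ (by omega : t + 1 < c), hst _ ht]; exact h.unimodal t ht

theorem IsHull.congr {st' : ℕ → ℕ} (h : IsHull U V st a c i)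
    (hst : ∀ t < c, st' (a + t) = st (a + t)) : IsHull U V st' a c i := by
  refine ⟨h.toIsChain.congr hst, fun k hk hki ω => ?_⟩
  obtain ⟨t, ht, hle⟩ := h.dom k hk hki ω
  exact ⟨t, ht, by rwa [hst t ht]⟩

theorem IsHull.toPartial (h : IsHull U V st a c i) : IsPartialHull U V st a c i :=
  ⟨h.toIsChain, fun k hk hki ω => Or.inl (h.dom k hk hki ω)⟩

theorem IsHull.single (h : st a = a) : IsHull U V st a 1 (a + 1) := by
  refine ⟨⟨le_rfl, le_rfl, fun t ht => ?_, fun t ht => by omega, fun t ht => by omega⟩,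
    fun k hk hki ω => ⟨0, by omega, ?_⟩⟩
  · obtain rfl : t = 0 := by omega
    simp [h]
  · obtain rfl : k = a := by omega
    simp [h]

theorem IsChain.pop (h : IsChain U V st a c i) (hc : 1 < c) : IsChain U V st a (c - 1) i :=
  ⟨by omega, by have := h.le; omega, fun t ht => h.mem t (by omega),
    fun t ht => h.incr t (by omega), fun t ht => h.unimodal t (by omega)⟩

/-- If `y` beats both neighbours for `ω`, multiply the two strict inequalities by the opposite
horizontal distances and subtract: `ω` cancels and the first clause of `Redundant` forces both
products to vanish. Then the three abscissas agree, a degenerate case excluded by the second clause,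
which keeps a `y` strictly above both others. -/
theorem le_or_le_of_redundant {x y z : ℕ} (h : Redundant U V x y z) (hxy : U x ≤ U y)
    (hyz : U y ≤ U z) (ω : ℝ) :
    linVal U V ω y ≤ linVal U V ω x ∨ linVal U V ω y ≤ linVal U V ω z := by
  by_contra! hc
  obtain ⟨h1, h2⟩ := hc
  obtain ⟨h3, h4⟩ := h
  simp only [linVal] at h1 h2
  have d1 : 0 ≤ U y - U x := by linarith
  have d2 : 0 ≤ U z - U y := by linarith
  have e1 : 0 < (V y - V x) + ω * (U y - U x) := by linarith
  have e2 : (V z - V y) + ω * (U z - U y) < 0 := by linarith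
  have p1 := mul_nonneg e1.le d2
  have p2 := mul_nonpos_of_nonpos_of_nonneg e2.le d1
  have q1 : ((V y - V x) + ω * (U y - U x)) * (U z - U y) = 0 := by nlinarith
  have q2 : ((V z - V y) + ω * (U z - U y)) * (U y - U x) = 0 := by nlinarith
  have r1 : U z - U y = 0 := (mul_eq_zero.1 q1).resolve_left e1.ne'
  have r2 : U y - U x = 0 := (mul_eq_zero.1 q2).resolve_left e2.ne
  rw [r2] at e1
  rw [r1] at e2
  rcases h4 with h4 | h4
  · exact h4 (by linarith)
  · exact h4 (by linarith)

/-- If the turn at `y` is strictly concave, cross multiplication transports the sign of the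
increment backwards. Otherwise `y` is above both neighbours, so an increase from `y` to `z` needs `ω
> 0`, and then the step from `x` to `y` increases as well. -/
theorem lt_of_not_redundant {x y z : ℕ} (h : ¬ Redundant U V x y z) (hxy : U x ≤ U y)
    (hyz : U y ≤ U z) {ω : ℝ} (hlt : linVal U V ω y < linVal U V ω z) :
    linVal U V ω x < linVal U V ω y := by
  simp only [linVal] at *
  have d1 : 0 ≤ U y - U x := by linarith
  have d2 : 0 ≤ U z - U y := by linarith
  have e2 : 0 < (V z - V y) + ω * (U z - U y) := by linarith
  suffices 0 < (V y - V x) + ω * (U y - U x) by linarith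
  by_contra! hc
  rw [Redundant, not_and_or, not_not, not_or, not_not, not_not] at h
  rcases h with h | ⟨h1, h2⟩
  · have p1 := mul_nonpos_of_nonpos_of_nonneg hc d2
    have p2 := mul_nonneg e2.le d1
    nlinarith
  · have hω : 0 < ω * (U z - U y) := by linarith
    have hω' : 0 < ω := pos_of_mul_pos_left hω d2
    have := mul_nonneg hω'.le d1
    linarith

/-- A redundant top is never better than both the entry below it and the pending point `i`, so
whatever it dominated is dominated by one of these. -/
theorem IsPartialHull.pop (h : IsPartialHull U V st a c i) (hc : 1 < c)
    (hU : ∀ k l, k ≤ l → l ≤ i → U k ≤ U l)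
    (hr : Redundant U V (st (a + (c - 2))) (st (a + (c - 1))) i) :
    IsPartialHull U V st a (c - 1) i := by
  have hincr := h.incr (c - 2) (by omega)
  have hmem := h.mem (c - 1) (by omega)
  rw [show c - 2 + 1 = c - 1 by omega] at hincr
  refine ⟨h.toIsChain.pop hc, fun k hk hki ω => ?_⟩
  rcases h.dom k hk hki ω with ⟨t, ht, hle⟩ | hle
  · by_cases htc : t = c - 1
    · subst htc
      rcases le_or_le_of_redundant hr (hU _ _ hincr.le hmem.2.le) (hU _ _ hmem.2.le le_rfl) ω
        with h' | h'
      · exact Or.inl ⟨c - 2, by omega, hle.trans h'⟩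
      · exact Or.inr (hle.trans h')
    · exact Or.inl ⟨t, by omega, hle⟩
  · exact Or.inr hle

/-- Pushing `i` removes the second alternative in `IsPartialHull.dom`. The only new triple on the
chain is the one ending in `i`, and it is not redundant. -/
theorem IsPartialHull.push (h : IsPartialHull U V st a c i)
    (hU : ∀ k l, k ≤ l → l ≤ i → U k ≤ U l)
    (hr : 1 < c → ¬ Redundant U V (st (a + (c - 2))) (st (a + (c - 1))) i) :
    IsHull U V (Function.update st (a + c) i) a (c + 1) (i + 1) := by
  have hold : ∀ t < c, Function.update st (a + c) i (a + t) = st (a + t) :=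
    fun t ht => Function.update_of_ne (by omega) _ _
  have hnew : Function.update st (a + c) i (a + c) = i := Function.update_self _ _ _
  have hle := h.le
  refine ⟨⟨by omega, by omega, fun t ht => ?_, fun t ht => ?_, fun t ht ω => ?_⟩,
    fun k hk hki ω => ?_⟩
  · rcases Nat.lt_succ_iff_lt_or_eq.1 ht with ht | rfl
    · rw [hold t ht]
      have := h.mem t ht
      omega
    · rw [hnew]
      omega
  · rw [hold t (by omega)]
    rcases Nat.lt_succ_iff_lt_or_eq.1 ht with ht' | ht'
    · rw [hold _ ht']
      exact h.incr t ht'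
    · rw [ht', hnew]
      exact (h.mem t (by omega)).2
  · rw [hold t (by omega), hold (t + 1) (by omega)]
    rcases Nat.lt_succ_iff_lt_or_eq.1 ht with ht' | rfl
    · rw [hold _ ht']
      exact h.unimodal t ht' ω
    · rw [hnew]
      have hm := h.mem (t + 1) (by omega)
      have hi := h.incr t (by omega)
      exact lt_of_not_redundant (by simpa using hr (by omega)) (hU _ _ hi.le hm.2.le)
        (hU _ _ hm.2.le le_rfl)
  · have hi : ∃ t < c + 1, linVal U V ω i ≤
        linVal U V ω (Function.update st (a + c) i (a + t)) :=
      ⟨c, by omega, by rw [hnew]⟩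
    rcases Nat.lt_succ_iff_lt_or_eq.1 hki with hki | rfl
    · rcases h.dom k hk hki ω with ⟨t, ht, hle⟩ | hle
      · exact ⟨t, by omega, by rwa [hold t ht]⟩
      · obtain ⟨t, ht, h'⟩ := hi
        exact ⟨t, ht, hle.trans h'⟩
    · exact hi

/-- On a chain, a linear function that increases at the end is maximal at the end. -/
theorem IsChain.le_top (h : IsChain U V st a c i) {ω : ℝ}
    (hlt : 1 < c → linVal U V ω (st (a + (c - 2))) < linVal U V ω (st (a + (c - 1)))) {t : ℕ}
    (ht : t < c) : linVal U V ω (st (a + t)) ≤ linVal U V ω (st (a + (c - 1))) := by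
  -- Unimodality read backwards: an increase in the last step implies one in each earlier step.
  have key : ∀ d, d + 1 < c → linVal U V ω (st (a + (c - 2 - d))) <
      linVal U V ω (st (a + (c - 2 - d + 1))) := by
    intro d
    induction d with
    | zero =>
      intro hd
      have := hlt (by omega)
      rwa [show c - 2 - 0 + 1 = c - 1 by omega]
    | succ d ih =>
      intro hd
      have := ih (by omega)
      obtain ⟨x, hx⟩ : ∃ x, c - 2 - (d + 1) = x := ⟨_, rfl⟩
      rw [show c - 2 - d = x + 1 by omega] at this
      rw [hx]
      exact h.unimodal x (by omega) ω this
  have key' : ∀ d, d < c → linVal U V ω (st (a + (c - 1 - d))) ≤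
      linVal U V ω (st (a + (c - 1))) := by
    intro d
    induction d with
    | zero => intro _; simp
    | succ d ih =>
      intro hd
      have h1 := ih (by omega)
      have h2 := key d (by omega)
      rw [show c - 2 - d = c - 1 - (d + 1) by omega,
        show c - 1 - (d + 1) + 1 = c - 1 - d by omega] at h2
      exact h2.le.trans h1
  have := key' (c - 1 - t) (by omega)
  rwa [show c - 1 - (c - 1 - t) = t by omega] at this

/-- The state of the construction of the hulls of the blocks of width `w`. -/
structure BuildInv (U V : ℕ → ℝ) (w : ℕ) (st cnt : ℕ → ℕ) (i c : ℕ) : Prop where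
  done : ∀ b, b < i / w → IsHull U V st (b * w) (cnt b) ((b + 1) * w)
  part : i % w ≠ 0 → IsPartialHull U V st (i / w * w) c i

variable {w : ℕ} {cnt : ℕ → ℕ}

/-- The stack of a block is stored from the first position of the block on, and a chain has no more
entries than its block has points. So a write at `p` leaves the stacks of finished blocks alone. The
stored count is renewed with every push, so it is final when the block ends. -/
theorem BuildInv.of_push (hw : 0 < w) (h : BuildInv U V w st cnt i c) {c' p : ℕ}
    (hp : i / w * w ≤ p) (hn : IsHull U V (Function.update st p i) (i / w * w) c' (i + 1)) :
    BuildInv U V w (Function.update st p i) (Function.update cnt (i / w) c') (i + 1) c' := by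
  have hdm := Nat.div_add_mod i w
  have hml := Nat.mod_lt i hw
  rw [mul_comm] at hdm
  have hold : ∀ b, b < i / w → IsHull U V (Function.update st p i) (b * w)
      (Function.update cnt (i / w) c' b) ((b + 1) * w) := by
    intro b hb
    have h1 := h.done b hb
    rw [Function.update_of_ne hb.ne]
    refine h1.congr fun t ht => Function.update_of_ne ?_ _ _
    have h2 := h1.le
    have h3 := Nat.mul_le_mul_right w (Nat.succ_le_of_lt hb)
    have : (b + 1) * w = b.succ * w := rfl
    omega
  by_cases hlast : i % w + 1 = w
  · have hi1 : i + 1 = (i / w + 1) * w := by rw [add_mul]; omega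
    have hd1 : (i + 1) / w = i / w + 1 := by rw [hi1, Nat.mul_div_cancel _ hw]
    refine ⟨fun b hb => ?_, fun hne => (hne ?_).elim⟩
    · rw [hd1] at hb
      rcases Nat.lt_succ_iff_lt_or_eq.1 hb with hb | rfl
      · exact hold b hb
      · rw [Function.update_self, ← hi1]
        exact hn
    · rw [hi1, Nat.mul_mod_left]
  · have hd1 : (i + 1) / w = i / w := by
      refine Nat.div_eq_of_lt_le (by omega) ?_
      rw [add_mul]; omega
    exact ⟨hd1 ▸ hold, fun _ => hd1 ▸ hn.toPartial⟩

theorem BuildInv.first (hw : 0 < w) (h : BuildInv U V w st cnt i c) (hi : i % w = 0) :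
    BuildInv U V w (Function.update st i i) (Function.update cnt (i / w) 1) (i + 1) 1 := by
  have hdm := Nat.div_add_mod i w
  rw [mul_comm] at hdm
  have : i / w * w = i := by omega
  refine h.of_push hw this.le ?_
  rw [this]
  exact IsHull.single (Function.update_self _ _ _)

theorem BuildInv.push (hw : 0 < w) (h : BuildInv U V w st cnt i c) (hi : i % w ≠ 0)
    (hU : ∀ k l, k ≤ l → l ≤ i → U k ≤ U l)
    (hr : 1 < c → ¬ Redundant U V (st (i / w * w + (c - 2))) (st (i / w * w + (c - 1))) i) :
    BuildInv U V w (Function.update st (i / w * w + c) i) (Function.update cnt (i / w) (c + 1))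
      (i + 1) (c + 1) :=
  h.of_push hw (Nat.le_add_right _ _) ((h.part hi).push hU hr)

theorem BuildInv.pop (h : BuildInv U V w st cnt i c) (hi : i % w ≠ 0)
    (hU : ∀ k l, k ≤ l → l ≤ i → U k ≤ U l) (hc : 1 < c)
    (hr : Redundant U V (st (i / w * w + (c - 2))) (st (i / w * w + (c - 1))) i) :
    BuildInv U V w st cnt i (c - 1) :=
  ⟨h.done, fun _ => (h.part hi).pop hc hU hr⟩

notation "qW" => (12 : ℕ)
notation "qNN" => (13 : ℕ)
notation "qNB" => (14 : ℕ)
notation "qSt" => (15 : ℕ)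
notation "qCnt" => (16 : ℕ)
notation "qI" => (17 : ℕ)
notation "qC" => (18 : ℕ)
notation "qQ" => (19 : ℕ)
notation "qNQ" => (20 : ℕ)
notation "qQB" => (21 : ℕ)
notation "qAI" => (22 : ℕ)
notation "rU" => (5 : ℕ)
notation "rV" => (6 : ℕ)
notation "rWQ" => (7 : ℕ)

/-- The program text of the test `Redundant`. -/
def redundantTest (x y z : WordExpr) : Test :=
  .conj (.neg (.realLt ((.get rV z - .get rV y) * (.get rU y - .get rU x))
      ((.get rV y - .get rV x) * (.get rU z - .get rU y))))
    (.disj (.neg (.realLt (.ofWord (.lit 0)) (.get rV y - .get rV x)))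
      (.neg (.realLt (.get rV z - .get rV y) (.ofWord (.lit 0)))))

theorem redundantTest_holds (s : Store) (x y z : WordExpr) : (redundantTest x y z).Holds s ↔
    Redundant (s.real rU) (s.real rV) (x.eval s) (y.eval s) (z.eval s) := by
  simp only [redundantTest, Test.Holds, Redundant, RealExpr.eval_mul, RealExpr.eval_sub,
    RealExpr.eval_get, RealExpr.eval_ofWord, WordExpr.eval_lit, Nat.cast_zero]

/-- Compute the hulls of the blocks of width `qW` of the first `qNN` points. -/
def buildHulls : Program :=
  (assign qI (.lit 0) ;; assign qC (.lit 0)) ;;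
  .loop (.wordLt (var qI) (var qNN))
    (.branch (.wordEq (var qI - var qI / var qW * var qW) (.lit 0))
      (.setWord qSt (var qI) (var qI) ;; .setWord qCnt (var qI / var qW) (.lit 1) ;;
        assign qC (.lit 1) ;; assign qI (var qI + .lit 1))
      (.branch (.conj (.wordLt (.lit 1) (var qC)) (redundantTest
          (.get qSt (var qI / var qW * var qW + (var qC - .lit 2)))
          (.get qSt (var qI / var qW * var qW + (var qC - .lit 1))) (var qI)))
        (assign qC (var qC - .lit 1))
        (.setWord qSt (var qI / var qW * var qW + var qC) (var qI) ;;
          .setWord qCnt (var qI / var qW) (var qC + .lit 1) ;;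
          assign qC (var qC + .lit 1) ;; assign qI (var qI + .lit 1))))

theorem sub_div_mul (i w : ℕ) : i - i / w * w = i % w := by
  have := Nat.div_add_mod i w
  rw [mul_comm] at this
  omega

theorem buildHulls_runs {B w NB : ℕ} {s : Store} (hw : s.word qW 0 = w) (hw0 : 0 < w)
    (hNN : s.word qNN 0 = NB * w) (hB : NB * w + 1 < B)
    (hU : ∀ k l, k ≤ l → l < NB * w → s.real rU k ≤ s.real rU l) :
    Runs B (2 * (NB * w) + 1) buildHulls s (fun u => ∀ b < NB,
      IsHull (s.real rU) (s.real rV) (u.word qSt) (b * w) (u.word qCnt b) ((b + 1) * w)) := by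
  refine (Runs.simpleInitLoop (fun u => u.word qI 0 ≤ NB * w ∧ BuildInv (s.real rU) (s.real rV) w
      (u.word qSt) (u.word qCnt) (u.word qI 0) (u.word qC 0))
      -- The potential of the scan: a push costs two units and gives one back through the stack
      -- height, and a pop lowers the height.
      (fun u => 2 * (NB * w - u.word qI 0) + u.word qC 0) _ ?_ ?_).mono le_rfl ?_
  · simp
    exact ⟨by omega, ⟨fun b hb => by simp at hb, by simp⟩⟩
  · rintro u hf ⟨hle, hI⟩ hb
    have h1 := hf.word qW rfl
    have h2 := hf.word qNN rfl
    have h3 := hf.real rU rfl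
    have h4 := hf.real rV rfl
    simp [h2, hNN] at hb
    simp only [wp, redundantTest_holds, Test.Holds, WordExpr.eval_lit, WordExpr.eval_get, WordExpr.eval_sub,
      WordExpr.eval_mul, WordExpr.eval_add, WordExpr.eval_div, Store.putWord_word_self,
      Store.putWord_word_of_ne, Function.update_self, ne_eq,
      Nat.reduceEqDiff, not_false_eq_true, sub_div_mul, h1, h3, h4, hw]
    generalize u.word qC 0 = c at *
    generalize u.word qI 0 = i at *
    have hU' : ∀ k l, k ≤ l → l ≤ i → s.real rU k ≤ s.real rU l :=
      fun k l hkl hl => hU k l hkl (by omega)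
    have hdiv := Nat.div_le_self i w
    have hdm := Nat.div_add_mod i w
    rw [mul_comm] at hdm
    refine ⟨fun hm => ?_, fun hm => ⟨fun hc => ?_, fun hc => ?_⟩⟩
    · have := hI.first hw0 hm
      and_intros <;> omega
    · have := hI.pop hm hU' hc.1 hc.2
      have := (hI.part hm).le
      and_intros <;> omega
    · have := hI.push hw0 hm hU' (fun h h' => hc ⟨h, h'⟩)
      have := (hI.part hm).le
      and_intros <;> omega
  · rintro u hf ⟨⟨hle, hI⟩, hb⟩ b hbN
    have h2 := hf.word qNN rfl
    simp [h2, hNN] at hb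
    refine hI.done b ?_
    rw [show u.word qI 0 = NB * w by omega, Nat.mul_div_cancel _ hw0]
    exact hbN

/-- The state of answering the queries `q, q + 1, …` by popping from the hulls. -/
structure QueryInv (U V : ℕ → ℝ) (w NB : ℕ) (WQ : ℕ → ℝ) (QB : ℕ → ℕ) (NQ : ℕ) (st cnt : ℕ → ℕ)
    (q : ℕ) (AI : ℕ → ℕ) : Prop where
  chain : ∀ b < NB, IsChain U V st (b * w) (cnt b) ((b + 1) * w)
  dom : ∀ q', q ≤ q' → q' < NQ → QB q' < NB → ∀ k, QB q' * w ≤ k → k < (QB q' + 1) * w →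
    ∃ t < cnt (QB q'), linVal U V (WQ q') k ≤ linVal U V (WQ q') (st (QB q' * w + t))
  ans : ∀ q' < q, QB q' < NB → QB q' * w ≤ AI q' ∧ AI q' < (QB q' + 1) * w ∧
    ∀ k, QB q' * w ≤ k → k < (QB q' + 1) * w →
      linVal U V (WQ q') k ≤ linVal U V (WQ q') (AI q')

variable {NB NQ q : ℕ} {WQ : ℕ → ℝ} {QB AI : ℕ → ℕ}

theorem QueryInv.init (h : ∀ b < NB, IsHull U V st (b * w) (cnt b) ((b + 1) * w)) :
    QueryInv U V w NB WQ QB NQ st cnt 0 AI :=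
  ⟨fun b hb => (h b hb).toIsChain, fun q' _ _ hb k hk hk' => (h _ hb).dom k hk hk' _,
    fun q' hq => by omega⟩

theorem QueryInv.skip (h : QueryInv U V w NB WQ QB NQ st cnt q AI) (hq : ¬ QB q < NB) :
    QueryInv U V w NB WQ QB NQ st cnt (q + 1) AI := by
  refine ⟨h.chain, fun q' hq' => h.dom q' (by omega), fun q' hq' hb => ?_⟩
  rcases Nat.lt_succ_iff_lt_or_eq.1 hq' with hq' | rfl
  · exact h.ans q' hq' hb
  · exact (hq hb).elim

/-- The hull may have lost points that only earlier queries needed, but for the current query it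
still contains a maximum. If the last step strictly increases or there is only one entry, the top is
that maximum, by `IsChain.le_top`. -/
theorem QueryInv.answer (h : QueryInv U V w NB WQ QB NQ st cnt q AI) (hqN : q < NQ)
    (hq : QB q < NB) (hlt : 1 < cnt (QB q) →
      linVal U V (WQ q) (st (QB q * w + (cnt (QB q) - 2))) <
        linVal U V (WQ q) (st (QB q * w + (cnt (QB q) - 1)))) :
    QueryInv U V w NB WQ QB NQ st cnt (q + 1)
      (Function.update AI q (st (QB q * w + (cnt (QB q) - 1)))) := by
  refine ⟨h.chain, fun q' hq' => h.dom q' (by omega), fun q' hq' hb => ?_⟩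
  rcases Nat.lt_succ_iff_lt_or_eq.1 hq' with hq' | rfl
  · rw [Function.update_of_ne hq'.ne]
    exact h.ans q' hq' hb
  · rw [Function.update_self]
    have hc := h.chain _ hb
    have hm := hc.mem (cnt (QB q') - 1) (by have := hc.pos; omega)
    refine ⟨hm.1, hm.2, fun k hk hk' => ?_⟩
    obtain ⟨t, ht, hle⟩ := h.dom q' le_rfl hqN hb k hk hk'
    exact hle.trans (hc.le_top hlt ht)

/-- The top has an abscissa at least that of its predecessor. If it does not beat the predecessor
for the current parameter, it does not for any smaller one, and the later queries have no larger
parameters. So dropping it is permanent, and all queries together pop at most as many entries as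
were pushed. -/
theorem QueryInv.pop (h : QueryInv U V w NB WQ QB NQ st cnt q AI)
    (hq : QB q < NB) (hU : ∀ k l, k ≤ l → l < NB * w → U k ≤ U l)
    (hWQ : ∀ q', q ≤ q' → q' < NQ → WQ q' ≤ WQ q) (hc : 1 < cnt (QB q))
    (hle : ¬ linVal U V (WQ q) (st (QB q * w + (cnt (QB q) - 2))) <
        linVal U V (WQ q) (st (QB q * w + (cnt (QB q) - 1)))) :
    QueryInv U V w NB WQ QB NQ st (Function.update cnt (QB q) (cnt (QB q) - 1)) q AI := by
  refine ⟨fun b hb => ?_, fun q' hqq hqN hb k hk hk' => ?_, h.ans⟩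
  · by_cases hbq : b = QB q
    · subst hbq
      rw [Function.update_self]
      exact (h.chain _ hb).pop hc
    · rw [Function.update_of_ne hbq]
      exact h.chain b hb
  · obtain ⟨t, ht, hle'⟩ := h.dom q' hqq hqN hb k hk hk'
    by_cases hbq : QB q' = QB q
    · rw [hbq, Function.update_self]
      rw [hbq] at ht hle'
      by_cases htop : t = cnt (QB q) - 1
      · refine ⟨cnt (QB q) - 2, by omega, hle'.trans ?_⟩
        have hch := h.chain _ hq
        have hincr := hch.incr (cnt (QB q) - 2) (by omega)
        rw [show cnt (QB q) - 2 + 1 = cnt (QB q) - 1 by omega] at hincr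
        have hm := (hch.mem (cnt (QB q) - 1) (by omega)).2
        have hbw := Nat.mul_le_mul_right w (Nat.succ_le_of_lt hq)
        have hUle := hU _ _ hincr.le (hm.trans_le hbw)
        have hω := hWQ q' hqq hqN
        rw [htop]
        simp only [linVal, not_lt] at hle ⊢
        nlinarith
      · exact ⟨t, by omega, hle'⟩
    · rw [Function.update_of_ne hbq]
      exact ⟨t, ht, hle'⟩

/-- Answer the queries: `qAI[q]` maximizes `v + rWQ[q] * u` over the block `qQB[q]`. -/
def answerQueries : Program :=
  assign qQ (.lit 0) ;;
  .loop (.wordLt (var qQ) (var qNQ))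
    (.branch (.wordLt (.get qQB (var qQ)) (var qNB))
      (.branch (.conj (.wordLt (.lit 1) (.get qCnt (.get qQB (var qQ)))) (.neg (.realLt
          (.get rV (.get qSt (.get qQB (var qQ) * var qW + (.get qCnt (.get qQB (var qQ)) - .lit 2))) +
            .get rWQ (var qQ) *
          .get rU (.get qSt (.get qQB (var qQ) * var qW + (.get qCnt (.get qQB (var qQ)) - .lit 2))))
          (.get rV (.get qSt (.get qQB (var qQ) * var qW + (.get qCnt (.get qQB (var qQ)) - .lit 1))) +
            .get rWQ (var qQ) *
          .get rU (.get qSt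
            (.get qQB (var qQ) * var qW + (.get qCnt (.get qQB (var qQ)) - .lit 1)))))))
        (.setWord qCnt (.get qQB (var qQ)) (.get qCnt (.get qQB (var qQ)) - .lit 1))
        (.setWord qAI (var qQ)
            (.get qSt (.get qQB (var qQ) * var qW + (.get qCnt (.get qQB (var qQ)) - .lit 1))) ;;
          assign qQ (var qQ + .lit 1)))
      (assign qQ (var qQ + .lit 1)))

/-- Over the block of each query, the answer to the query is maximal. -/
def AnswersMax (U V : ℕ → ℝ) (w NB : ℕ) (WQ : ℕ → ℝ) (QB : ℕ → ℕ) (NQ : ℕ) (AI : ℕ → ℕ) : Prop :=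
  ∀ q < NQ, QB q < NB → QB q * w ≤ AI q ∧ AI q < (QB q + 1) * w ∧
    ∀ k, QB q * w ≤ k → k < (QB q + 1) * w → linVal U V (WQ q) k ≤ linVal U V (WQ q) (AI q)

theorem answerQueries_runs {B w NB NQ : ℕ} {s : Store} (hw : s.word qW 0 = w)
    (hNB : s.word qNB 0 = NB) (hNQ : s.word qNQ 0 = NQ) (hB : NB * w + 1 < B) (hBQ : NQ + 1 < B)
    (hBN : NB < B) (hU : ∀ k l, k ≤ l → l < NB * w → s.real rU k ≤ s.real rU l)
    (hWQ : ∀ k l, k ≤ l → l < NQ → s.real rWQ l ≤ s.real rWQ k)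
    (hh : ∀ b < NB,
      IsHull (s.real rU) (s.real rV) (s.word qSt) (b * w) (s.word qCnt b) ((b + 1) * w)) :
    Runs B (NQ + NB * w + 1) answerQueries s (fun u =>
      AnswersMax (s.real rU) (s.real rV) w NB (s.real rWQ) (s.word qQB) NQ (u.word qAI)) := by
  refine (Runs.simpleInitLoop (fun u => u.word qQ 0 ≤ NQ ∧
      QueryInv (s.real rU) (s.real rV) w NB (s.real rWQ) (s.word qQB) NQ (s.word qSt)
        (u.word qCnt) (u.word qQ 0) (u.word qAI))
      -- Every round either finishes a query or pops a hull entry.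
      (fun u => (NQ - u.word qQ 0) + ∑ b ∈ Finset.range NB, u.word qCnt b) _ ?_ ?_).mono le_rfl ?_
  · simp
    refine ⟨by omega, QueryInv.init hh, ?_⟩
    calc ∑ b ∈ Finset.range NB, s.word qCnt b ≤ ∑ _b ∈ Finset.range NB, w := by
          refine Finset.sum_le_sum fun b hb => ?_
          have := (hh b (Finset.mem_range.1 hb)).le
          rw [add_mul] at this
          omega
      _ = NB * w := by simp
  · rintro u hf ⟨hle, hI⟩ hb
    have h1 := hf.word qW rfl
    have h2 := hf.word qNB rfl
    have h3 := hf.word qNQ rfl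
    have h4 := hf.word qQB rfl
    have h5 := hf.word qSt rfl
    have h6 := hf.real rU rfl
    have h7 := hf.real rV rfl
    have h8 := hf.real rWQ rfl
    simp [h3, hNQ] at hb
    simp only [wp, Test.Holds, WordExpr.eval_lit, WordExpr.eval_get, WordExpr.eval_sub,
      WordExpr.eval_mul, WordExpr.eval_add, RealExpr.eval_get, RealExpr.eval_add,
      RealExpr.eval_mul, Store.putWord_word_self,
      Store.putWord_word_of_ne, Function.update_self, ne_eq,
      Nat.reduceEqDiff, not_false_eq_true, h1, h2, h4, h5, h6, h7, h8, hw, hNB]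
    generalize u.word qQ 0 = q at *
    refine ⟨fun hq => ?_, fun hq => ?_⟩
    · have hbw := Nat.mul_le_mul_right w (Nat.succ_le_of_lt hq)
      have hch := hI.chain _ hq
      have hcl := hch.le
      have hcp := hch.pos
      have hm := hch.mem (u.word qCnt (s.word qQB q) - 1) (by omega)
      rw [Nat.succ_eq_add_one] at hbw
      refine ⟨fun hc => ?_, fun hc => ?_⟩
      · have := hI.pop hq hU (fun q' h h' => hWQ q q' h h') hc.1 hc.2
        have hsum : ∑ b ∈ Finset.range NB, Function.update (u.word qCnt) (s.word qQB q)
            (u.word qCnt (s.word qQB q) - 1) b < ∑ b ∈ Finset.range NB, u.word qCnt b := by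
          refine Finset.sum_lt_sum (fun b _ => ?_) ⟨s.word qQB q, Finset.mem_range.2 hq, ?_⟩
          · by_cases hbq : b = s.word qQB q
            · subst hbq
              rw [Function.update_self]
              omega
            · rw [Function.update_of_ne hbq]
          · rw [Function.update_self]
            omega
        and_intros <;> omega
      · have := hI.answer hb hq (fun h => by by_contra h'; exact hc ⟨h, h'⟩)
        and_intros <;> omega
    · have := hI.skip hq
      and_intros <;> omega
  · rintro u hf ⟨⟨hle, hI⟩, hb⟩ q hq hqB
    have h3 := hf.word qNQ rfl
    simp [h3, hNQ] at hb
    exact hI.ans q (by omega) hqB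

/-- Build the hulls of the blocks and answer the queries. -/
def maximize : Program := buildHulls ;; answerQueries

theorem maximize_runs {B w NB NQ : ℕ} {s : Store} (hw : s.word qW 0 = w) (hw0 : 0 < w)
    (hNN : s.word qNN 0 = NB * w) (hNB : s.word qNB 0 = NB) (hNQ : s.word qNQ 0 = NQ)
    (hB : NB * w + 1 < B) (hBQ : NQ + 1 < B)
    (hU : ∀ k l, k ≤ l → l < NB * w → s.real rU k ≤ s.real rU l)
    (hWQ : ∀ k l, k ≤ l → l < NQ → s.real rWQ l ≤ s.real rWQ k) :
    Runs B (NQ + 2 * (NB * w) + 1) maximize s (fun u =>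
      AnswersMax (s.real rU) (s.real rV) w NB (s.real rWQ) (s.word qQB) NQ (u.word qAI)) := by
  refine Runs.seq ((buildHulls_runs hw hw0 hNN hB hU).mono (by omega) fun _ _ h => h)
    fun u hf hu => ?_
  have h1 := hf.word qW rfl
  have h2 := hf.word qNB rfl
  have h3 := hf.word qNQ rfl
  have h4 := hf.word qQB rfl
  have h6 := hf.real rU rfl
  have h7 := hf.real rV rfl
  have h8 := hf.real rWQ rfl
  have hBN : NB < B := (Nat.le_mul_of_pos_right NB hw0).trans_lt (by omega)
  have := answerQueries_runs (B := B) (s := u) (w := w) (NB := NB) (NQ := NQ) (by rw [h1, hw])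
    (by rw [h2, hNB]) (by rw [h3, hNQ]) hB hBQ hBN (by rwa [h6]) (by rwa [h8]) (by rwa [h6, h7])
  rw [h4, h6, h7, h8] at this
  exact this.mono (by omega) fun _ _ h => h

end RealRAM

namespace RealRAM

/-! ### The first position from which a property fails -/

/-- All positions in `[k, p)` are good. -/
def GoodOn (good : ℕ → Prop) (k p : ℕ) : Prop := ∀ i, k ≤ i → i < p → good i

/-- `r` is the first position `≥ k` that is not good. -/
def IsFirstBad (good : ℕ → Prop) (k r : ℕ) : Prop := k ≤ r ∧ GoodOn good k r ∧ ¬ good r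

open Classical in
/-- If `p ≡ -w` modulo `d` and the next `w` positions are good, jump over them. -/
noncomputable def jump (good : ℕ → Prop) (d w p : ℕ) : ℕ :=
  if p % d = d - w ∧ GoodOn good p (p + w) then p + w else p

/-- The invariant of the ascending search before the step of width `w`. -/
def Ascending (good : ℕ → Prop) (k w p : ℕ) : Prop :=
  k ≤ p ∧ GoodOn good k p ∧
    (¬ w ∣ p → ∃ j, 2 ^ j ∣ p ∧ ¬ 2 ^ (j + 1) ∣ p ∧ ¬ GoodOn good p (p + 2 ^ j))

/-- The invariant of the descending search after the step of width `2 ^ i`. -/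
def Descending (good : ℕ → Prop) (k i p : ℕ) : Prop :=
  k ≤ p ∧ GoodOn good k p ∧ ∃ j ≤ i, 2 ^ j ∣ p ∧ ¬ GoodOn good p (p + 2 ^ j)

variable {good : ℕ → Prop} {k p i n : ℕ}

theorem GoodOn.append {q : ℕ} (h : GoodOn good k p) (h' : GoodOn good p q) : GoodOn good k q :=
  fun x hx hxq => by
    rcases Nat.lt_or_ge x p with hp | hp
    · exact h x hx hp
    · exact h' x hp hxq

theorem Ascending.init : Ascending good k 1 k :=
  ⟨le_rfl, fun x h h' => by omega, fun h => (h (one_dvd _)).elim⟩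

/-- A test takes place only if the width divides `p` exactly once. Success makes `p` divisible by
the doubled width. Failure freezes `p`: from then on the width does not divide `p`, and the failed
aligned block is the witness of the invariant. -/
theorem Ascending.step (h : Ascending good k (2 ^ i) p) :
    Ascending good k (2 ^ (i + 1)) (jump good (2 * 2 ^ i) (2 ^ i) p) := by
  obtain ⟨hk, hg, hn⟩ := h
  rw [jump, show 2 * 2 ^ i - 2 ^ i = 2 ^ i by omega, ← pow_succ']
  have hdm := Nat.div_add_mod p (2 ^ (i + 1))
  have hdvd : 2 ^ i ∣ 2 ^ (i + 1) := pow_dvd_pow _ (Nat.le_succ i)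
  split_ifs with hc
  · refine ⟨by omega, hg.append hc.2, fun hnd => (hnd ?_).elim⟩
    have : p + 2 ^ i = 2 ^ (i + 1) * (p / 2 ^ (i + 1)) + 2 ^ (i + 1) := by
      rw [pow_succ] at *
      omega
    rw [this]
    exact Nat.dvd_add (Nat.dvd_mul_right _ _) dvd_rfl
  · refine ⟨hk, hg, fun hnd => ?_⟩
    by_cases hw : 2 ^ i ∣ p
    · refine ⟨i, hw, hnd, fun hgood => hc ⟨?_, hgood⟩⟩
      have h1 : 2 ^ i ∣ p % 2 ^ (i + 1) := (Nat.dvd_mod_iff hdvd).2 hw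
      obtain ⟨c, hc⟩ := h1
      have h2 : p % 2 ^ (i + 1) < 2 ^ (i + 1) := Nat.mod_lt _ (by positivity)
      have h3 : p % 2 ^ (i + 1) ≠ 0 := fun h => hnd (Nat.dvd_of_mod_eq_zero h)
      rw [hc, pow_succ] at h2
      have h4 : c < 2 := Nat.lt_of_mul_lt_mul_left h2
      have h5 : c ≠ 0 := by
        rintro rfl
        exact h3 (by rw [hc, mul_zero])
      rw [hc, show c = 1 by omega, mul_one]
    · exact hn hw

theorem GoodOn.le (hgood : ∀ x, good x → x < n) (hkn : k ≤ n) (hkp : k ≤ p)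
    (h : GoodOn good k p) : p ≤ n := by
  rcases hkp.eq_or_lt with rfl | hlt
  · exact hkn
  · have := hgood _ (h (p - 1) (by omega) (by omega))
    omega

/-- A multiple of `2 ^ i > n` that is at most `n` is 0, and the block from 0 of that width contains
the bad position `n`. Otherwise `p` is frozen by a smaller block. -/
theorem Ascending.toDescending (hgood : ∀ x, good x → x < n) (hkn : k ≤ n) (hn : n < 2 ^ i)
    (h : Ascending good k (2 ^ i) p) : Descending good k i p := by
  obtain ⟨hk, hg, hnd⟩ := h
  refine ⟨hk, hg, ?_⟩
  by_cases hw : 2 ^ i ∣ p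
  · have hp : p = 0 := Nat.eq_zero_of_dvd_of_lt hw ((GoodOn.le hgood hkn hk hg).trans_lt hn)
    refine ⟨i, le_rfl, hw, fun h => ?_⟩
    exact absurd (hgood n (h n (by omega) (by omega))) (lt_irrefl n)
  · obtain ⟨j, h1, -, h3⟩ := hnd hw
    refine ⟨j, ?_, h1, h3⟩
    by_contra hij
    exact hw ((pow_dvd_pow 2 (by omega)).trans h1)

/-- If the first half of a bad block is good then the second half is bad, and `p` moves there.
Otherwise the first half is itself a bad block. A bad block that is already no wider than `2 ^ i`
prevents the jump. -/
theorem Descending.step (h : Descending good k (i + 1) p) :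
    Descending good k i (jump good (2 ^ i) (2 ^ i) p) := by
  obtain ⟨hk, hg, j, hj, hd, hb⟩ := h
  rw [jump, Nat.sub_self]
  split_ifs with hc
  · obtain rfl : j = i + 1 := by
      by_contra hne
      refine hb fun x hx hxp => hc.2 x hx ?_
      have := Nat.pow_le_pow_right (n := 2) (by norm_num) (show j ≤ i by omega)
      omega
    refine ⟨by omega, hg.append hc.2, i, le_rfl, ?_, fun h => hb ?_⟩
    · exact Nat.dvd_add (Nat.dvd_of_mod_eq_zero hc.1) dvd_rfl
    · have := hc.2.append h
      rwa [add_assoc, ← two_mul, ← pow_succ'] at this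
  · refine ⟨hk, hg, ?_⟩
    by_cases hji : j = i + 1
    · have hdi : 2 ^ i ∣ p := (pow_dvd_pow 2 (by omega)).trans hd
      exact ⟨i, le_rfl, hdi, fun h => hc ⟨Nat.mod_eq_zero_of_dvd hdi, h⟩⟩
    · exact ⟨j, by omega, hd, hb⟩

theorem Descending.isFirstBad (h : Descending good k 0 p) : IsFirstBad good k p := by
  obtain ⟨hk, hg, j, hj, -, hb⟩ := h
  refine ⟨hk, hg, fun hp => hb fun x hx hxp => ?_⟩
  obtain rfl : j = 0 := by omega
  obtain rfl : x = p := by omega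
  exact hp

/-! ### The reach of all lines -/

notation "tN" => (23 : ℕ)
notation "tM" => (24 : ℕ)
notation "tPos" => (25 : ℕ)
notation "tMod" => (26 : ℕ)
notation "tQ" => (27 : ℕ)
notation "rA" => (8 : ℕ)
notation "rB" => (9 : ℕ)

/-- Line `q` is on or above point `i`, one of the first `n` points. -/
def LineCovers (U V A C : ℕ → ℝ) (n q i : ℕ) : Prop := i < n ∧ V i ≤ A q * U i + C q

/-- Select the block to be tested for each line. -/
def selectBlocks : Program :=
  forLoop tQ (var tM) (.branch
    (.wordEq (.get tPos (var tQ) - .get tPos (var tQ) / var tMod * var tMod) (var tMod - var qW))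
    (.setWord qQB (var tQ) (.get tPos (var tQ) / var qW))
    (.setWord qQB (var tQ) (var qNB)))

/-- Advance the lines that are above all points of their block. -/
def advance : Program :=
  forLoop tQ (var tM) (.branch
    (.conj (.wordLt (.get qQB (var tQ)) (var qNB))
      (.neg (.realLt (.get rB (var tQ)) (.get rV (.get qAI (var tQ)) +
        .get rWQ (var tQ) * .get rU (.get qAI (var tQ))))))
    (.setWord tPos (var tQ) (.get tPos (var tQ) + var qW))
    .skip)

/-- One step of width `qW` of the search for all lines. -/
def reachPass : Program :=
  (assign qNB (var tN / var qW) ;; assign qNN (var qNB * var qW)) ;;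
  selectBlocks ;; maximize ;; advance

/-- The queries are `V - A q * U`, whose maximum over a block is compared with the intercept. Their
parameters `-A q` decrease because the lines are sorted by slope. The block number `n / w`, one too
large, marks lines that make no test in this pass. -/
theorem reachPass_runs {B w n m d : ℕ} {s : Store} (hw : s.word qW 0 = w) (hw0 : 0 < w)
    (hn : s.word tN 0 = n) (hm : s.word tM 0 = m) (hQ : s.word qNQ 0 = m)
    (hd : s.word tMod 0 = d) (hB : 2 * (n + w + m) + 1 < B)
    (hmod : ∀ p, p % d = d - w → w ∣ p)
    (hU : ∀ k l, k ≤ l → l < n → s.real rU k ≤ s.real rU l)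
    (hA : ∀ k l, k ≤ l → l < m → s.real rA k ≤ s.real rA l)
    (hWQ : ∀ q < m, s.real rWQ q = 0 - s.real rA q)
    (hpos : ∀ q < m, s.word tPos q ≤ n) :
    Runs B (m + 2 * n + 1) reachPass s (fun u => ∀ q < m, u.word tPos q =
      jump (LineCovers (s.real rU) (s.real rV) (s.real rA) (s.real rB) n q) d w
        (s.word tPos q)) := by
  have hnw : n / w * w ≤ n := Nat.div_mul_le_self n w
  have hnw' : n / w ≤ n := Nat.div_le_self n w
  refine Runs.seq (Q := fun u => u.word qNB 0 = n / w ∧ u.word qNN 0 = n / w * w)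
    ((Runs.of_wp ?_).mono (by omega) fun _ _ h => h) fun s₁ f₁ ⟨hNB₁, hNN₁⟩ => ?_
  · simp [hn, hw]
    omega
  have g₁ : s₁.word tM = s.word tM ∧ s₁.word qW = s.word qW ∧ s₁.word tMod = s.word tMod ∧
      s₁.word tPos = s.word tPos ∧ s₁.word qNQ = s.word qNQ ∧ s₁.real = s.real :=
    ⟨f₁.word _ rfl, f₁.word _ rfl, f₁.word _ rfl, f₁.word _ rfl, f₁.word _ rfl,
      funext fun a => f₁.real a rfl⟩
  refine Runs.seq (Q := fun u => ∀ q < m, u.word qQB q =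
    if s.word tPos q % d = d - w then s.word tPos q / w else n / w)
    (Runs.mono (F := m + 1) ?_ (by omega) fun _ _ h => h) fun s₂ f₂ hQB₂ => ?_
  · refine Runs.forLoop (fun k u => ∀ q < k, u.word qQB q =
      if s.word tPos q % d = d - w then s.word tPos q / w else n / w) (by omega) ?_ (by simp) ?_
    · intro u hf
      simp [hf.word tM rfl, g₁, hm]
    · intro k u hk hf hv hI
      have := Nat.div_le_self (s.word tPos k) w
      have := hpos k hk
      simp only [wp, Test.Holds, WordExpr.eval_lit, WordExpr.eval_get, WordExpr.eval_sub,
        WordExpr.eval_mul, WordExpr.eval_div, Store.putWord_word_self,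
        Store.putWord_word_of_ne, ne_eq, Nat.reduceEqDiff, not_false_eq_true, hv,
        hf.word tPos rfl, hf.word tMod rfl, hf.word qW rfl, hf.word qNB rfl, g₁, hNB₁, hw, hd,
        sub_div_mul, Function.update_apply]
      refine ⟨fun hc => ⟨by omega, by omega, trivial, fun q hq => ?_⟩,
        fun hc => ⟨by omega, by omega, trivial, fun q hq => ?_⟩⟩ <;>
      · by_cases hqk : q = k
        · rw [if_pos hqk, hqk]
          simp [hc]
        · rw [if_neg hqk]
          exact hI q (by omega)
  have g₂ : s₂.word tM = s.word tM ∧ s₂.word qW = s.word qW ∧ s₂.word tPos = s.word tPos ∧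
      s₂.word qNQ = s.word qNQ ∧ s₂.word qNB = s₁.word qNB ∧ s₂.word qNN = s₁.word qNN ∧
      s₂.real = s.real :=
    ⟨(f₂.word _ rfl).trans g₁.1, (f₂.word _ rfl).trans g₁.2.1,
      (f₂.word _ rfl).trans g₁.2.2.2.1, (f₂.word _ rfl).trans g₁.2.2.2.2.1, f₂.word _ rfl,
      f₂.word _ rfl, (funext fun a => f₂.real a rfl : s₂.real = s₁.real).trans g₁.2.2.2.2.2⟩
  refine Runs.seq ((maximize_runs (w := w) (NB := n / w) (NQ := m) (s := s₂) (by simp [g₂, hw]) hw0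
    (by simp [g₂, hNN₁]) (by simp [g₂, hNB₁]) (by simp [g₂, hQ]) (by omega) (by omega)
    (fun k l hkl hl => by simpa [g₂] using hU k l hkl (by omega)) (fun k l hkl hl => ?_)).mono
    (by omega) fun _ _ h => h) fun s₃ f₃ hans => ?_
  · have := hA k l hkl hl
    simp only [g₂]
    rw [hWQ k (by omega), hWQ l hl]
    linarith
  have g₃ : s₃.word tM = s.word tM ∧ s₃.word qW = s.word qW ∧ s₃.word tPos = s.word tPos ∧
      s₃.word qNB = s₁.word qNB ∧ s₃.word qQB = s₂.word qQB ∧ s₃.real = s.real :=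
    ⟨(f₃.word _ rfl).trans g₂.1, (f₃.word _ rfl).trans g₂.2.1,
      (f₃.word _ rfl).trans g₂.2.2.1, (f₃.word _ rfl).trans g₂.2.2.2.2.1, f₃.word _ rfl,
      (funext fun a => f₃.real a rfl : s₃.real = s₂.real).trans g₂.2.2.2.2.2.2⟩
  rw [g₂.2.2.2.2.2.2] at hans
  -- The test performed by `advance` is the condition in `jump`.
  have hjump : ∀ q < m, (s₂.word qQB q < n / w ∧ ¬ s.real rB q < s.real rV (s₃.word qAI q) +
      s.real rWQ q * s.real rU (s₃.word qAI q) ↔ s.word tPos q % d = d - w ∧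
      GoodOn (LineCovers (s.real rU) (s.real rV) (s.real rA) (s.real rB) n q) (s.word tPos q)
        (s.word tPos q + w)) := by
    intro q hq
    have hans' := hans q hq
    have hval : ∀ i, linVal (s.real rU) (s.real rV) (s.real rWQ q) i ≤ s.real rB q ↔
        s.real rV i ≤ s.real rA q * s.real rU i + s.real rB q := by
      intro i
      rw [linVal, hWQ q hq]
      constructor <;> intro h <;> linarith
    rw [hQB₂ q hq] at hans' ⊢
    by_cases hc : s.word tPos q % d = d - w
    · simp only [hc, if_true, true_and] at hans' ⊢
      obtain ⟨c, hpc⟩ := hmod _ hc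
      rw [mul_comm] at hpc
      have hpw : s.word tPos q / w = c := by rw [hpc, Nat.mul_div_cancel _ hw0]
      rw [hpw] at hans' ⊢
      rw [hpc]
      constructor
      · rintro ⟨hlt, hle⟩
        intro i hi hi'
        obtain ⟨h1, h2, h3⟩ := hans' hlt
        have h4 : (c + 1) * w ≤ n / w * w := Nat.mul_le_mul_right w hlt
        refine ⟨by rw [add_mul] at h4; omega, (hval i).1 ((h3 i hi (by rw [add_mul]; omega)).trans ?_)⟩
        exact not_lt.1 hle
      · intro hg
        -- `LineCovers` includes `i < n`, so a good block ends within the points and is one of the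
        -- complete blocks for which a hull exists.
        have hlt : c < n / w := by
          have := (hg (c * w + w - 1) (by omega) (by omega)).1
          refine (Nat.le_div_iff_mul_le hw0).2 ?_
          rw [Nat.succ_mul]
          omega
        refine ⟨hlt, not_lt.2 ?_⟩
        obtain ⟨h1, h2, h3⟩ := hans' hlt
        exact (hval _).2 (hg _ h1 (by rw [add_mul] at h2; omega)).2
    · simp [hc]
  refine (Runs.forLoop (N := m) (fun k u => ∀ q < m, u.word tPos q = if q < k then
      jump (LineCovers (s.real rU) (s.real rV) (s.real rA) (s.real rB) n q) d w
        (s.word tPos q) else s.word tPos q) (by omega) ?_ (by simp [g₃]) ?_).mono (by omega)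
      fun u _ hu q hq => by simpa [hq] using hu q hq
  · intro u hf
    simp [hf.word tM rfl, g₃, hm]
  · intro k u hk hf hv hI
    have hk' := hI k hk
    simp only [lt_irrefl, if_false] at hk'
    have := hpos k hk
    simp only [wp, Test.Holds, WordExpr.eval_get, WordExpr.eval_lit, WordExpr.eval_add,
        RealExpr.eval_get, RealExpr.eval_add, RealExpr.eval_mul, Store.putWord_word_self,
        Store.putWord_word_of_ne, ne_eq, Nat.reduceEqDiff, not_false_eq_true, hv, hk',
        hf.word qW rfl, hf.word qNB rfl, hf.word qQB rfl, hf.word qAI rfl, hf.real rB rfl,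
        hf.real rV rfl, hf.real rWQ rfl, hf.real rU rfl, g₃, hNB₁, hw, hjump k hk,
        Function.update_apply]
    refine ⟨fun hc => ⟨by omega, by omega, trivial, fun q hq => ?_⟩,
      fun hc => ⟨trivial, fun q hq => ?_⟩⟩
    · by_cases hqk : q = k
      · rw [if_pos hqk, hqk, if_pos (Nat.lt_succ_self k), jump, if_pos hc]
      · rw [if_neg hqk, hI q hq]
        simp only [show q < k + 1 ↔ q < k by omega]
    · rw [hI q hq]
      by_cases hqk : q = k
      · rw [hqk, if_neg (lt_irrefl k), if_pos (Nat.lt_succ_self k), jump, if_neg hc]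
      · simp only [show q < k + 1 ↔ q < k by omega]

/-- Advance `tPos[q]`, for all lines `q`, to the first point there that `q` does not cover. -/
def reach : Program :=
  assign qNQ (var tM) ;;
  forLoop tQ (var tM) (.setReal rWQ (var tQ) (.ofWord (.lit 0) - .get rA (var tQ))) ;;
  (assign qW (.lit 1) ;;
    .loop (.neg (.wordLt (var tN) (var qW)))
      (assign tMod (.lit 2 * var qW) ;; reachPass ;; assign qW (.lit 2 * var qW))) ;;
  .loop (.wordLt (.lit 1) (var qW))
    ((assign qW (var qW / .lit 2) ;; assign tMod (var qW)) ;; reachPass)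

theorem reach_runs {B n m : ℕ} {s : Store} (hn : s.word tN 0 = n) (hm : s.word tM 0 = m)
    (hB : 8 * (n + m + 1) < B)
    (hU : ∀ k l, k ≤ l → l < n → s.real rU k ≤ s.real rU l)
    (hA : ∀ k l, k ≤ l → l < m → s.real rA k ≤ s.real rA l)
    (hpos : ∀ q < m, s.word tPos q ≤ n) :
    Runs B ((m + 2 * n + 1) * (Nat.log 2 n + 2)) reach s (fun u => ∀ q < m, IsFirstBad
      (LineCovers (s.real rU) (s.real rV) (s.real rA) (s.real rB) n q)
      (s.word tPos q) (u.word tPos q)) := by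
  have hF : m + 2 * n + 1 ≤ (m + 2 * n + 1) * (Nat.log 2 n + 2) :=
    Nat.le_mul_of_pos_right _ (by omega)
  refine Runs.seq (Q := fun u => u.word qNQ 0 = m)
    ((Runs.of_wp (by simp [hm]; omega)).mono (by omega) fun _ _ h => h) fun s₁ f₁ hQ₁ => ?_
  refine Runs.seq (Q := fun u => ∀ q < m, u.real rWQ q = 0 - s.real rA q)
    (Runs.mono (F := m + 1) ?_ (by omega) fun _ _ h => h) fun s₂ f₂ hWQ₂ => ?_
  · refine Runs.forLoop (fun k u => ∀ q < k, u.real rWQ q = 0 - s.real rA q) (by omega) ?_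
      (by simp) ?_
    · intro u hf
      simp [hf.word tM rfl, f₁.word tM rfl, hm]
    · intro k u hk hf hv hI
      simp only [wp, WordExpr.eval_get, WordExpr.eval_lit, RealExpr.eval_sub, RealExpr.eval_get,
        RealExpr.eval_ofWord, Nat.cast_zero, hv, hf.real rA rfl, f₁.real rA rfl,
        Store.putReal_real_self, Store.putReal_word, Store.putWord_real, Function.update_apply]
      refine ⟨by omega, trivial, fun q hq => ?_⟩
      split_ifs with h
      · rw [h]
      · exact hI q (by omega)
  set good := LineCovers (s.real rU) (s.real rV) (s.real rA) (s.real rB) n with hgood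
  have hlt : ∀ q i, good q i → i < n := fun q i h => h.1
  have g₂ : s₂.word tN = s.word tN ∧ s₂.word tM = s.word tM ∧ s₂.word tPos = s.word tPos ∧
      s₂.word qNQ 0 = m :=
    ⟨(f₂.word _ rfl).trans (f₁.word _ rfl), (f₂.word _ rfl).trans (f₁.word _ rfl),
      (f₂.word _ rfl).trans (f₁.word _ rfl), by rw [f₂.word qNQ rfl, hQ₁]⟩
  have r₂ : s₂.real rU = s.real rU ∧ s₂.real rV = s.real rV ∧ s₂.real rA = s.real rA ∧
      s₂.real rB = s.real rB :=
    ⟨(f₂.real _ rfl).trans (f₁.real _ rfl), (f₂.real _ rfl).trans (f₁.real _ rfl),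
      (f₂.real _ rfl).trans (f₁.real _ rfl), (f₂.real _ rfl).trans (f₁.real _ rfl)⟩
  -- The same pass serves both searches: modulus `2 * w` ascending (`p` an odd multiple of `w`) and
  -- modulus `w` descending.
  have pass : ∀ (w d : ℕ) (u : Store), u.word tN = s₂.word tN → u.word tM = s₂.word tM →
      u.word qNQ = s₂.word qNQ → u.real = s₂.real → u.word qW 0 = w → u.word tMod 0 = d → 0 < w →
      w ≤ 2 * n + 1 → (∀ p, p % d = d - w → w ∣ p) → (∀ q < m, u.word tPos q ≤ n) →
      Runs B (m + 2 * n + 1) reachPass u (fun v => ∀ q < m, v.word tPos q =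
        jump (good q) d w (u.word tPos q)) := by
    intro w d u h1 h2 h3 h4 h5 h6 h7 h8 h9 h10
    have := reachPass_runs (B := B) (s := u) (n := n) (m := m) h5 h7 (by rw [h1, g₂.1, hn])
      (by rw [h2, g₂.2.1, hm]) (by rw [h3, g₂.2.2.2]) h6 (by omega) h9
      (by rw [h4, r₂.1]; exact hU) (by rw [h4, r₂.2.2.1]; exact hA)
      (by rw [h4, r₂.2.2.1]; exact hWQ₂) h10
    rwa [h4, r₂.1, r₂.2.1, r₂.2.2.1, r₂.2.2.2] at this
  refine Runs.seq (Q := fun u => (∃ i, u.word qW 0 = 2 ^ i ∧ i ≤ Nat.log 2 n + 1 ∧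
      ∀ q < m, Descending (good q) (s.word tPos q) i (u.word tPos q)))
    ((Runs.initLoop (F := m + 2 * n + 1) (fun u => ∃ i, u.word qW 0 = 2 ^ i ∧
        i ≤ Nat.log 2 n + 1 ∧ ∀ q < m, Ascending (good q) (s.word tPos q) (2 ^ i) (u.word tPos q))
      (fun u => Nat.log 2 n + 1 - Nat.log 2 (u.word qW 0)) (Nat.log 2 n + 1) (by omega)
      ?_ ?_).mono le_rfl ?_) fun s₃ f₃ h₃ => ?_
  · simp
    refine ⟨by omega, by omega, 0, by simp, by omega, fun q hq => ?_⟩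
    rw [g₂.2.2.1, pow_zero]
    exact Ascending.init
  · rintro u hf ⟨i, hi, hil, hI⟩ hb
    simp [hf.word tN rfl, g₂, hn] at hb
    have hile : i ≤ Nat.log 2 n := Nat.le_log_of_pow_le one_lt_two (hi ▸ hb)
    refine Runs.seq (Q := fun v => v.word tMod 0 = 2 * 2 ^ i ∧ v.word qW = u.word qW ∧
        v.word tPos = u.word tPos) ((Runs.of_wp ?_).mono (by omega) fun _ _ h => h)
      fun v fv hv => ?_
    · simp [hi]
      omega
    refine Runs.seq (pass (2 ^ i) (2 * 2 ^ i) v (by rw [fv.word tN rfl, hf.word tN rfl])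
      (by rw [fv.word tM rfl, hf.word tM rfl]) (by rw [fv.word qNQ rfl, hf.word qNQ rfl]) ?_
      (by rw [hv.2.1, hi]) hv.1 (by positivity) (by omega) ?_ ?_) fun v' fv' hv' => ?_
    · rw [show v.real = u.real from funext fun a => fv.real a rfl]
      exact funext fun a => hf.real a rfl
    · intro p hp
      have hdm := Nat.div_add_mod p (2 * 2 ^ i)
      rw [hp, show 2 * 2 ^ i - 2 ^ i = 2 ^ i by omega] at hdm
      rw [← hdm, mul_comm 2, mul_assoc]
      exact Nat.dvd_add (Nat.dvd_mul_right _ _) dvd_rfl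
    · intro q hq
      rw [hv.2.2]
      obtain ⟨h1, h2, -⟩ := hI q hq
      exact GoodOn.le (hlt q) (hpos q hq) h1 h2
    · refine (Runs.of_wp ?_).mono (by omega) fun _ _ h => h
      have hw' : v'.word qW 0 = 2 ^ i := by rw [fv'.word qW rfl, hv.2.1, hi]
      simp only [wp, WordExpr.eval_get, WordExpr.eval_lit, WordExpr.eval_mul,
        Store.putWord_word_self, Store.putWord_word_of_ne, ne_eq, Nat.reduceEqDiff,
        not_false_eq_true, hw', Function.update_self]
      refine ⟨by omega, by omega, ⟨i + 1, by rw [pow_succ'], by omega, fun q hq => ?_⟩, ?_⟩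
      · rw [hv' q hq, hv.2.2]
        exact (hI q hq).step
      · rw [← pow_succ', hi, Nat.log_pow one_lt_two, Nat.log_pow one_lt_two]
        omega
  · rintro u hf ⟨⟨i, hi, hil, hI⟩, hb⟩
    simp [hf.word tN rfl, g₂, hn] at hb
    exact ⟨i, hi, hil, fun q hq => (hI q hq).toDescending (hlt q) (hpos q hq) (hi ▸ hb)⟩
  refine (Runs.loop (F := m + 2 * n + 1) (fun u => (∃ i, u.word qW 0 = 2 ^ i ∧
      i ≤ Nat.log 2 n + 1 ∧ ∀ q < m, Descending (good q) (s.word tPos q) i (u.word tPos q)))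
    (fun u => Nat.log 2 (u.word qW 0)) (Nat.log 2 n + 1) h₃ ?_ (by omega) ?_).mono le_rfl ?_
  · obtain ⟨i, hi, hil, -⟩ := h₃
    rwa [hi, Nat.log_pow one_lt_two]
  · rintro u hf ⟨i, hi, hil, hI⟩ hb
    simp [hi] at hb
    obtain ⟨i, rfl⟩ := Nat.exists_eq_succ_of_ne_zero hb
    have hhalf : 2 ^ (i + 1) / 2 = 2 ^ i := by rw [pow_succ, Nat.mul_div_cancel _ two_pos]
    have hle : 2 ^ i ≤ 2 * n + 1 := by
      by_cases hn0 : n = 0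
      · subst hn0
        simp at hil
        simp [hil]
      · have := Nat.pow_le_of_le_log hn0 (Nat.le_of_succ_le_succ hil)
        omega
    refine Runs.seq (Q := fun v => v.word tMod 0 = 2 ^ i ∧ v.word qW 0 = 2 ^ i ∧
        v.word tPos = u.word tPos) ((Runs.of_wp ?_).mono (by omega) fun _ _ h => h)
      fun v fv hv => ?_
    · simp [hi, hhalf]
      omega
    refine (pass (2 ^ i) (2 ^ i) v
      (by rw [fv.word tN rfl, hf.word tN rfl, f₃.word tN rfl])
      (by rw [fv.word tM rfl, hf.word tM rfl, f₃.word tM rfl])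
      (by rw [fv.word qNQ rfl, hf.word qNQ rfl, f₃.word qNQ rfl]) ?_ hv.2.1 hv.1 (by positivity) hle
      ?_ ?_).mono le_rfl fun v' fv' hv' => ⟨⟨i, ?_, by omega, fun q hq => ?_⟩, ?_⟩
    · rw [show v.real = u.real from funext fun a => fv.real a rfl,
        show u.real = s₃.real from funext fun a => hf.real a rfl]
      exact funext fun a => f₃.real a rfl
    · intro p hp
      rw [Nat.sub_self] at hp
      exact Nat.dvd_of_mod_eq_zero hp
    · intro q hq
      rw [hv.2.2]
      obtain ⟨h1, h2, -⟩ := hI q hq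
      exact GoodOn.le (hlt q) (hpos q hq) h1 h2
    · rw [fv'.word qW rfl, hv.2.1]
    · rw [hv' q hq, hv.2.2]
      exact (hI q hq).step
    · rw [fv'.word qW rfl, hv.2.1, hi, Nat.log_pow one_lt_two, Nat.log_pow one_lt_two]
      omega
  · rintro u hf ⟨⟨i, hi, hil, hI⟩, hb⟩ q hq
    simp [hi] at hb
    subst hb
    exact (hI q hq).isFirstBad

end RealRAM

namespace RealRAM

/-! ### Runs of consecutive points covered by a line -/

/-- For sorted points and lines: `c u` is a highest line at point `u`, `K j` the first point
whose highest line is at least as steep as line `j`, and `[l j, r j)` the run of points around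
`K j` that line `j` covers. -/
structure IsRunSystem (X Y A C : ℕ → ℝ) (n m : ℕ) (c K l r : ℕ → ℕ) : Prop where
  monoX : ∀ u v, u ≤ v → v < n → X u ≤ X v
  c_lt : ∀ u < n, 0 < m → c u < m
  c_max : ∀ u < n, ∀ q < m, A q * X u + C q ≤ A (c u) * X u + C (c u)
  K_le : ∀ j < m, K j ≤ n
  lt_K : ∀ j < m, ∀ u < K j, A (c u) < A j
  at_K : ∀ j < m, K j < n → A j ≤ A (c (K j))
  right : ∀ j < m, IsFirstBad (LineCovers X Y A C n j) (K j) (r j)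
  l_le : ∀ j < m, l j ≤ K j
  left : ∀ j < m, GoodOn (LineCovers X Y A C n j) (l j) (K j)
  l_bad : ∀ j < m, 0 < l j → ¬ LineCovers X Y A C n j (l j - 1)

/-- Every point is covered by some line. -/
def Feasible (X Y A C : ℕ → ℝ) (n m : ℕ) : Prop := ∀ u < n, ∃ q < m, LineCovers X Y A C n q u

theorem exists_last_bad {P : ℕ → Prop} {a b : ℕ} (h : ¬ GoodOn P a b) :
    ∃ u, a ≤ u ∧ u < b ∧ ¬ P u ∧ GoodOn P (u + 1) b := by
  induction b with
  | zero => exact (h fun i _ hi => absurd hi (Nat.not_lt_zero i)).elim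
  | succ b ih =>
    by_cases hb : a ≤ b ∧ ¬ P b
    · exact ⟨b, hb.1, Nat.lt_succ_self b, hb.2, fun i hi hib => by omega⟩
    · have hPb : a ≤ b → P b := fun hab => by
        by_contra hn
        exact hb ⟨hab, hn⟩
      obtain ⟨u, h1, h2, h3, h4⟩ := ih fun hg => h fun i hi hib => by
        rcases Nat.lt_succ_iff_lt_or_eq.1 hib with hib | rfl
        · exact hg i hi hib
        · exact hPb hi
      refine ⟨u, h1, by omega, h3, fun i hi hib => ?_⟩
      rcases Nat.lt_succ_iff_lt_or_eq.1 hib with hib | rfl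
      · exact h4 i hi hib
      · exact hPb (by omega)

theorem exists_first_bad {P : ℕ → Prop} {a b : ℕ} (h : ¬ GoodOn P a b) :
    ∃ u, a ≤ u ∧ u < b ∧ ¬ P u ∧ GoodOn P a u := by
  classical
  have hex : ∃ u, a ≤ u ∧ u < b ∧ ¬ P u := by
    by_contra! hn
    exact h hn
  obtain ⟨h1, h2, h3⟩ := Nat.find_spec hex
  refine ⟨Nat.find hex, h1, h2, h3, fun i hi hib => ?_⟩
  by_contra hn
  exact Nat.find_min hex hib ⟨hi, hib.trans h2, hn⟩

namespace IsRunSystem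

variable {X Y A C : ℕ → ℝ} {n m : ℕ} {c K l r : ℕ → ℕ}

theorem covers_c (h : IsRunSystem X Y A C n m c K l r) (hf : Feasible X Y A C n m) {u : ℕ}
    (hu : u < n) : c u < m ∧ LineCovers X Y A C n (c u) u := by
  obtain ⟨q, hq, hc⟩ := hf u hu
  exact ⟨h.c_lt u hu (by omega), hu, hc.2.trans (h.c_max u hu q hq)⟩

theorem K_c_le (h : IsRunSystem X Y A C n m c K l r) {u : ℕ} (hc : c u < m) :
    K (c u) ≤ u := by
  by_contra! hlt
  exact lt_irrefl _ (h.lt_K _ hc u hlt)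

/-- The highest line at `u` serves unless it is less steep than `j`. As `K j ≤ u`, this can only be
a tie between points of equal abscissa, and then the highest line at `K j` is also highest at `u`.
-/
theorem exists_steeper (h : IsRunSystem X Y A C n m c K l r) (hf : Feasible X Y A C n m)
    {j u : ℕ} (hj : j < m) (hu : u < n) (hK : K j ≤ u) :
    ∃ g < m, LineCovers X Y A C n g u ∧ A j ≤ A g ∧ K g ≤ u := by
  obtain ⟨hcu, hcov⟩ := h.covers_c hf hu
  by_cases hA : A j ≤ A (c u)
  · exact ⟨c u, hcu, hcov, hA, h.K_c_le hcu⟩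
  · have hKn : K j < n := by omega
    have hcK := (h.covers_c hf hKn).1
    have h1 := h.at_K j hj hKn
    have h2 := h.c_max u hu _ hcK
    have h3 := h.c_max _ hKn _ hcu
    have h4 := h.monoX _ _ hK hu
    have hX : X u = X (K j) := by
      refine le_antisymm ?_ h4
      by_contra! hlt
      push Not at hA
      have := mul_pos (sub_pos.2 (hA.trans_le h1)) (sub_pos.2 hlt)
      nlinarith
    refine ⟨c (K j), hcK, ⟨hu, ?_⟩, h1, (h.K_c_le hcK).trans hK⟩
    have := h.c_max _ hKn _ hcu
    rw [← hX] at this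
    exact hcov.2.trans this

theorem l_le_of_good (h : IsRunSystem X Y A C n m c K l r) {i j : ℕ} (hj : j < m)
    (hg : GoodOn (LineCovers X Y A C n j) i (K j)) : l j ≤ i := by
  by_contra! hlt
  have := h.l_le j hj
  exact h.l_bad j hj (by omega) (hg _ (by omega) (by omega))

/-- If line `j` covers everything from `K j` to `e`, its own run is the answer. Otherwise let `u` be
the last point missed: a line that covers `u` and is at least as steep as `j` is above `j` from `u`
on, so it covers `[u, e)`. Its block starts at `u < i`, whence the induction on `i`. -/
theorem exists_run_of_K_le (h : IsRunSystem X Y A C n m c K l r) (hf : Feasible X Y A C n m)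
    {e : ℕ} (i : ℕ) : ∀ j < m, i < e → K j ≤ e → GoodOn (LineCovers X Y A C n j) i e →
      ∃ j' < m, l j' ≤ i ∧ e ≤ r j' := by
  induction i using Nat.strong_induction_on with
  | _ i ih =>
    intro j hj hie hK hg
    by_cases hgood : GoodOn (LineCovers X Y A C n j) (K j) e
    · refine ⟨j, hj, h.l_le_of_good hj fun x hx hxK => hg x hx (by omega), ?_⟩
      by_contra! hlt
      exact (h.right j hj).2.2 (hgood _ (h.right j hj).1 hlt)
    · obtain ⟨u, hKu, hue, hbad, hlast⟩ := exists_last_bad hgood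
      have hui : u < i := by
        by_contra! hiu
        exact hbad (hg u hiu hue)
      have hun : u < n := hui.trans (hg i le_rfl hie).1
      obtain ⟨g, hgm, hcov, hA, hKg⟩ := h.exists_steeper hf hj hun hKu
      obtain ⟨j', hj', h1, h2⟩ := ih u hui g hgm hue (by omega) fun x hx hxe => by
        rcases hx.eq_or_lt with rfl | hx
        · exact hcov
        · have hxj := hlast x hx hxe
          refine ⟨hxj.1, hxj.2.trans ?_⟩
          have hb : A j * X u + C j < Y u := by
            by_contra! hle
            exact hbad ⟨hun, hle⟩
          have := mul_nonneg (sub_nonneg.2 hA) (sub_nonneg.2 (h.monoX u x hx.le hxj.1))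
          have := hcov.2
          linarith
      exact ⟨j', hj', by omega, h2⟩

/-- Whatever a line covers consecutively is covered by one of the runs. -/
theorem exists_run (h : IsRunSystem X Y A C n m c K l r) (hf : Feasible X Y A C n m)
    {i e j : ℕ} (hj : j < m) (hie : i < e) (hg : GoodOn (LineCovers X Y A C n j) i e) :
    ∃ j' < m, l j' ≤ i ∧ e ≤ r j' := by
  by_cases hK : K j ≤ e
  · exact h.exists_run_of_K_le hf i j hj hie hK hg
  by_cases hgood : GoodOn (LineCovers X Y A C n j) i (K j)
  · have := (h.right j hj).1
    exact ⟨j, hj, h.l_le_of_good hj hgood, by omega⟩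
  -- The mirrored argument, needed only once: at the first missed point `u` before `K j` the highest
  -- line is less steep than `j`, so it is above `j` on the left of `u`. It covers `[i, u + 1)`, and
  -- its own `K` is at most `u`.
  · obtain ⟨u, hiu, huK, hbad, hfirst⟩ := exists_first_bad hgood
    have heu : e ≤ u := by
      by_contra! hue
      exact hbad (hg u hiu hue)
    have hun : u < n := huK.trans_le (h.K_le j hj)
    obtain ⟨hcm, hcov⟩ := h.covers_c hf hun
    obtain ⟨j', hj', h1, h2⟩ := h.exists_run_of_K_le hf (e := u + 1) i (c u) hcm (by omega)
      ((h.K_c_le hcm).trans (Nat.le_succ u)) fun x hx hxe => by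
        rcases Nat.lt_succ_iff_lt_or_eq.1 hxe with hxu | rfl
        · have hxj := hfirst x hx hxu
          refine ⟨hxj.1, hxj.2.trans ?_⟩
          have hb : A j * X u + C j < Y u := by
            by_contra! hle
            exact hbad ⟨hun, hle⟩
          have := mul_nonneg (sub_nonneg.2 (h.lt_K j hj u huK).le)
            (sub_nonneg.2 (h.monoX x u hxu.le hun))
          have := hcov.2
          linarith
        · exact hcov
    exact ⟨j', hj', h1, by omega⟩

theorem good_run (h : IsRunSystem X Y A C n m c K l r) {j : ℕ} (hj : j < m) :
    GoodOn (LineCovers X Y A C n j) (l j) (r j) :=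
  (h.left j hj).append (h.right j hj).2.1

theorem r_le (h : IsRunSystem X Y A C n m c K l r) {j : ℕ} (hj : j < m) : r j ≤ n :=
  GoodOn.le (fun _ h => h.1) (h.K_le j hj) (h.right j hj).1 (h.right j hj).2.1

end IsRunSystem

/-! ### The greedy choice of runs -/

/-- The number of points covered by the first `t` chosen runs. -/
def covered (r out : ℕ → ℕ) (t : ℕ) : ℕ := if t = 0 then 0 else r (out (t - 1))

/-- The first `k` entries of `out` are greedy choices: each run starts within the points covered
so far, and reaches farthest among these. -/
def IsGreedy (l r : ℕ → ℕ) (m : ℕ) (out : ℕ → ℕ) (k : ℕ) : Prop :=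
  ∀ t < k, out t < m ∧ l (out t) ≤ covered r out t ∧ covered r out t < r (out t) ∧
    ∀ j < m, l j ≤ covered r out t → r j ≤ r (out t)

theorem covered_succ (r out : ℕ → ℕ) (t : ℕ) : covered r out (t + 1) = r (out t) := by
  simp [covered]

theorem IsGreedy.covered_mono {l r out : ℕ → ℕ} {m k : ℕ} (h : IsGreedy l r m out k) {t t' : ℕ}
    (htt : t ≤ t') (ht : t' ≤ k) : covered r out t ≤ covered r out t' := by
  induction t', htt using Nat.le_induction with
  | base => exact le_rfl
  | succ t' _ ih =>
    refine (ih (by omega)).trans ?_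
    rw [covered_succ]
    exact (h t' (by omega)).2.2.1.le

theorem covered_congr {r out out' : ℕ → ℕ} {k : ℕ} (ho : ∀ t < k, out' t = out t) {t : ℕ}
    (ht : t ≤ k) : covered r out' t = covered r out t := by
  unfold covered
  split_ifs with h0
  · rfl
  · rw [ho _ (by omega)]

theorem IsGreedy.snoc {l r out : ℕ → ℕ} {m k j : ℕ} (h : IsGreedy l r m out k) (hj : j < m)
    (hl : l j ≤ covered r out k) (hr : covered r out k < r j)
    (hmax : ∀ j' < m, l j' ≤ covered r out k → r j' ≤ r j) :
    IsGreedy l r m (Function.update out k j) (k + 1) := by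
  have ho : ∀ t < k, Function.update out k j t = out t :=
    fun t ht => Function.update_of_ne ht.ne _ _
  intro t ht
  rcases Nat.lt_succ_iff_lt_or_eq.1 ht with ht | rfl
  · rw [ho t ht, covered_congr ho ht.le]
    exact h t ht
  · rw [Function.update_self, covered_congr ho le_rfl]
    exact ⟨hj, hl, hr, hmax⟩

section Greedy

variable {X Y A C : ℕ → ℝ} {n m : ℕ} {c K l r out : ℕ → ℕ} {k : ℕ}

theorem IsGreedy.exists_covers (h : IsRunSystem X Y A C n m c K l r)
    (hgr : IsGreedy l r m out k) {t : ℕ} (ht : t ≤ k) {u : ℕ} (hu : u < covered r out t) :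
    ∃ t' < t, LineCovers X Y A C n (out t') u := by
  induction t with
  | zero => simp [covered] at hu
  | succ t ih =>
    by_cases hut : u < covered r out t
    · obtain ⟨t', ht', hc⟩ := ih (by omega) hut
      exact ⟨t', by omega, hc⟩
    · obtain ⟨h1, h2, h3, h4⟩ := hgr t ht
      rw [covered_succ] at hu
      exact ⟨t, by omega, h.good_run h1 u (by omega) hu⟩

/-- The greedy choice is at most as large as any set of lines that covers all points. -/
theorem IsGreedy.le_encard (h : IsRunSystem X Y A C n m c K l r) (hgr : IsGreedy l r m out k)
    {S : Set LowerHalfplane} (hSm : ∀ g ∈ S, ∃ q < m, A q = g.slope ∧ C q = g.intercept)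
    (hS : ∀ u < n, ∃ g ∈ S, Y u ≤ g.slope * X u + g.intercept) : (k : ℕ∞) ≤ S.encard := by
  have hf : Feasible X Y A C n m := by
    intro u hu
    obtain ⟨g, hg, hle⟩ := hS u hu
    obtain ⟨q, hq, h1, h2⟩ := hSm g hg
    exact ⟨q, hq, hu, by rwa [h1, h2]⟩
  have hfin : S.Finite := by
    refine ((Set.finite_Iio m).image fun q => (⟨A q, C q⟩ : LowerHalfplane)).subset fun g hg => ?_
    obtain ⟨q, hq, h1, h2⟩ := hSm g hg
    exact ⟨q, hq, LowerHalfplane.ext h1 h2⟩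
  have hlt : ∀ t < k, covered r out t < n := fun t ht =>
    (hgr t ht).2.2.1.trans_le (h.r_le (hgr t ht).1)
  -- `covered r out t` is the first point not covered before greedy step `t`. For `t ≥ k` the line
  -- is irrelevant.
  have htop : ∀ t : ℕ, ∃ g : LowerHalfplane, t < k → g ∈ S ∧ ∀ g' ∈ S,
      g'.slope * X (covered r out t) + g'.intercept ≤
        g.slope * X (covered r out t) + g.intercept := by
    intro t
    by_cases ht : t < k
    · obtain ⟨g₀, hg₀, -⟩ := hS _ (hlt t ht)
      obtain ⟨g, hg, hmax⟩ := hfin.exists_maximalFor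
        (fun g => g.slope * X (covered r out t) + g.intercept) S ⟨g₀, hg₀⟩
      refine ⟨g, fun _ => ⟨hg, fun g' hg' => ?_⟩⟩
      exact (le_total _ _).elim id fun hle => hmax hg' hle
    · exact ⟨⟨0, 0⟩, fun h => (ht h).elim⟩
  choose top htop using htop
  -- A line of `S` that is highest at the starts of two steps covers all points between them, so
  -- some run starts by the first and passes the second. The greedy step at the first would have
  -- chosen a run at least as long.
  have hinj : ∀ t t', t < t' → t' < k → top t ≠ top t' := by
    intro t t' htt ht' heq
    obtain ⟨hgS, hg1⟩ := htop t (by omega)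
    have hg2 := (htop t' ht').2
    rw [← heq] at hg2
    obtain ⟨q, hq, hq1, hq2⟩ := hSm _ hgS
    have hmono := hgr.covered_mono htt.le ht'.le
    have hgood : GoodOn (LineCovers X Y A C n q) (covered r out t) (covered r out t' + 1) := by
      intro u hu hu'
      have hun : u < n := by have := hlt t' ht'; omega
      obtain ⟨g', hg', hle⟩ := hS u hun
      refine ⟨hun, hle.trans ?_⟩
      rw [hq1, hq2]
      have h1 := hg1 g' hg'
      have h2 := hg2 g' hg'
      have h3 := h.monoX _ _ hu hun
      have h4 := h.monoX u _ (Nat.lt_succ_iff.1 hu') (hlt t' ht')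
      -- An affine function that is nonnegative at both ends is nonnegative in between. The sign of
      -- its slope decides which end is used.
      rcases le_total 0 ((top t).slope - g'.slope) with hs | hs
      · have := mul_nonneg hs (sub_nonneg.2 h3)
        linarith
      · have := mul_nonneg (neg_nonneg.2 hs) (sub_nonneg.2 h4)
        linarith
    obtain ⟨j', hj', h1, h2⟩ := h.exists_run hf hq (by omega) hgood
    have h3 := (hgr t (by omega)).2.2.2 j' hj' h1
    have h4 := hgr.covered_mono (t := t + 1) htt ht'.le
    rw [covered_succ] at h4
    omega
  have hset : top '' (Finset.range k : Set ℕ) ⊆ S := by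
    rintro _ ⟨t, ht, rfl⟩
    exact (htop t (by simpa using ht)).1
  have hon : Set.InjOn top (Finset.range k : Set ℕ) := by
    intro t ht t' ht' heq
    simp only [Finset.coe_range, Set.mem_Iio] at ht ht'
    rcases lt_trichotomy t t' with hlt | rfl | hlt
    · exact (hinj t t' hlt ht' heq).elim
    · rfl
    · exact (hinj t' t hlt ht heq.symm).elim
  calc (k : ℕ∞) = (Finset.range k : Set ℕ).encard := by
        rw [Set.encard_coe_eq_coe_finsetCard, Finset.card_range]
    _ = (top '' (Finset.range k : Set ℕ)).encard := hon.encard_image.symm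
    _ ≤ S.encard := Set.encard_le_encard hset

/-- If the greedy choice is stuck, then the lines do not cover the points. -/
theorem IsRunSystem.not_feasible (h : IsRunSystem X Y A C n m c K l r) {i : ℕ} (hi : i < n)
    (hstuck : ∀ j < m, l j ≤ i → r j ≤ i) : ¬ Feasible X Y A C n m := by
  intro hf
  obtain ⟨q, hq, hc⟩ := hf i hi
  obtain ⟨j', hj', h1, h2⟩ := h.exists_run hf hq (Nat.lt_succ_self i) fun u hu hu' => by
    obtain rfl : u = i := by omega
    exact hc
  have := hstuck j' hj' h1
  omega

end Greedy

end RealRAM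

/-! ### From arrays to sets of points and halfplanes -/

open RealRAM

theorem covers_iff {P : Set (ℝ × ℝ)} {S : Set LowerHalfplane} :
    Covers P S ↔ ∀ p ∈ P, ∃ g ∈ S, p.2 ≤ g.slope * p.1 + g.intercept := by
  simp [Covers, Set.subset_def, LowerHalfplane.carrier]

/-- The arrays `X`, `Y` list the points of `P`. -/
def ListsPoints (P : Set (ℝ × ℝ)) (X Y : ℕ → ℝ) (n : ℕ) : Prop :=
  (∀ u < n, (X u, Y u) ∈ P) ∧ ∀ p ∈ P, ∃ u < n, (X u, Y u) = p

/-- The arrays `A`, `C` list the halfplanes of `H`. -/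
def ListsHalfplanes (H : Set LowerHalfplane) (A C : ℕ → ℝ) (m : ℕ) : Prop :=
  (∀ q < m, (⟨A q, C q⟩ : LowerHalfplane) ∈ H) ∧
    ∀ g ∈ H, ∃ q < m, (⟨A q, C q⟩ : LowerHalfplane) = g

section Lists

variable {P : Set (ℝ × ℝ)} {H : Set LowerHalfplane} {X Y A C : ℕ → ℝ} {n m : ℕ}

theorem covers_iff_feasible (hP : ListsPoints P X Y n) (hH : ListsHalfplanes H A C m) :
    Covers P H ↔ Feasible X Y A C n m := by
  rw [covers_iff]
  constructor
  · intro h u hu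
    obtain ⟨g, hg, hle⟩ := h _ (hP.1 u hu)
    obtain ⟨q, hq, rfl⟩ := hH.2 g hg
    exact ⟨q, hq, hu, hle⟩
  · intro h p hp
    obtain ⟨u, hu, rfl⟩ := hP.2 p hp
    obtain ⟨q, hq, -, hle⟩ := h u hu
    exact ⟨_, hH.1 q hq, hle⟩

theorem RealRAM.IsGreedy.isSmallestCover {c K l r out : ℕ → ℕ} {k : ℕ} (hP : ListsPoints P X Y n)
    (hH : ListsHalfplanes H A C m) (h : IsRunSystem X Y A C n m c K l r)
    (hgr : IsGreedy l r m out k) (hn : n ≤ covered r out k) :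
    let sol := (List.range k).map fun t => (⟨A (out t), C (out t)⟩ : LowerHalfplane)
    sol.Nodup ∧ IsSmallestCover P H {g | g ∈ sol} := by
  classical
  intro sol
  have hmem : ∀ g, g ∈ sol ↔ ∃ t < k, (⟨A (out t), C (out t)⟩ : LowerHalfplane) = g := by
    simp [sol]
  have hsub : {g | g ∈ sol} ⊆ H := by
    intro g hg
    obtain ⟨t, ht, rfl⟩ := (hmem g).1 hg
    exact hH.1 _ (hgr t ht).1
  have hcov : Covers P {g | g ∈ sol} := by
    rw [covers_iff]
    intro p hp
    obtain ⟨u, hu, rfl⟩ := hP.2 p hp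
    obtain ⟨t, ht, hc⟩ := hgr.exists_covers h le_rfl (hu.trans_le hn)
    exact ⟨_, (hmem _).2 ⟨t, ht, rfl⟩, hc.2⟩
  have hlow : ∀ S ⊆ H, Covers P S → (k : ℕ∞) ≤ S.encard := by
    intro S hS hSc
    rw [covers_iff] at hSc
    refine hgr.le_encard h (fun g hg => ?_) fun u hu => hSc _ (hP.1 u hu)
    obtain ⟨q, hq, rfl⟩ := hH.2 g (hS hg)
    exact ⟨q, hq, rfl, rfl⟩
  have hlen : sol.length = k := by simp [sol]
  have hcoe : {g | g ∈ sol} = (sol.toFinset : Set LowerHalfplane) := by ext; simp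
  have hcard : {g | g ∈ sol}.encard ≤ k := by
    rw [hcoe, Set.encard_coe_eq_coe_finsetCard]
    exact_mod_cast (List.toFinset_card_le sol).trans hlen.le
  refine ⟨?_, hsub, hcov, fun S hS hSc => hcard.trans (hlow S hS hSc)⟩
  -- The chosen halfplanes are themselves a cover, so they have at least `k` distinct members. A
  -- list of length `k` with `k` distinct members has no repetition, even if the input lists a
  -- halfplane several times.
  have hk := hlow _ hsub hcov
  rw [hcoe, Set.encard_coe_eq_coe_finsetCard, Nat.cast_le] at hk
  refine Multiset.coe_nodup.1 (Multiset.dedup_card_eq_card_iff_nodup.1 ?_)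
  refine le_antisymm (Multiset.card_le_card (Multiset.dedup_le _)) ?_
  rw [Multiset.coe_card, hlen]
  exact hk

end Lists

namespace RealRAM

/-! ### The phases of the algorithm -/

notation "gIdx" => (28 : ℕ)
notation "gI" => (29 : ℕ)
notation "gPerm" => (30 : ℕ)
notation "gK" => (32 : ℕ)
notation "gKs" => (33 : ℕ)
notation "gL" => (34 : ℕ)
notation "gBR" => (35 : ℕ)
notation "gBJ" => (36 : ℕ)
notation "gEnd" => (37 : ℕ)
notation "gCur" => (38 : ℕ)
notation "gCurJ" => (39 : ℕ)
notation "gCnt" => (40 : ℕ)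
notation "gOk" => (41 : ℕ)
notation "gJ" => (42 : ℕ)
notation "rX" => (10 : ℕ)
notation "rY" => (11 : ℕ)
notation "rLA" => (12 : ℕ)
notation "rLC" => (13 : ℕ)

/-- The number of points. -/
abbrev numPoints : WordExpr := .get 0 (.lit 0)

/-- The number of halfplanes. -/
abbrev numLines : WordExpr := .get 0 (.lit 1)

/-- Sort `e` pairs in the real arrays `a`, `b` by the first component into `x`, `y`, and record the
permutation in the word array `g`. -/
def sortPairs (e : WordExpr) (a b x y g : ℕ) : Program :=
  assign sN e ;;
  forLoop gI (var sN) (.setReal rKey (var gI) (.get a (var gI))) ;;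
  mergeSort ;;
  forLoop gI (var sN) (.setReal x (var gI) (.get a (.get sIdx (var gI))) ;;
    .setReal y (var gI) (.get b (.get sIdx (var gI))) ;;
    .setWord g (var gI) (.get sIdx (var gI)))

theorem sortPairs_runs {B N a b x y g : ℕ} {e : WordExpr} {s : Store} (he : e.eval s = N)
    (hB : 4 * N + 1 < B) (ha : a < 4) (hb : b < 4) (hx : 10 ≤ x) (hy : 10 ≤ y) (hxy : x ≠ y)
    (hg : g = gIdx ∨ g = gPerm) :
    Runs B ((N + 1) * (Nat.log 2 N + 2)) (sortPairs e a b x y g) s (fun u =>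
      IsSorting (s.real a) N (u.word g) ∧
      ∀ i < N, u.real x i = s.real a (u.word g i) ∧ u.real y i = s.real b (u.word g i)) := by
  have hF : N + 1 ≤ (N + 1) * (Nat.log 2 N + 2) := Nat.le_mul_of_pos_right _ (by omega)
  have hax : a ≠ x := by omega
  have hay : a ≠ y := by omega
  have hbx : b ≠ x := by omega
  have hby : b ≠ y := by omega
  have hak : a ≠ rKey := by omega
  have hbk : b ≠ rKey := by omega
  have hgI : gI ≠ g := by omega
  have hgS : sIdx ≠ g := by omega
  have hgN : sN ≠ g := by omega
  refine Runs.seq (Q := fun u => u.word sN 0 = N ∧ u.real = s.real)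
    ((Runs.of_wp (by simp [he]; omega)).mono (by omega) fun _ _ h => h) fun s₁ f₁ ⟨hN₁, hr₁⟩ => ?_
  refine Runs.seq (Q := fun u => ∀ i < N, u.real rKey i = s.real a i)
    (Runs.mono (F := N + 1) ?_ hF fun _ _ h => h) fun s₂ f₂ hk₂ => ?_
  · refine Runs.forLoop (fun k u => ∀ i < k, u.real rKey i = s.real a i) (by omega) ?_
      (by simp) ?_
    · intro u hf
      simp [hf.word sN rfl, hN₁]
    · intro k u hk hf hv hI
      have hra : u.real a = s.real a := by
        rw [hf.real a (by simp [Program.writesReal, hak.symm]), hr₁]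
      simp only [wp, WordExpr.eval_get, WordExpr.eval_lit, RealExpr.eval_get, hv, hra,
        Store.putReal_real_self, Store.putReal_word, Store.putWord_real, Function.update_apply]
      refine ⟨by omega, trivial, fun i hi => ?_⟩
      split_ifs with h
      · rw [h]
      · exact hI i (by omega)
  have hN₂ : s₂.word sN 0 = N := by rw [f₂.word sN rfl, hN₁]
  have hra₂ : s₂.real a = s.real a := by
    rw [f₂.real a (by simp [Program.writesReal, hak.symm]), hr₁]
  have hrb₂ : s₂.real b = s.real b := by
    rw [f₂.real b (by simp [Program.writesReal, hbk.symm]), hr₁]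
  refine Runs.seq (mergeSort_runs hN₂ hB) fun s₃ f₃ hsort => ?_
  have hN₃ : s₃.word sN 0 = N := by rw [f₃.word sN rfl, hN₂]
  have hra₃ : s₃.real a = s.real a := by rw [f₃.real a rfl, hra₂]
  have hrb₃ : s₃.real b = s.real b := by rw [f₃.real b rfl, hrb₂]
  refine (Runs.forLoop (N := N) (fun k u => ∀ i < k, u.word g i = s₃.word sIdx i ∧
      u.real x i = s.real a (s₃.word sIdx i) ∧ u.real y i = s.real b (s₃.word sIdx i))
    (by omega) ?_ (by simp) ?_).mono hF ?_
  · intro u hf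
    simp [hf.word sN (by simp [Program.writesWord, hgN.symm]), hN₃]
  · intro k u hk hf hv hI
    have hlt := hsort.lt k hk
    simp only [wp, WordExpr.eval_get, WordExpr.eval_lit, RealExpr.eval_get, hv,
      hf.word sIdx (by simp [Program.writesWord, hgS.symm]),
      hf.real a (by simp [Program.writesReal, hax.symm, hay.symm]),
      hf.real b (by simp [Program.writesReal, hbx.symm, hby.symm]), hra₃, hrb₃,
      Store.putReal_real_self, Store.putReal_word, Store.putWord_real,
      Store.putReal_real_of_ne _ _ _ hbx, Store.putReal_real_of_ne _ _ _ hxy,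
      Store.putReal_real_of_ne _ _ _ hxy.symm,
      Store.putWord_word_of_ne _ _ _ hgI, Store.putWord_word_of_ne _ _ _ hgI.symm,
      Store.putWord_word_self, Function.update_apply]
    refine ⟨by omega, by omega, by omega, by omega, trivial, fun i hi => ?_⟩
    split_ifs with h
    · simp [h]
    · exact hI i (by omega)
  · intro u hf hu
    refine ⟨⟨fun i hi => ?_, fun v hv => ?_, fun i j hij hj => ?_⟩, fun i hi => ?_⟩
    · rw [(hu i hi).1]
      exact hsort.lt i hi
    · obtain ⟨i, hi, h⟩ := hsort.surj v hv
      exact ⟨i, hi, by rw [(hu i hi).1, h]⟩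
    · rw [(hu i (by omega)).1, (hu j hj).1, ← hk₂ _ (hsort.lt i (by omega)),
        ← hk₂ _ (hsort.lt j hj)]
      exact hsort.mono i j hij hj
    · obtain ⟨h1, h2, h3⟩ := hu i hi
      rw [h1]
      exact ⟨h2, h3⟩

/-- For each point, in reverse order, find a highest line there. -/
def envelope : Program :=
  (assign qW (numLines + (.lit 1 - numLines)) ;; assign qNB (numLines / var qW) ;;
    assign qNN (var qNB * var qW) ;; assign qNQ numPoints) ;;
  forLoop gI numLines (.setReal rU (var gI) (.get rLA (var gI)) ;;
    .setReal rV (var gI) (.get rLC (var gI))) ;;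
  forLoop gI numPoints (.setReal rWQ (var gI) (.get rX (numPoints - .lit 1 - var gI)) ;;
    .setWord qQB (var gI) (.lit 0)) ;;
  maximize

/-- By duality the lines become the points (slope, intercept), forming a single block, and a point
with abscissa x asks for the maximum of intercept + x * slope. `maximize` wants decreasing
parameters, hence the reversed order `n - 1 - u`. -/
theorem envelope_runs {B n m : ℕ} {s : Store} (hn : s.word 0 0 = n) (hm : s.word 0 1 = m)
    (hB : 2 * (n + m + 1) < B)
    (hX : ∀ u v, u ≤ v → v < n → s.real rX u ≤ s.real rX v)
    (hA : ∀ u v, u ≤ v → v < m → s.real rLA u ≤ s.real rLA v) :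
    Runs B (n + 2 * m + 1) envelope s (fun v => ∀ u < n, 0 < m →
      v.word qAI (n - 1 - u) < m ∧ ∀ q < m, s.real rLA q * s.real rX u + s.real rLC q ≤
        s.real rLA (v.word qAI (n - 1 - u)) * s.real rX u +
          s.real rLC (v.word qAI (n - 1 - u))) := by
  -- The width is `max m 1`, so that it is positive and there is no block at all if `m = 0`.
  obtain ⟨w, hw⟩ : ∃ w, m + (1 - m) = w := ⟨_, rfl⟩
  obtain ⟨NB, hNB⟩ : ∃ NB, m / w = NB := ⟨_, rfl⟩
  have hw0 : 0 < w := by omega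
  have hNBw : NB * w = m := by
    rcases Nat.eq_zero_or_pos m with rfl | hpos
    · simp at hNB
      simp [← hNB]
    · have : w = m := by omega
      subst this
      rw [Nat.div_self hpos] at hNB
      rw [← hNB, one_mul]
  have hNBle : NB ≤ m := hNB ▸ Nat.div_le_self m w
  refine Runs.seq (Q := fun u => u.word qW 0 = w ∧ u.word qNB 0 = NB ∧ u.word qNN 0 = NB * w ∧
      u.word qNQ 0 = n) ((Runs.of_wp ?_).mono (by omega) fun _ _ h => h)
    fun s₁ f₁ ⟨hw₁, hNB₁, hNN₁, hNQ₁⟩ => ?_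
  · simp [hn, hm, hw, hNB, hNBw]
    omega
  refine Runs.seq (Q := fun u => ∀ q < m, u.real rU q = s.real rLA q ∧ u.real rV q = s.real rLC q)
    (Runs.mono (F := m + 1) ?_ (by omega) fun _ _ h => h) fun s₂ f₂ hUV => ?_
  · refine Runs.forLoop (fun k u => ∀ q < k, u.real rU q = s.real rLA q ∧
      u.real rV q = s.real rLC q) (by omega) ?_ (by simp) ?_
    · intro u hf
      simp [hf.word 0 rfl, f₁.word 0 rfl, hm]
    · intro k u hk hf hv hI
      simp only [wp, WordExpr.eval_get, WordExpr.eval_lit, RealExpr.eval_get, hv,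
        Store.putReal_real_self, Store.putReal_word, Store.putWord_real, Store.putReal_real_of_ne,
        ne_eq, Nat.reduceEqDiff, not_false_eq_true, Function.update_apply, hf.real rLA rfl,
        hf.real rLC rfl, f₁.real rLA rfl, f₁.real rLC rfl]
      refine ⟨by omega, by omega, trivial, fun i hi => ?_⟩
      split_ifs with h
      · simp [h]
      · exact hI i (by omega)
  refine Runs.seq (Q := fun u => ∀ q < n, u.real rWQ q = s.real rX (n - 1 - q) ∧
      u.word qQB q = 0)
    (Runs.mono (F := n + 1) ?_ (by omega) fun _ _ h => h) fun s₃ f₃ hWQ => ?_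
  · refine Runs.forLoop (fun k u => ∀ q < k, u.real rWQ q = s.real rX (n - 1 - q) ∧
      u.word qQB q = 0) (by omega) ?_ (by simp) ?_
    · intro u hf
      simp [hf.word 0 rfl, f₂.word 0 rfl, f₁.word 0 rfl, hn]
    · intro k u hk hf hv hI
      simp only [wp, WordExpr.eval_get, WordExpr.eval_lit, WordExpr.eval_sub, RealExpr.eval_get, hv,
        Store.putReal_real_self, Store.putReal_word, Store.putWord_real,
        Store.putWord_word_self, Store.putWord_word_of_ne,
        ne_eq, Nat.reduceEqDiff, not_false_eq_true, Function.update_apply, hf.real rX rfl,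
        f₂.real rX rfl, f₁.real rX rfl, hf.word 0 rfl, f₂.word 0 rfl, f₁.word 0 rfl, hn]
      refine ⟨by omega, by omega, by omega, trivial, fun i hi => ?_⟩
      split_ifs with h
      · simp [h]
      · exact hI i (by omega)
  have hUV' : s₃.real rU = s₂.real rU ∧ s₃.real rV = s₂.real rV :=
    ⟨f₃.real _ rfl, f₃.real _ rfl⟩
  refine (maximize_runs (B := B) (s := s₃) (w := w) (NB := NB) (NQ := n)
    (by rw [f₃.word qW rfl, f₂.word qW rfl, hw₁]) hw0
    (by rw [f₃.word qNN rfl, f₂.word qNN rfl, hNN₁])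
    (by rw [f₃.word qNB rfl, f₂.word qNB rfl, hNB₁])
    (by rw [f₃.word qNQ rfl, f₂.word qNQ rfl, hNQ₁]) (by omega) (by omega) ?_ ?_).mono (by omega) ?_
  · intro k l hkl hl
    rw [hNBw] at hl
    rw [hUV'.1, (hUV k (by omega)).1, (hUV l hl).1]
    exact hA k l hkl hl
  · intro k l hkl hl
    rw [(hWQ k (by omega)).1, (hWQ l hl).1]
    exact hX _ _ (by omega) (by omega)
  · intro v hf hans u hu hpos
    have hq := hWQ (n - 1 - u) (by omega)
    have hNB1 : 0 < NB := by
      by_contra h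
      simp [show NB = 0 by omega] at hNBw
      omega
    have h := hans (n - 1 - u) (by omega) (by rw [hq.2]; exact hNB1)
    have hwm : w = m := by omega
    rw [hq.1, hq.2, hUV'.1, hUV'.2, hwm, show n - 1 - (n - 1 - u) = u by omega] at h
    simp only [zero_mul, zero_add, one_mul] at h
    refine ⟨h.2.1, fun q hqm => ?_⟩
    have := h.2.2 q (Nat.zero_le q) hqm
    simp only [linVal] at this
    rw [(hUV q hqm).1, (hUV q hqm).2, (hUV _ h.2.1).1, (hUV _ h.2.1).2] at this
    linarith

/-- For each line, find the first point whose highest line is at least as steep. -/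
def positions : Program :=
  (assign gJ (.lit 0) ;; assign gK (.lit 0)) ;;
  .loop (.wordLt (var gJ) numLines)
    (.branch (.conj (.wordLt (var gK) numPoints)
        (.realLt (.get rLA (.get qAI (numPoints - .lit 1 - var gK))) (.get rLA (var gJ))))
      (assign gK (var gK + .lit 1))
      (.setWord gKs (var gJ) (var gK) ;; assign gJ (var gJ + .lit 1)))

/-- Two pointers suffice: a point whose highest line is less steep than line `j` stays excluded for
the later lines, which are at least as steep. -/
theorem positions_runs {B n m : ℕ} {s : Store} (hn : s.word 0 0 = n) (hm : s.word 0 1 = m)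
    (hB : n + m + 1 < B) (hA : ∀ u v, u ≤ v → v < m → s.real rLA u ≤ s.real rLA v) :
    Runs B (n + m + 1) positions s (fun v => ∀ j < m, v.word gKs j ≤ n ∧
      (∀ u < v.word gKs j, s.real rLA (s.word qAI (n - 1 - u)) < s.real rLA j) ∧
      (v.word gKs j < n → s.real rLA j ≤ s.real rLA (s.word qAI (n - 1 - v.word gKs j)))) := by
  refine (Runs.simpleInitLoop (fun v => v.word gK 0 ≤ n ∧ v.word gJ 0 ≤ m ∧
      (∀ u < v.word gK 0, v.word gJ 0 < m →
        s.real rLA (s.word qAI (n - 1 - u)) < s.real rLA (v.word gJ 0)) ∧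
      ∀ j < v.word gJ 0, v.word gKs j ≤ n ∧
      (∀ u < v.word gKs j, s.real rLA (s.word qAI (n - 1 - u)) < s.real rLA j) ∧
      (v.word gKs j < n → s.real rLA j ≤ s.real rLA (s.word qAI (n - 1 - v.word gKs j))))
    (fun v => (n - v.word gK 0) + (m - v.word gJ 0)) (n + m) ?_ ?_).mono le_rfl ?_
  · simp
    omega
  · rintro v hf ⟨hk, hj, hI, hd⟩ hb
    simp [hf.word 0 rfl, hm] at hb
    simp only [wp, Test.Holds, WordExpr.eval_get, WordExpr.eval_lit, WordExpr.eval_add,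
      WordExpr.eval_sub, RealExpr.eval_get, Store.putWord_word_self, Store.putWord_word_of_ne,
      ne_eq, Nat.reduceEqDiff, not_false_eq_true, Function.update_self, hf.word 0 rfl,
      hf.word qAI rfl, hf.real rLA rfl, hn]
    generalize v.word gK 0 = k at *
    generalize v.word gJ 0 = j at *
    refine ⟨fun hc => ⟨by omega, by omega, ⟨by omega, hj, fun u hu hjm => ?_, hd⟩, by omega⟩,
      fun hc => ⟨by omega, by omega, by omega, by omega, ⟨hk, by omega, fun u hu hjm => ?_,
        fun j' hj' => ?_⟩, by omega⟩⟩
    · rcases Nat.lt_succ_iff_lt_or_eq.1 hu with hu | rfl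
      · exact hI u hu hjm
      · exact hc.2
    · exact (hI u hu hb).trans_le (hA _ _ (Nat.le_succ j) hjm)
    · rw [Function.update_apply]
      split_ifs with h
      · subst h
        exact ⟨hk, fun u hu => hI u hu hb, fun hkn => not_lt.1 fun hlt => hc ⟨hkn, hlt⟩⟩
      · exact hd j' (by omega)
  · rintro v hf ⟨⟨hk, hj, hI, hd⟩, hb⟩ j' hj'
    simp [hf.word 0 rfl, hm] at hb
    exact hd j' (by omega)

end RealRAM

/-! ### The ends of the runs, and the greedy sweep -/

namespace RealRAM

/-- Extend the run of each line to the left, by a search in the mirrored input. -/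
def reachLeft : Program :=
  (assign tN numPoints ;; assign tM numLines) ;;
  forLoop gI numPoints (.setReal rU (var gI)
      (.ofWord (.lit 0) - .get rX (numPoints - .lit 1 - var gI)) ;;
    .setReal rV (var gI) (.get rY (numPoints - .lit 1 - var gI))) ;;
  forLoop gI numLines (.setReal rA (var gI)
      (.ofWord (.lit 0) - .get rLA (numLines - .lit 1 - var gI)) ;;
    .setReal rB (var gI) (.get rLC (numLines - .lit 1 - var gI)) ;;
    .setWord tPos (var gI) (numPoints - .get gKs (numLines - .lit 1 - var gI))) ;;
  reach ;;
  forLoop gI numLines (.setWord gL (var gI) (numPoints - .get tPos (numLines - .lit 1 - var gI)))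

/-- Negating abscissas and slopes and reversing both orders preserves sortedness and coverage. Point
`i` becomes `n - 1 - i`, but an interval boundary `p` becomes `n - p`. So the first bad position `R`
of the reflected search is the point just before the left end `n - R`. -/
theorem reachLeft_runs {B n m : ℕ} {s : Store} (hn : s.word 0 0 = n) (hm : s.word 0 1 = m)
    (hB : 8 * (n + m + 1) < B)
    (hX : ∀ u v, u ≤ v → v < n → s.real rX u ≤ s.real rX v)
    (hA : ∀ u v, u ≤ v → v < m → s.real rLA u ≤ s.real rLA v)
    (hK : ∀ j < m, s.word gKs j ≤ n) :
    Runs B ((m + 2 * n + 1) * (Nat.log 2 n + 2)) reachLeft s (fun v => ∀ j < m,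
      v.word gL j ≤ s.word gKs j ∧
      GoodOn (LineCovers (s.real rX) (s.real rY) (s.real rLA) (s.real rLC) n j)
        (v.word gL j) (s.word gKs j) ∧
      (0 < v.word gL j →
        ¬ LineCovers (s.real rX) (s.real rY) (s.real rLA) (s.real rLC) n j (v.word gL j - 1))) := by
  have hF : m + 2 * n + 1 ≤ (m + 2 * n + 1) * (Nat.log 2 n + 2) :=
    Nat.le_mul_of_pos_right _ (by omega)
  refine Runs.seq (Q := fun u => u.word tN 0 = n ∧ u.word tM 0 = m)
    ((Runs.of_wp (by simp [hn, hm]; omega)).mono (by omega) fun _ _ h => h)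
    fun s₁ f₁ ⟨hn₁, hm₁⟩ => ?_
  refine Runs.seq (Q := fun u => ∀ i < n, u.real rU i = 0 - s.real rX (n - 1 - i) ∧
      u.real rV i = s.real rY (n - 1 - i))
    (Runs.mono (F := n + 1) ?_ (by omega) fun _ _ h => h) fun s₂ f₂ h₂ => ?_
  · refine Runs.forLoop (fun k u => ∀ i < k, u.real rU i = 0 - s.real rX (n - 1 - i) ∧
      u.real rV i = s.real rY (n - 1 - i)) (by omega) ?_ (by simp) ?_
    · intro u hf
      simp [hf.word 0 rfl, f₁.word 0 rfl, hn]
    · intro k u hk hf hv hI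
      simp only [wp, WordExpr.eval_get, WordExpr.eval_lit, WordExpr.eval_sub, RealExpr.eval_get,
        RealExpr.eval_sub, RealExpr.eval_ofWord, Nat.cast_zero, hv,
        Store.putReal_real_self, Store.putReal_word, Store.putWord_real, Store.putReal_real_of_ne,
        ne_eq, Nat.reduceEqDiff, not_false_eq_true, Function.update_apply, hf.real rX rfl,
        hf.real rY rfl, f₁.real rX rfl, f₁.real rY rfl, hf.word 0 rfl, f₁.word 0 rfl, hn]
      refine ⟨by omega, by omega, trivial, fun i hi => ?_⟩
      split_ifs with h
      · simp [h]
      · exact hI i (by omega)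
  refine Runs.seq (Q := fun u => ∀ i < m, u.real rA i = 0 - s.real rLA (m - 1 - i) ∧
      u.real rB i = s.real rLC (m - 1 - i) ∧ u.word tPos i = n - s.word gKs (m - 1 - i))
    (Runs.mono (F := m + 1) ?_ (by omega) fun _ _ h => h) fun s₃ f₃ h₃ => ?_
  · refine Runs.forLoop (fun k u => ∀ i < k, u.real rA i = 0 - s.real rLA (m - 1 - i) ∧
      u.real rB i = s.real rLC (m - 1 - i) ∧ u.word tPos i = n - s.word gKs (m - 1 - i))
      (by omega) ?_ (by simp) ?_
    · intro u hf
      simp [hf.word 0 rfl, f₂.word 0 rfl, f₁.word 0 rfl, hm]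
    · intro k u hk hf hv hI
      simp only [wp, WordExpr.eval_get, WordExpr.eval_lit, WordExpr.eval_sub, RealExpr.eval_get,
        RealExpr.eval_sub, RealExpr.eval_ofWord, Nat.cast_zero, hv,
        Store.putReal_real_self, Store.putReal_word, Store.putWord_real, Store.putReal_real_of_ne,
        Store.putWord_word_self, Store.putWord_word_of_ne,
        ne_eq, Nat.reduceEqDiff, not_false_eq_true, Function.update_apply, hf.real rLA rfl,
        hf.real rLC rfl, f₂.real rLA rfl, f₁.real rLA rfl, f₂.real rLC rfl, f₁.real rLC rfl,
        hf.word 0 rfl, f₂.word 0 rfl, f₁.word 0 rfl, hf.word gKs rfl, f₂.word gKs rfl,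
        f₁.word gKs rfl, hn, hm]
      refine ⟨by omega, by omega, by omega, by omega, trivial, fun i hi => ?_⟩
      split_ifs with h
      · simp [h]
      · exact hI i (by omega)
  have hr₃ : s₃.real rU = s₂.real rU ∧ s₃.real rV = s₂.real rV :=
    ⟨f₃.real _ rfl, f₃.real _ rfl⟩
  refine Runs.seq (reach_runs (n := n) (m := m)
    (by rw [f₃.word tN rfl, f₂.word tN rfl, hn₁]) (by rw [f₃.word tM rfl, f₂.word tM rfl, hm₁])
    hB ?_ ?_ ?_) fun s₄ f₄ h₄ => ?_
  · intro k l hkl hl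
    rw [hr₃.1, (h₂ k (by omega)).1, (h₂ l hl).1]
    have := hX (n - 1 - l) (n - 1 - k) (by omega) (by omega)
    linarith
  · intro k l hkl hl
    rw [(h₃ k (by omega)).1, (h₃ l hl).1]
    have := hA (m - 1 - l) (m - 1 - k) (by omega) (by omega)
    linarith
  · intro q hq
    rw [(h₃ q hq).2.2]
    omega
  have hcov : ∀ j < m, ∀ i < n,
      (LineCovers (s₃.real rU) (s₃.real rV) (s₃.real rA) (s₃.real rB) n (m - 1 - j) i ↔
        LineCovers (s.real rX) (s.real rY) (s.real rLA) (s.real rLC) n j (n - 1 - i)) := by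
    intro j hj i hi
    have h3 := h₃ (m - 1 - j) (by omega)
    rw [show m - 1 - (m - 1 - j) = j by omega] at h3
    rw [LineCovers, LineCovers, hr₃.1, hr₃.2, (h₂ i hi).1, (h₂ i hi).2, h3.1, h3.2.1]
    have : (0 - s.real rLA j) * (0 - s.real rX (n - 1 - i)) =
        s.real rLA j * s.real rX (n - 1 - i) := by ring
    rw [this]
    exact and_congr_left fun _ => ⟨fun _ => by omega, fun _ => hi⟩
  refine (Runs.forLoop (N := m) (fun k u => ∀ i < k,
    u.word gL i = n - s₄.word tPos (m - 1 - i)) (by omega) ?_ (by simp) ?_).mono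
    (by omega) ?_
  · intro u hf
    simp [hf.word 0 rfl, f₄.word 0 rfl, f₃.word 0 rfl, f₂.word 0 rfl, f₁.word 0 rfl, hm]
  · intro k u hk hf hv hI
    simp only [wp, WordExpr.eval_get, WordExpr.eval_lit, WordExpr.eval_sub, hv,
      Store.putWord_word_self, Store.putWord_word_of_ne,
      ne_eq, Nat.reduceEqDiff, not_false_eq_true, Function.update_apply,
      hf.word 0 rfl, f₄.word 0 rfl, f₃.word 0 rfl, f₂.word 0 rfl, f₁.word 0 rfl,
      hf.word tPos rfl, hn, hm]
    refine ⟨by omega, by omega, trivial, fun i hi => ?_⟩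
    split_ifs with h
    · simp [h]
    · exact hI i (by omega)
  · intro v hf hv j hj
    obtain ⟨h1, h2, h3⟩ := h₄ (m - 1 - j) (by omega)
    have hle := GoodOn.le (fun _ h => h.1)
      (by rw [(h₃ (m - 1 - j) (by omega)).2.2]; omega) h1 h2
    rw [(h₃ (m - 1 - j) (by omega)).2.2, show m - 1 - (m - 1 - j) = j by omega] at h1 h2
    rw [hv j hj]
    have hKj := hK j hj
    generalize s₄.word tPos (m - 1 - j) = R at *
    refine ⟨by omega, fun i hi hiK => ?_, fun hpos hc => h3 ?_⟩
    · have := (hcov j hj (n - 1 - i) (by omega)).1 (h2 _ (by omega) (by omega))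
      rwa [show n - 1 - (n - 1 - i) = i by omega] at this
    · rw [hcov j hj R (by omega), show n - 1 - R = n - R - 1 by omega]
      exact hc

/-- Extend the run of each line to the right. -/
def reachRight : Program :=
  (assign tN numPoints ;; assign tM numLines) ;;
  forLoop gI numPoints (.setReal rU (var gI) (.get rX (var gI)) ;;
    .setReal rV (var gI) (.get rY (var gI))) ;;
  forLoop gI numLines (.setReal rA (var gI) (.get rLA (var gI)) ;;
    .setReal rB (var gI) (.get rLC (var gI)) ;;
    .setWord tPos (var gI) (.get gKs (var gI))) ;;
  reach

theorem reachRight_runs {B n m : ℕ} {s : Store} (hn : s.word 0 0 = n) (hm : s.word 0 1 = m)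
    (hB : 8 * (n + m + 1) < B)
    (hX : ∀ u v, u ≤ v → v < n → s.real rX u ≤ s.real rX v)
    (hA : ∀ u v, u ≤ v → v < m → s.real rLA u ≤ s.real rLA v)
    (hK : ∀ j < m, s.word gKs j ≤ n) :
    Runs B ((m + 2 * n + 1) * (Nat.log 2 n + 2)) reachRight s (fun v => ∀ j < m,
      IsFirstBad (LineCovers (s.real rX) (s.real rY) (s.real rLA) (s.real rLC) n j)
        (s.word gKs j) (v.word tPos j)) := by
  have hF : m + 2 * n + 1 ≤ (m + 2 * n + 1) * (Nat.log 2 n + 2) :=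
    Nat.le_mul_of_pos_right _ (by omega)
  refine Runs.seq (Q := fun u => u.word tN 0 = n ∧ u.word tM 0 = m)
    ((Runs.of_wp (by simp [hn, hm]; omega)).mono (by omega) fun _ _ h => h)
    fun s₁ f₁ ⟨hn₁, hm₁⟩ => ?_
  refine Runs.seq (Q := fun u => ∀ i < n, u.real rU i = s.real rX i ∧
      u.real rV i = s.real rY i)
    (Runs.mono (F := n + 1) ?_ (by omega) fun _ _ h => h) fun s₂ f₂ h₂ => ?_
  · refine Runs.forLoop (fun k u => ∀ i < k, u.real rU i = s.real rX i ∧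
      u.real rV i = s.real rY i) (by omega) ?_ (by simp) ?_
    · intro u hf
      simp [hf.word 0 rfl, f₁.word 0 rfl, hn]
    · intro k u hk hf hv hI
      simp only [wp, WordExpr.eval_get, WordExpr.eval_lit, RealExpr.eval_get, hv,
        Store.putReal_real_self, Store.putReal_word, Store.putWord_real, Store.putReal_real_of_ne,
        ne_eq, Nat.reduceEqDiff, not_false_eq_true, Function.update_apply, hf.real rX rfl,
        hf.real rY rfl, f₁.real rX rfl, f₁.real rY rfl]
      refine ⟨by omega, by omega, trivial, fun i hi => ?_⟩
      split_ifs with h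
      · simp [h]
      · exact hI i (by omega)
  refine Runs.seq (Q := fun u => ∀ i < m, u.real rA i = s.real rLA i ∧
      u.real rB i = s.real rLC i ∧ u.word tPos i = s.word gKs i)
    (Runs.mono (F := m + 1) ?_ (by omega) fun _ _ h => h) fun s₃ f₃ h₃ => ?_
  · refine Runs.forLoop (fun k u => ∀ i < k, u.real rA i = s.real rLA i ∧
      u.real rB i = s.real rLC i ∧ u.word tPos i = s.word gKs i) (by omega) ?_ (by simp) ?_
    · intro u hf
      simp [hf.word 0 rfl, f₂.word 0 rfl, f₁.word 0 rfl, hm]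
    · intro k u hk hf hv hI
      have := hK k hk
      simp only [wp, WordExpr.eval_get, WordExpr.eval_lit, RealExpr.eval_get, hv,
        Store.putReal_real_self, Store.putReal_word, Store.putWord_real, Store.putReal_real_of_ne,
        Store.putWord_word_self, Store.putWord_word_of_ne,
        ne_eq, Nat.reduceEqDiff, not_false_eq_true, Function.update_apply, hf.real rLA rfl,
        hf.real rLC rfl, f₂.real rLA rfl, f₁.real rLA rfl, f₂.real rLC rfl, f₁.real rLC rfl,
        hf.word gKs rfl, f₂.word gKs rfl, f₁.word gKs rfl]
      refine ⟨by omega, by omega, by omega, by omega, trivial, fun i hi => ?_⟩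
      split_ifs with h
      · simp [h]
      · exact hI i (by omega)
  have hr₃ : s₃.real rU = s₂.real rU ∧ s₃.real rV = s₂.real rV :=
    ⟨f₃.real _ rfl, f₃.real _ rfl⟩
  refine (reach_runs (n := n) (m := m)
    (by rw [f₃.word tN rfl, f₂.word tN rfl, hn₁]) (by rw [f₃.word tM rfl, f₂.word tM rfl, hm₁])
    hB ?_ ?_ ?_).mono le_rfl fun s₄ f₄ h₄ j hj => ?_
  · intro k l hkl hl
    rw [hr₃.1, (h₂ k (by omega)).1, (h₂ l hl).1]
    exact hX k l hkl hl
  · intro k l hkl hl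
    rw [(h₃ k (by omega)).1, (h₃ l hl).1]
    exact hA k l hkl hl
  · intro q hq
    rw [(h₃ q hq).2.2]
    exact hK q hq
  · have hcov : LineCovers (s₃.real rU) (s₃.real rV) (s₃.real rA) (s₃.real rB) n j =
        LineCovers (s.real rX) (s.real rY) (s.real rLA) (s.real rLC) n j := by
      funext i
      refine propext (and_congr_right fun hi => ?_)
      rw [hr₃.1, hr₃.2, (h₂ i hi).1, (h₂ i hi).2, (h₃ j hj).1, (h₃ j hj).2.1]
    have := h₄ j hj
    rwa [(h₃ j hj).2.2, hcov] at this

/-- For each starting position, find the run from there that reaches farthest. -/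
def buckets : Program :=
  forLoop gI (numPoints + .lit 1) (.setWord gBR (var gI) (.lit 0)) ;;
  forLoop gJ numLines (.branch
    (.wordLt (.get gBR (.get gL (var gJ))) (.get tPos (var gJ)))
    (.setWord gBR (.get gL (var gJ)) (.get tPos (var gJ)) ;;
      .setWord gBJ (.get gL (var gJ)) (var gJ))
    .skip)

/-- Among the first `m` runs `[l j, r j)` that start at `p`, the one with number `BJ p` reaches
farthest, to `BR p`; if there is none then `BR p = 0`. -/
def IsBucketing (l r : ℕ → ℕ) (n m : ℕ) (BR BJ : ℕ → ℕ) : Prop :=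
  (∀ j < m, r j ≤ BR (l j)) ∧
    ∀ p ≤ n, 0 < BR p → BJ p < m ∧ l (BJ p) = p ∧ r (BJ p) = BR p

theorem buckets_runs {B n m : ℕ} {s : Store} (hn : s.word 0 0 = n) (hm : s.word 0 1 = m)
    (hB : n + m + 1 < B) (hl : ∀ j < m, s.word gL j ≤ n) (hr : ∀ j < m, s.word tPos j ≤ n) :
    Runs B (n + m + 2) buckets s (fun v =>
      IsBucketing (s.word gL) (s.word tPos) n m (v.word gBR) (v.word gBJ)) := by
  refine Runs.seq (Q := fun u => ∀ i < n + 1, u.word gBR i = 0)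
    (Runs.mono (F := n + 1 + 1) ?_ (by omega) fun _ _ h => h) fun s₁ f₁ h₁ => ?_
  · refine Runs.forLoop (fun k u => ∀ i < k, u.word gBR i = 0) (by omega) ?_ (by simp) ?_
    · intro u hf
      simp [hf.word 0 rfl, hn]
    · intro k u hk hf hv hI
      simp only [wp, WordExpr.eval_get, WordExpr.eval_lit, hv, Store.putWord_word_self,
        Store.putWord_word_of_ne, ne_eq, Nat.reduceEqDiff, not_false_eq_true,
        Function.update_apply]
      refine ⟨by omega, by omega, trivial, fun i hi => ?_⟩
      split_ifs with h
      · rfl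
      · exact hI i (by omega)
  refine (Runs.forLoop (N := m) (fun k u => IsBucketing (s.word gL) (s.word tPos) n k
    (u.word gBR) (u.word gBJ)) (by omega) ?_ ?_ ?_).mono (by omega) fun _ _ h => h
  · intro u hf
    simp [hf.word 0 rfl, f₁.word 0 rfl, hm]
  · refine ⟨by simp, fun p hp hpos => ?_⟩
    simp [h₁ p (by omega)] at hpos
  · intro k u hk hf hv hI
    have h1 := hl k hk
    have h2 := hr k hk
    simp only [wp, Test.Holds, WordExpr.eval_get, WordExpr.eval_lit, hv, Store.putWord_word_self,
      Store.putWord_word_of_ne, ne_eq, Nat.reduceEqDiff, not_false_eq_true,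
      hf.word gL rfl, f₁.word gL rfl, hf.word tPos rfl, f₁.word tPos rfl]
    refine ⟨fun hc => ⟨by omega, by omega, by omega, by omega, trivial, fun j hj => ?_,
      fun p hp hpos => ?_⟩, fun hc => ⟨trivial, fun j hj => ?_, fun p hp hpos => ?_⟩⟩
    · by_cases hjl : s.word gL j = s.word gL k
      · rw [hjl, Function.update_self]
        rcases Nat.lt_succ_iff_lt_or_eq.1 hj with hj | rfl
        · have := hI.1 j hj
          rw [hjl] at this
          omega
        · exact le_rfl
      · rw [Function.update_of_ne hjl]
        refine hI.1 j ?_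
        rcases Nat.lt_succ_iff_lt_or_eq.1 hj with hj | rfl
        · exact hj
        · exact (hjl rfl).elim
    · by_cases hpl : p = s.word gL k
      · subst hpl
        rw [Function.update_self, Function.update_self]
        exact ⟨Nat.lt_succ_self k, rfl, rfl⟩
      · rw [Function.update_of_ne hpl] at hpos
        rw [Function.update_of_ne hpl, Function.update_of_ne hpl]
        have := hI.2 p hp hpos
        exact ⟨by omega, this.2⟩
    · rcases Nat.lt_succ_iff_lt_or_eq.1 hj with hj | rfl
      · exact hI.1 j hj
      · exact not_lt.1 hc
    · have := hI.2 p hp hpos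
      exact ⟨by omega, this.2⟩

/-- Choose runs greedily, and report the result. -/
def sweep : Program :=
  ((assign gI (.lit 0) ;; assign gEnd (.lit 0) ;; assign gCur (.lit 0) ;; assign gCurJ (.lit 0) ;;
    assign gCnt (.lit 0) ;; assign gOk (.lit 1)) ;;
  .loop (.conj (.wordLt (var gI) numPoints) (.wordEq (var gOk) (.lit 1)))
    (.branch (.wordLt (var gCur) (.get gBR (var gI)))
      (assign gCur (.get gBR (var gI)) ;; assign gCurJ (.get gBJ (var gI))) .skip ;;
    .branch (.wordEq (var gI) (var gEnd))
      (.branch (.wordLt (var gI) (var gCur))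
        (.setWord 2 (var gCnt) (.get gIdx (var gCurJ)) ;; assign gCnt (var gCnt + .lit 1) ;;
          assign gEnd (var gCur) ;; assign gI (var gI + .lit 1))
        (assign gOk (.lit 0)))
      (assign gI (var gI + .lit 1)))) ;;
  (.setWord 1 (.lit 0) (var gOk) ;; .setWord 1 (.lit 1) (var gCnt))

/-- The state of the greedy choice at point `i`: the first `e` points are covered by the `cnt` chosen
runs, and among the runs that start before `p` the run `curj` reaches farthest, to `cur`. -/
structure SweepInv (l r idx : ℕ → ℕ) (n m p i e cur curj cnt ok : ℕ) (sol : ℕ → ℕ) : Prop where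
  cnt_le : cnt ≤ i
  i_le : i ≤ e
  e_le : e ≤ n
  greedy : ∃ out, IsGreedy l r m out cnt ∧ e = covered r out cnt ∧ ∀ t < cnt, sol t = idx (out t)
  cur_max : ok = 1 → ∀ j < m, l j < p → r j ≤ cur
  cur_eq : ok = 1 → 0 < cur → curj < m ∧ l curj < p ∧ r curj = cur
  ok_or : ok = 1 ∨ ok = 0 ∧ i < n ∧ ∀ j < m, l j ≤ i → r j ≤ i

section Sweep

variable {l r idx sol BR BJ : ℕ → ℕ} {n m i e cur curj cnt : ℕ}

theorem SweepInv.improve (h : SweepInv l r idx n m i i e cur curj cnt 1 sol)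
    (hb : IsBucketing l r n m BR BJ) (hi : i < n) (hc : cur < BR i) :
    SweepInv l r idx n m (i + 1) i e (BR i) (BJ i) cnt 1 sol := by
  have hbi := hb.2 i hi.le (by omega)
  refine ⟨h.cnt_le, h.i_le, h.e_le, h.greedy, fun _ j hj hl => ?_,
    fun _ _ => ⟨hbi.1, by omega, hbi.2.2⟩, Or.inl rfl⟩
  rcases Nat.lt_succ_iff_lt_or_eq.1 hl with hl | hl
  · exact (h.cur_max rfl j hj hl).trans hc.le
  · exact hl ▸ hb.1 j hj

theorem SweepInv.keep (h : SweepInv l r idx n m i i e cur curj cnt 1 sol)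
    (hb : IsBucketing l r n m BR BJ) (hc : ¬ cur < BR i) :
    SweepInv l r idx n m (i + 1) i e cur curj cnt 1 sol := by
  refine ⟨h.cnt_le, h.i_le, h.e_le, h.greedy, fun _ j hj hl => ?_,
    fun _ hpos => ?_, Or.inl rfl⟩
  · rcases Nat.lt_succ_iff_lt_or_eq.1 hl with hl | hl
    · exact h.cur_max rfl j hj hl
    · have := hb.1 j hj
      rw [hl] at this
      omega
  · have := h.cur_eq rfl hpos
    exact ⟨this.1, by omega, this.2.2⟩

/-- At `i = e` all runs starting at or before the first uncovered point have been inspected, so the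
recorded run `curj` is a greedy choice. -/
theorem SweepInv.choose (h : SweepInv l r idx n m (i + 1) i e cur curj cnt 1 sol)
    (hr : ∀ j < m, r j ≤ n) (hie : i = e) (hc : i < cur) :
    SweepInv l r idx n m (i + 1) (i + 1) cur cur curj (cnt + 1) 1
      (Function.update sol cnt (idx curj)) := by
  obtain ⟨h1, h2, h3⟩ := h.cur_eq rfl (by omega)
  obtain ⟨out, hg, he, hs⟩ := h.greedy
  have := h.cnt_le
  refine ⟨by omega, by omega, h3 ▸ hr curj h1, ⟨Function.update out cnt curj, ?_, ?_, ?_⟩,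
    h.cur_max, h.cur_eq, Or.inl rfl⟩
  · exact hg.snoc h1 (by omega) (by omega) fun j hj hl => h3 ▸ h.cur_max rfl j hj (by omega)
  · rw [covered_succ, Function.update_self, h3]
  · intro t ht
    rcases Nat.lt_succ_iff_lt_or_eq.1 ht with ht | rfl
    · rw [Function.update_of_ne ht.ne, Function.update_of_ne ht.ne]
      exact hs t ht
    · rw [Function.update_self, Function.update_self]

/-- No run starting at or before `i` goes beyond `i`. This is the certificate of infeasibility used
by `IsRunSystem.not_feasible`. -/
theorem SweepInv.stuck (h : SweepInv l r idx n m (i + 1) i e cur curj cnt 1 sol) (hi : i < n)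
    (hc : ¬ i < cur) : SweepInv l r idx n m i i e cur curj cnt 0 sol := by
  refine ⟨h.cnt_le, h.i_le, h.e_le, h.greedy, by omega, by omega,
    Or.inr ⟨rfl, hi, fun j hj hl => ?_⟩⟩
  have := h.cur_max rfl j hj (by omega)
  omega

theorem SweepInv.pass (h : SweepInv l r idx n m (i + 1) i e cur curj cnt 1 sol) (hie : i ≠ e) :
    SweepInv l r idx n m (i + 1) (i + 1) e cur curj cnt 1 sol := by
  have h1 := h.cnt_le
  have h2 := h.i_le
  exact ⟨by omega, by omega, h.e_le, h.greedy, h.cur_max, h.cur_eq, Or.inl rfl⟩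

end Sweep

theorem sweep_runs {B n m : ℕ} {s : Store} (hn : s.word 0 0 = n)
    (hB : n + m + 2 < B) (hr : ∀ j < m, s.word tPos j ≤ n) (hidx : ∀ j < m, s.word gIdx j < m)
    (hb : IsBucketing (s.word gL) (s.word tPos) n m (s.word gBR) (s.word gBJ)) :
    Runs B (n + 2) sweep s (fun v =>
      (v.word 1 0 = 1 ∧ ∃ out, IsGreedy (s.word gL) (s.word tPos) m out (v.word 1 1) ∧
        n ≤ covered (s.word tPos) out (v.word 1 1) ∧
        ∀ t < v.word 1 1, v.word 2 t = s.word gIdx (out t)) ∨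
      (v.word 1 0 = 0 ∧ ∃ i < n, ∀ j < m, s.word gL j ≤ i → s.word tPos j ≤ i)) := by
  refine Runs.seq ((Runs.simpleInitLoop (fun v => v.word gI 0 ≤ n ∧
      SweepInv (s.word gL) (s.word tPos) (s.word gIdx) n m (v.word gI 0) (v.word gI 0)
        (v.word gEnd 0) (v.word gCur 0) (v.word gCurJ 0) (v.word gCnt 0) (v.word gOk 0)
        -- The flag is part of the measure because the round that gets stuck does not advance `gI`.
        (v.word 2)) (fun v => n - v.word gI 0 + v.word gOk 0) (n + 1) ?_ ?_).mono le_rfl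
      fun _ _ h => h) fun u hf ⟨⟨hi, hI⟩, hb⟩ => ?_
  · simp
    refine ⟨by omega, by omega, ⟨le_rfl, le_rfl, by omega, ⟨fun _ => 0, fun t ht => by omega,
      by simp [covered], fun t ht => by omega⟩, by omega, by omega, Or.inl rfl⟩⟩
  · rintro v hf ⟨-, hI⟩ hc
    simp [hf.word 0 rfl, hn] at hc
    rw [hc.2] at hI
    have hstep : ∀ c cj, SweepInv (s.word gL) (s.word tPos) (s.word gIdx) n m (v.word gI 0 + 1)
        (v.word gI 0) (v.word gEnd 0) c cj (v.word gCnt 0) 1 (v.word 2) → v.word gI 0 < c →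
        s.word gIdx cj < m ∧ c ≤ n := by
      intro c cj h hlt
      obtain ⟨h1, -, h3⟩ := h.cur_eq rfl (by omega)
      exact ⟨hidx cj h1, h3 ▸ hr cj h1⟩
    simp only [wp, Test.Holds, WordExpr.eval_get, WordExpr.eval_lit, WordExpr.eval_add,
      Store.putWord_word_self, Store.putWord_word_of_ne, ne_eq, Nat.reduceEqDiff,
      not_false_eq_true, Function.update_self, hf.word gBR rfl, hf.word gBJ rfl, hf.word gIdx rfl,
      hc.2]
    have hcnt := hI.cnt_le
    generalize v.word gI 0 = i at *
    generalize v.word gCnt 0 = cnt at *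
    refine ⟨fun hlt => ?_, fun hlt => ?_⟩
    · have h' := hI.improve hb hc.1 hlt
      have hbi := hb.2 i hc.1.le (by omega)
      have hrn := hr _ hbi.1
      refine ⟨by omega, by omega, by omega, by omega, fun hie => ⟨fun hic => ?_, fun hic => ?_⟩,
        fun hie => ?_⟩
      · have h1 := hstep _ _ h' hic
        have h2 := h'.choose hr hie hic
        and_intros <;> omega
      · have h2 := h'.stuck hc.1 hic
        and_intros <;> omega
      · have h2 := h'.pass hie
        and_intros <;> omega
    · have h' := hI.keep hb hlt
      refine ⟨fun hie => ⟨fun hic => ?_, fun hic => ?_⟩, fun hie => ?_⟩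
      · have h1 := hstep _ _ h' hic
        have h2 := h'.choose hr hie hic
        and_intros <;> omega
      · have h2 := h'.stuck hc.1 hic
        and_intros <;> omega
      · have h2 := h'.pass hie
        and_intros <;> omega
  · simp [hf.word 0 rfl, hn] at hb
    have hcnt := hI.cnt_le
    refine (Runs.of_wp ?_).mono (by omega) fun _ _ h => h
    have hok : u.word gOk 0 ≤ 1 := by
      rcases hI.ok_or with h | ⟨h, -⟩ <;> omega
    simp
    refine ⟨by omega, by omega, by omega, by omega, ?_⟩
    rcases hI.ok_or with h | ⟨h, hin, hst⟩
    · obtain ⟨out, hg, he, hs⟩ := hI.greedy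
      refine Or.inl ⟨h, out, hg, ?_, hs⟩
      have : ¬ u.word gI 0 < n := fun h' => hb h' h
      have := hI.i_le
      omega
    · exact Or.inr ⟨h, _, hin, hst⟩

end RealRAM

/-! ### The whole program, its running time, and the theorem -/

namespace RealRAM

/-- The program that solves the coverage problem. -/
def coverProgram : Program :=
  sortPairs numPoints 0 1 rX rY gPerm ;; sortPairs numLines 2 3 rLA rLC gIdx ;;
  envelope ;; positions ;; reachLeft ;; reachRight ;; buckets ;; sweep

/-- A bound for the number of times that an instruction is executed. -/
def coverFactor (N : ℕ) : ℕ := (2 * N + 2) * (Nat.log 2 N + 2)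

theorem le_coverFactor {a b n N : ℕ} (ha : a ≤ 2 * N + 2) (hn : n ≤ N)
    (hb : b ≤ a * (Nat.log 2 n + 2)) : b ≤ coverFactor N :=
  hb.trans (Nat.mul_le_mul ha (Nat.add_le_add_right (Nat.log_mono_right hn) 2))

/-- The existential statement extracts from the stores the purely mathematical data (sorted arrays,
run system, greedy choice), so that the machine is no longer needed in the proof of correctness. -/
theorem coverProgram_runs {B n m : ℕ} {s : Store} (hn : s.word 0 0 = n) (hm : s.word 0 1 = m)
    (hB : 8 * (n + m + 1) < B) :
    Runs B (coverFactor (n + m)) coverProgram s (fun v =>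
      ∃ X Y A C : ℕ → ℝ, ∃ σ τ c K l r : ℕ → ℕ,
        IsSorting (s.real 0) n σ ∧ (∀ i < n, X i = s.real 0 (σ i) ∧ Y i = s.real 1 (σ i)) ∧
        IsSorting (s.real 2) m τ ∧ (∀ i < m, A i = s.real 2 (τ i) ∧ C i = s.real 3 (τ i)) ∧
        IsRunSystem X Y A C n m c K l r ∧
        ((v.word 1 0 = 1 ∧ ∃ out, IsGreedy l r m out (v.word 1 1) ∧
          n ≤ covered r out (v.word 1 1) ∧ ∀ t < v.word 1 1, v.word 2 t = τ (out t)) ∨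
        (v.word 1 0 = 0 ∧ ∃ i < n, ∀ j < m, l j ≤ i → r j ≤ i))) := by
  have hlin : ∀ b, b ≤ 2 * (n + m) + 2 → b ≤ coverFactor (n + m) := fun b hb =>
    le_coverFactor hb (Nat.zero_le _) (Nat.le_mul_of_pos_right _ (by omega) : b ≤ b * (_ + 2))
  refine Runs.seq ((sortPairs_runs (e := numPoints) (a := 0) (b := 1) (x := rX) (y := rY)
    (g := gPerm) (s := s) hn (by omega) (by omega) (by omega) (by omega) (by omega) (by omega)
    (by omega)).mono (le_coverFactor (by omega) (by omega) le_rfl) fun _ _ h => h)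
    fun s₁ f₁ ⟨hσ, hXY⟩ => ?_
  refine Runs.seq ((sortPairs_runs (e := numLines) (a := 2) (b := 3) (x := rLA) (y := rLC)
    (g := gIdx) (s := s₁) (N := m) (by rw [← hm, ← f₁.word 0 rfl]; rfl) (by omega) (by omega)
    (by omega) (by omega) (by omega) (by omega)
    (by omega)).mono (le_coverFactor (by omega) (by omega) le_rfl) fun _ _ h => h)
    fun s₂ f₂ ⟨hτ, hAC⟩ => ?_
  rw [f₁.real 2 rfl] at hτ hAC
  rw [f₁.real 3 rfl] at hAC
  obtain ⟨X, hX⟩ : ∃ X, s₁.real rX = X := ⟨_, rfl⟩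
  obtain ⟨Y, hY⟩ : ∃ Y, s₁.real rY = Y := ⟨_, rfl⟩
  obtain ⟨σ, hs₁⟩ : ∃ σ, s₁.word gPerm = σ := ⟨_, rfl⟩
  obtain ⟨A, hA⟩ : ∃ A, s₂.real rLA = A := ⟨_, rfl⟩
  obtain ⟨C, hC⟩ : ∃ C, s₂.real rLC = C := ⟨_, rfl⟩
  obtain ⟨τ, hs₂⟩ : ∃ τ, s₂.word gIdx = τ := ⟨_, rfl⟩
  rw [hX, hY, hs₁] at hXY
  rw [hs₁] at hσ
  rw [hA, hC, hs₂] at hAC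
  rw [hs₂] at hτ
  have hX₂ : s₂.real rX = X := by rw [f₂.real rX rfl, hX]
  have hY₂ : s₂.real rY = Y := by rw [f₂.real rY rfl, hY]
  have hn₂ : s₂.word 0 0 = n := by rw [f₂.word 0 rfl, f₁.word 0 rfl, hn]
  have hm₂ : s₂.word 0 1 = m := by rw [f₂.word 0 rfl, f₁.word 0 rfl, hm]
  have monoX : ∀ u v, u ≤ v → v < n → X u ≤ X v := by
    intro u v huv hv
    rw [(hXY u (by omega)).1, (hXY v hv).1]
    exact hσ.mono u v huv hv
  have monoA : ∀ u v, u ≤ v → v < m → A u ≤ A v := by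
    intro u v huv hv
    rw [(hAC u (by omega)).1, (hAC v hv).1]
    exact hτ.mono u v huv hv
  refine Runs.seq ((envelope_runs hn₂ hm₂ (by omega) (hX₂ ▸ monoX) (hA ▸ monoA)).mono
    (hlin _ (by omega)) fun _ _ h => h) fun s₃ f₃ h₃ => ?_
  rw [hX₂, hA, hC] at h₃
  obtain ⟨c, hc⟩ : ∃ c : ℕ → ℕ, ∀ u, s₃.word qAI (n - 1 - u) = c u := ⟨_, fun _ => rfl⟩
  simp only [hc] at h₃
  have hA₃ : s₃.real rLA = A := by rw [f₃.real rLA rfl, hA]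
  have hn₃ : s₃.word 0 0 = n := by rw [f₃.word 0 rfl, hn₂]
  have hm₃ : s₃.word 0 1 = m := by rw [f₃.word 0 rfl, hm₂]
  refine Runs.seq ((positions_runs hn₃ hm₃ (by omega) (hA₃ ▸ monoA)).mono (hlin _ (by omega))
    fun _ _ h => h) fun s₄ f₄ h₄ => ?_
  simp only [hc, hA₃] at h₄
  obtain ⟨K, hK⟩ : ∃ K, s₄.word gKs = K := ⟨_, rfl⟩
  rw [hK] at h₄
  have hn₄ : s₄.word 0 0 = n := by rw [f₄.word 0 rfl, hn₃]
  have hm₄ : s₄.word 0 1 = m := by rw [f₄.word 0 rfl, hm₃]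
  have hX₄ : s₄.real rX = X := by rw [f₄.real rX rfl, f₃.real rX rfl, hX₂]
  have hY₄ : s₄.real rY = Y := by rw [f₄.real rY rfl, f₃.real rY rfl, hY₂]
  have hA₄ : s₄.real rLA = A := by rw [f₄.real rLA rfl, hA₃]
  have hC₄ : s₄.real rLC = C := by rw [f₄.real rLC rfl, f₃.real rLC rfl, hC]
  refine Runs.seq ((reachLeft_runs hn₄ hm₄ hB (hX₄ ▸ monoX) (hA₄ ▸ monoA)
    (hK ▸ fun j hj => (h₄ j hj).1)).mono (le_coverFactor (by omega) (by omega) le_rfl)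
    fun _ _ h => h) fun s₅ f₅ h₅ => ?_
  rw [hX₄, hY₄, hA₄, hC₄, hK] at h₅
  obtain ⟨l, hl⟩ : ∃ l, s₅.word gL = l := ⟨_, rfl⟩
  rw [hl] at h₅
  have hK₅ : s₅.word gKs = K := by rw [f₅.word gKs rfl, hK]
  have hn₅ : s₅.word 0 0 = n := by rw [f₅.word 0 rfl, hn₄]
  have hm₅ : s₅.word 0 1 = m := by rw [f₅.word 0 rfl, hm₄]
  have hX₅ : s₅.real rX = X := by rw [f₅.real rX rfl, hX₄]
  have hY₅ : s₅.real rY = Y := by rw [f₅.real rY rfl, hY₄]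
  have hA₅ : s₅.real rLA = A := by rw [f₅.real rLA rfl, hA₄]
  have hC₅ : s₅.real rLC = C := by rw [f₅.real rLC rfl, hC₄]
  refine Runs.seq ((reachRight_runs hn₅ hm₅ hB (hX₅ ▸ monoX) (hA₅ ▸ monoA)
    (hK₅ ▸ fun j hj => (h₄ j hj).1)).mono (le_coverFactor (by omega) (by omega) le_rfl)
    fun _ _ h => h) fun s₆ f₆ h₆ => ?_
  rw [hX₅, hY₅, hA₅, hC₅, hK₅] at h₆
  obtain ⟨r, hr⟩ : ∃ r, s₆.word tPos = r := ⟨_, rfl⟩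
  rw [hr] at h₆
  have hn₆ : s₆.word 0 0 = n := by rw [f₆.word 0 rfl, hn₅]
  have hm₆ : s₆.word 0 1 = m := by rw [f₆.word 0 rfl, hm₅]
  have hl₆ : s₆.word gL = l := by rw [f₆.word gL rfl, hl]
  have hsys : IsRunSystem X Y A C n m c K l r :=
    { monoX := monoX
      c_lt := fun u hu hpos => (h₃ u hu hpos).1
      c_max := fun u hu q hq => (h₃ u hu (by omega)).2 q hq
      K_le := fun j hj => (h₄ j hj).1
      lt_K := fun j hj => (h₄ j hj).2.1
      at_K := fun j hj => (h₄ j hj).2.2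
      right := h₆
      l_le := fun j hj => (h₅ j hj).1
      left := fun j hj => (h₅ j hj).2.1
      l_bad := fun j hj => (h₅ j hj).2.2 }
  have hrn : ∀ j < m, r j ≤ n := fun j hj => hsys.r_le hj
  have hln : ∀ j < m, l j ≤ n := fun j hj => (hsys.l_le j hj).trans (hsys.K_le j hj)
  refine Runs.seq ((buckets_runs hn₆ hm₆ (by omega) (hl₆ ▸ hln) (hr ▸ hrn)).mono
    (hlin _ (by omega)) fun _ _ h => h) fun s₇ f₇ h₇ => ?_
  have hl₇ : s₇.word gL = l := by rw [f₇.word gL rfl, hl₆]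
  have hr₇ : s₇.word tPos = r := by rw [f₇.word tPos rfl, hr]
  have hτ₇ : s₇.word gIdx = τ := by
    rw [f₇.word gIdx rfl, f₆.word gIdx rfl, f₅.word gIdx rfl, f₄.word gIdx rfl, f₃.word gIdx rfl,
      hs₂]
  have hn₇ : s₇.word 0 0 = n := by rw [f₇.word 0 rfl, hn₆]
  rw [hl₆, hr] at h₇
  refine (sweep_runs hn₇ (by omega) (hr₇ ▸ hrn) (hτ₇ ▸ hτ.lt)
    (by rw [hl₇, hr₇]; exact h₇)).mono (hlin _ (by omega)) fun v _ hv => ?_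
  rw [hl₇, hr₇, hτ₇] at hv
  exact ⟨X, Y, A, C, σ, τ, c, K, l, r, hσ, hXY, hτ, hAC, hsys, hv⟩

theorem coverFactor_isBigO :
    (fun N : ℕ => (coverFactor N : ℝ)) =O[Filter.atTop] fun N : ℕ => (N : ℝ) * Real.log N := by
  refine Asymptotics.IsBigO.of_bound (3 * (3 / Real.log 2)) ?_
  filter_upwards [Filter.eventually_ge_atTop 2] with N hN
  have hN2 : (2 : ℝ) ≤ N := by exact_mod_cast hN
  have hlog2 : 0 < Real.log 2 := Real.log_pos one_lt_two
  have hlogN : Real.log 2 ≤ Real.log N := Real.log_le_log two_pos hN2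
  have h1 : (Nat.log 2 N : ℝ) ≤ Real.log N / Real.log 2 := by
    rw [le_div_iff₀ hlog2, ← Real.log_pow]
    refine Real.log_le_log (by positivity) ?_
    exact_mod_cast Nat.pow_log_le_self 2 (by omega)
  have h2 : (1 : ℝ) ≤ Real.log N / Real.log 2 := (one_le_div hlog2).2 hlogN
  rw [Real.norm_of_nonneg (by positivity),
    Real.norm_of_nonneg (mul_nonneg (by positivity) (hlog2.le.trans hlogN))]
  calc (coverFactor N : ℝ) = (2 * N + 2) * (Nat.log 2 N + 2) := by
        simp [coverFactor]
    -- For `N ≥ 2` one has `2 ≤ N` and `1 ≤ log N / log 2`, so both factors are at most three times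
    -- their main terms.
    _ ≤ (3 * N) * (3 * (Real.log N / Real.log 2)) :=
        mul_le_mul (by linarith) (by linarith) (by positivity) (by positivity)
    _ = 3 * (3 / Real.log 2) * (N * Real.log N) := by ring

/-- The sorted input points are the input points. -/
theorem listsPoints_of_sorting {points : List (ℝ × ℝ)} {halfplanes : List LowerHalfplane}
    {X Y : ℕ → ℝ} {σ : ℕ → ℕ}
    (hσ : IsSorting ((inputStore points halfplanes).real 0) points.length σ)
    (h : ∀ i < points.length, X i = (inputStore points halfplanes).real 0 (σ i) ∧
      Y i = (inputStore points halfplanes).real 1 (σ i)) :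
    ListsPoints {q | q ∈ points} X Y points.length := by
  have key : ∀ i < points.length, ∀ hi : σ i < points.length, (X i, Y i) = points[σ i] := by
    intro i hi hlt
    rw [(h i hi).1, (h i hi).2]
    simp [inputStore, List.getD_eq_getElem?_getD, hlt]
  refine ⟨fun u hu => ?_, fun p hp => ?_⟩
  · rw [key u hu (hσ.lt u hu)]
    exact List.getElem_mem _
  · obtain ⟨v, hv, rfl⟩ := List.getElem_of_mem hp
    obtain ⟨u, hu, rfl⟩ := hσ.surj v hv
    exact ⟨u, hu, key u hu hv⟩

theorem getElem?_of_sorting {points : List (ℝ × ℝ)} {halfplanes : List LowerHalfplane}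
    {A C : ℕ → ℝ} {τ : ℕ → ℕ}
    (hτ : IsSorting ((inputStore points halfplanes).real 2) halfplanes.length τ)
    (h : ∀ i < halfplanes.length, A i = (inputStore points halfplanes).real 2 (τ i) ∧
      C i = (inputStore points halfplanes).real 3 (τ i)) {i : ℕ} (hi : i < halfplanes.length) :
    halfplanes[τ i]? = some ⟨A i, C i⟩ := by
  have hlt := hτ.lt i hi
  rw [(h i hi).1, (h i hi).2]
  simp [inputStore, List.getD_eq_getElem?_getD, hlt]

/-- The sorted input halfplanes are the input halfplanes. -/
theorem listsHalfplanes_of_sorting {halfplanes : List LowerHalfplane} {A C : ℕ → ℝ} {τ : ℕ → ℕ}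
    {key : ℕ → ℝ} (hτ : IsSorting key halfplanes.length τ)
    (h : ∀ i < halfplanes.length, halfplanes[τ i]? = some ⟨A i, C i⟩) :
    ListsHalfplanes {g | g ∈ halfplanes} A C halfplanes.length := by
  refine ⟨fun q hq => List.mem_of_getElem? (h q hq), fun g hg => ?_⟩
  obtain ⟨v, hv, rfl⟩ := List.getElem_of_mem hg
  obtain ⟨u, hu, rfl⟩ := hτ.surj v hv
  refine ⟨u, hu, ?_⟩
  have := h u hu
  rw [List.getElem?_eq_getElem hv] at this
  exact (Option.some.inj this).symm

end RealRAM

theorem mainTheorem2 :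
    ∃ (program : RealRAM.Program) (c : ℕ) (T : ℕ → ℕ),
      ((fun n : ℕ => (T n : ℝ)) =O[Filter.atTop] fun n : ℕ => (n : ℝ) * Real.log (n : ℝ)) ∧
      ∀ (points : List (ℝ × ℝ)) (halfplanes : List LowerHalfplane) (n : ℕ),
        n = points.length + halfplanes.length →
        ∃ (t : ℕ) (s : RealRAM.Store),
          RealRAM.Exec ((n + 2) ^ c) program (inputStore points halfplanes) t s ∧
          t ≤ T n ∧
          (Covers {q | q ∈ points} {h | h ∈ halfplanes} →
            ∃ S : Set LowerHalfplane,
              IsSmallestCover {q | q ∈ points} {h | h ∈ halfplanes} S ∧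
              ReportsSubset s halfplanes S) ∧
          (¬ Covers {q | q ∈ points} {h | h ∈ halfplanes} → ReportsInfeasible s) := by
  refine ⟨coverProgram, 4, fun n => coverProgram.weight * coverFactor n, ?_, ?_⟩
  · simp only [Nat.cast_mul]
    exact coverFactor_isBigO.const_mul_left _
  rintro points halfplanes n rfl
  -- The exponent 4 suffices because the cube of a number that is at least 2 already absorbs the
  -- constant 8.
  have hB : 8 * (points.length + halfplanes.length + 1) <
      (points.length + halfplanes.length + 2) ^ 4 := by
    generalize points.length + halfplanes.length = N
    have : 2 ^ 3 ≤ (N + 2) ^ 3 := Nat.pow_le_pow_left (by omega) 3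
    calc 8 * (N + 1) < 2 ^ 3 * (N + 2) := by omega
      _ ≤ (N + 2) ^ 3 * (N + 2) := Nat.mul_le_mul_right _ this
      _ = (N + 2) ^ 4 := by ring
  obtain ⟨t, v, hx, ht, X, Y, A, C, σ, τ, c, K, l, r, hσ, hXY, hτ, hAC, hsys, hv⟩ :=
    coverProgram_runs (s := inputStore points halfplanes) (n := points.length)
      (m := halfplanes.length) rfl rfl hB
  have hP := listsPoints_of_sorting hσ hXY
  have hget : ∀ i < halfplanes.length, halfplanes[τ i]? = some ⟨A i, C i⟩ :=
    fun i hi => getElem?_of_sorting hτ hAC hi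
  have hH := listsHalfplanes_of_sorting hτ hget
  refine ⟨t, v, hx, ht, ?_⟩
  rcases hv with ⟨hok, out, hg, hcov, hsol⟩ | ⟨hok, i, hi, hstuck⟩
  · obtain ⟨hnd, hsm⟩ := hg.isSmallestCover hP hH hsys hcov
    refine ⟨fun _ => ⟨_, hsm, hok, _, hnd, rfl, ?_⟩, fun hn => ?_⟩
    · rw [List.map_map]
      refine List.map_congr_left fun t ht => ?_
      rw [List.mem_range] at ht
      rw [hsol t ht]
      exact hget _ (hg t ht).1
    -- The chosen subset covers the points, so the set of all given halfplanes does too.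
    · refine (hn ?_).elim
      rw [covers_iff]
      intro p hp
      obtain ⟨g, hgS, hle⟩ := covers_iff.1 hsm.2.1 p hp
      exact ⟨g, hsm.1 hgS, hle⟩
  · refine ⟨fun hc => ?_, fun _ => hok⟩
    exact (hsys.not_feasible hi hstuck ((covers_iff_feasible hP hH).1 hc)).elim
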